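/- Let $n\in\mathbb N$, $\alpha,\beta,b>0$, $p\in(0,\tfrac12]$. For $x\in\mathbb R^n$ put $\phi_1(x)=(\alpha\|x\|^{-p}+\beta)x$ (with $\phi_1(0)=0$) and, for $x\neq0$, $c(x)=\alpha(1-p)\|x\|^{-p}+\beta$, $\phi_2(x)=c(x)\phi_1(x)$, $J(x)=\partial\phi_1/\partial x=(\alpha\|x\|^{-p}+\beta)I-\alpha p\,\|x\|^{-p-2}xx^{T}$ and $\mathcal J(x)=J(x)/c(x)$. Write $\mathrm{Sym}\{M\}=\frac12(M+M^T)$, $\mathrm{Gram}\{M\}=M^TM$, let $\|\cdot\|$ be the Euclidean (spectral) norm, and compare symmetric matrices in the Loewner order. Fix constants $0<g_m^\Delta\le g_M^\Delta$, $0<\gamma_1^\Delta\le\gamma_2^\Delta$, $\gamma_3,\gamma_4,\gamma_5\ge0$ and (arbitrarily large) $\delta_1,\delta_2,\delta_3\ge0$. Consider all systems $$\dot x=f(t,x)+G(t,x)u,\qquad G=(I+\Delta_G)G_0,\qquad f=\Delta_1\phi_1+f_2,\qquad t\ge0,\ x,u\in\mathbb R^n,$$ where $f,G_0,\Delta_G$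 are measurable in $t$ and continuous in $x$, $G_0(t,x)$ is invertible, and $h=(I+\Delta_G)^{-1}f_2$ satisfies the following: along every absolutely continuous curve $x(\cdot)$, $t\mapsto h(t,x(t))$ is absolutely continuous and $$\tfrac{d}{dt}h(t,x(t))=\Delta_2(t,x)\phi_2(x)+\Delta_3(t,x)\dot x$$ for almost every $t$ with $x(t)\ne0$. Assume that for all $t\ge0$ and all $x$ (all $x\ne0$ where $\mathcal J$ occurs): 1. $g_m^\Delta I\le G+G^T\le g_M^\Delta I$; 2. $\|\Delta_i\|\le\delta_i$ for $i=1,2,3$; 3. $\gamma_1^\Delta I\le 2\,\mathrm{Sym}\{\mathcal J(I+\Delta_G)\}\le\gamma_2^\Delta I$; 4. $\mathrm{Gram}\{\mathcal JG\}\le\gamma_3I$, $2\,\mathrm{Sym}\{\Delta_G\mathcal JG\}\le\gamma_4I$, $\mathrm{Gram}\{\Delta_G^T\}\le\gamma_5I$. Suppose $\gamma_1^\Delta g_m^\Delta>\gamma_4+2\sqrt{\gamma_3\gamma_5}$. Then there exist constant gains $k_1,k_2>0$, depending only on $n$, $\alpha,\beta,b,p$ and the constants above, such that for the controller $$u=-k_1\phi_1(x)+bG_0^{-1}(t,x)v,\qquad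 \dot v=-k_2\phi_2(x)$$ the origin $(x,z)=0$, where $z=v+b^{-1}(I+\Delta_G)^{-1}f_2$, is globally robustly finite-time stable. That is, with solutions of the closed loop understood in the sense of Filippov (absolutely continuous, with $\phi_2$ replaced by its Filippov regularization): for each such system and each $t_0\ge0$, every initial condition $(x_0,v_0)$ admits a solution on $[t_0,\infty)$, and every solution on a bounded interval $[t_0,\tau)$ extends to $[t_0,\infty)$; for every $\varepsilon>0$ there is $\delta>0$ such that $\|x(t_0)\|,\|z(t_0)\|<\delta$ implies $\|x(t)\|,\|z(t)\|<\varepsilon$ for all $t\ge t_0$; and for every $R>0$ there is $T>0$ such that $\|x(t_0)\|,\|z(t_0)\|\le R$ implies $x(t)=0$ and $z(t)=0$ for all $t\ge t_0+T$. Here $\delta$ and $T$ do not depend on the system, on $t_0$ or on the solution. -/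

import Mathlib

open MeasureTheory Set

noncomputable section

namespace MGSTA

/-- The state space `ℝⁿ` with the Euclidean norm. -/
abbrev Vec (n : ℕ) := EuclideanSpace ℝ (Fin n)

/-- Real `n × n` matrices, as linear operators on Euclidean space. The norm is the spectral norm,
the adjoint is the transpose, and `≤` is the Loewner order (`A ≤ B` iff `B - A` is symmetric
positive semidefinite). -/
abbrev Mat (n : ℕ) := Vec n →L[ℝ] Vec n

variable {n : ℕ}

/-- The symmetric part `(M + Mᵀ) / 2`. -/
def sym (M : Mat n) : Mat n := (1 / 2 : ℝ) • (M + M.adjoint)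

/-- The Gramian `Mᵀ M`. -/
def gram (M : Mat n) : Mat n := M.adjoint ∘L M

/-- The parameters chosen freely by the designer. -/
structure Design where
  α : ℝ
  β : ℝ
  b : ℝ
  p : ℝ

/-- `α > 0`, `β > 0`, `b > 0`, `p ∈ (0, 1/2]`. -/
structure Design.Valid (P : Design) : Prop where
  α_pos : 0 < P.α
  β_pos : 0 < P.β
  b_pos : 0 < P.b
  p_pos : 0 < P.p
  p_le : P.p ≤ 1 / 2

namespace Design

variable (P : Design)

/-- `φ₁(x) = (α ‖x‖^{-p} + β) x`; the value at `0` is `0`. -/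
def φ₁ (x : Vec n) : Vec n := (P.α * ‖x‖ ^ (-P.p) + P.β) • x

/-- `c(x) = α (1 - p) ‖x‖^{-p} + β`, meaningful for `x ≠ 0`. -/
def c (x : Vec n) : ℝ := P.α * (1 - P.p) * ‖x‖ ^ (-P.p) + P.β

/-- `φ₂(x) = c(x) φ₁(x)`, meaningful for `x ≠ 0`. -/
def φ₂ (x : Vec n) : Vec n := P.c x • P.φ₁ x

/-- The Jacobian of `φ₁` at `x ≠ 0`:
`J(x) = (α ‖x‖^{-p} + β) I - α p (‖x‖^{-p} / ‖x‖²) x xᵀ`. -/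
def J (x : Vec n) : Mat n :=
  (P.α * ‖x‖ ^ (-P.p) + P.β) • (1 : Mat n)
    - (P.α * P.p * (‖x‖ ^ (-P.p) / ‖x‖ ^ 2)) • InnerProductSpace.rankOne ℝ x x

/-- The normalized Jacobian `𝒥(x) = J(x) / c(x)`, for `x ≠ 0`. -/
def Jn (x : Vec n) : Mat n := (P.c x)⁻¹ • P.J x

end Design

/-- The constants bounding the uncertainty. -/
structure Bounds where
  gm : ℝ
  gM : ℝ
  γ₁ : ℝ
  γ₂ : ℝ
  γ₃ : ℝ
  γ₄ : ℝ
  γ₅ : ℝ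
  δ₁ : ℝ
  δ₂ : ℝ
  δ₃ : ℝ

/-- The sign conditions on the constants. -/
structure Bounds.Valid (B : Bounds) : Prop where
  gm_pos : 0 < B.gm
  gm_le : B.gm ≤ B.gM
  γ₁_pos : 0 < B.γ₁
  γ₁_le : B.γ₁ ≤ B.γ₂
  γ₃_nonneg : 0 ≤ B.γ₃
  γ₄_nonneg : 0 ≤ B.γ₄
  γ₅_nonneg : 0 ≤ B.γ₅
  δ₁_nonneg : 0 ≤ B.δ₁
  δ₂_nonneg : 0 ≤ B.δ₂
  δ₃_nonneg : 0 ≤ B.δ₃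

/-- The data of an uncertain system `ẋ = f(t,x) + G(t,x) u`: the nominal input matrix `G₀`, its
uncertainty `Δ_G`, the part `f₂` of the drift, and the matrices `Δ₁, Δ₂, Δ₃`.
Only times `t ≥ 0` matter. -/
structure System (n : ℕ) where
  G₀ : ℝ → Vec n → Mat n
  ΔG : ℝ → Vec n → Mat n
  f₂ : ℝ → Vec n → Vec n
  Δ₁ : ℝ → Vec n → Mat n
  Δ₂ : ℝ → Vec n → Mat n
  Δ₃ : ℝ → Vec n → Mat n

namespace System

variable (S : System n)

/-- `G = (I + Δ_G) G₀`. -/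
def G (t : ℝ) (x : Vec n) : Mat n := (1 + S.ΔG t x) ∘L S.G₀ t x

/-- `f = f₁ + f₂` with `f₁ = Δ₁ φ₁`. -/
def f (P : Design) (t : ℝ) (x : Vec n) : Vec n := S.Δ₁ t x (P.φ₁ x) + S.f₂ t x

/-- `h = (I + Δ_G)⁻¹ f₂`. -/
def h (t : ℝ) (x : Vec n) : Vec n := (1 + S.ΔG t x).inverse (S.f₂ t x)

end System

/-- `y` is absolutely continuous on `[t₀, t₁]` with (almost everywhere) derivative `η`. -/
def HasACDeriv (y η : ℝ → Vec n) (t₀ t₁ : ℝ) : Prop :=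
  IntervalIntegrable η volume t₀ t₁ ∧ ∀ t ∈ Icc t₀ t₁, y t = y t₀ + ∫ s in t₀..t, η s

/-- Carathéodory regularity on `t ≥ 0`: continuous in `x`, measurable in `t`. -/
def Caratheodory {F : Type*} [TopologicalSpace F] [MeasurableSpace F] (g : ℝ → Vec n → F) : Prop :=
  (∀ t, 0 ≤ t → Continuous (g t)) ∧ ∀ x, Measurable fun t : Ici (0 : ℝ) => g t x

/-- The standing assumptions on the uncertain system, for given constants. The conditions that
involve `𝒥(x)` are imposed for `x ≠ 0`, where `𝒥` is defined. -/
structure System.Admissible (S : System n) (P : Design) (B : Bounds) : Prop where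
  G₀_reg : Caratheodory S.G₀
  ΔG_reg : Caratheodory S.ΔG
  f_reg : Caratheodory (S.f P)
  G₀_inv : ∀ t x, 0 ≤ t → (S.G₀ t x).IsInvertible
  /-- `d/dt [(I + Δ_G)⁻¹ f₂] = Δ₂ φ₂ + Δ₃ ẋ` along every absolutely continuous curve `x`, at
  almost every time at which `x ≠ 0`. Since `G` is invertible, these curves are exactly the
  trajectories of `ẋ = f + G u` for the various inputs `u`. -/
  h_deriv : ∀ (t₀ t₁ : ℝ) (x ξ : ℝ → Vec n), 0 ≤ t₀ → t₀ ≤ t₁ → HasACDeriv x ξ t₀ t₁ →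
    ∃ η : ℝ → Vec n, HasACDeriv (fun t => S.h t (x t)) η t₀ t₁ ∧
      ∀ᵐ s, s ∈ Icc t₀ t₁ → x s ≠ 0 →
        η s = S.Δ₂ s (x s) (P.φ₂ (x s)) + S.Δ₃ s (x s) (ξ s)
  G_lower : ∀ t x, 0 ≤ t → B.gm • (1 : Mat n) ≤ S.G t x + (S.G t x).adjoint
  G_upper : ∀ t x, 0 ≤ t → S.G t x + (S.G t x).adjoint ≤ B.gM • (1 : Mat n)
  Δ₁_le : ∀ t x, 0 ≤ t → ‖S.Δ₁ t x‖ ≤ B.δ₁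
  Δ₂_le : ∀ t x, 0 ≤ t → ‖S.Δ₂ t x‖ ≤ B.δ₂
  Δ₃_le : ∀ t x, 0 ≤ t → ‖S.Δ₃ t x‖ ≤ B.δ₃
  γ₁_bound : ∀ t x, 0 ≤ t → x ≠ 0 →
    B.γ₁ • (1 : Mat n) ≤ (2 : ℝ) • sym (P.Jn x ∘L (1 + S.ΔG t x))
  γ₂_bound : ∀ t x, 0 ≤ t → x ≠ 0 →
    (2 : ℝ) • sym (P.Jn x ∘L (1 + S.ΔG t x)) ≤ B.γ₂ • (1 : Mat n)
  γ₃_bound : ∀ t x, 0 ≤ t → x ≠ 0 → gram (P.Jn x ∘L S.G t x) ≤ B.γ₃ • (1 : Mat n)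
  γ₄_bound : ∀ t x, 0 ≤ t → x ≠ 0 →
    (2 : ℝ) • sym (S.ΔG t x ∘L P.Jn x ∘L S.G t x) ≤ B.γ₄ • (1 : Mat n)
  γ₅_bound : ∀ t x, 0 ≤ t → gram (S.ΔG t x).adjoint ≤ B.γ₅ • (1 : Mat n)

/-- The Filippov regularization of a vector field:
`⋂_{r > 0} ⋂_{N null} closed convex hull of g (ball x r \ N)`. -/
def filippov (g : Vec n → Vec n) (x : Vec n) : Set (Vec n) :=
  ⋂ (r : ℝ) (_ : 0 < r) (N : Set (Vec n)) (_ : volume N = 0),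
    closedConvexHull ℝ (g '' (Metric.ball x r \ N))

namespace System

variable (S : System n) (P : Design) (k₁ k₂ : ℝ)

/-- The control `u = -k₁ φ₁(x) + b G₀(t,x)⁻¹ v`. -/
def control (t : ℝ) (x v : Vec n) : Vec n :=
  -(k₁ • P.φ₁ x) + P.b • (S.G₀ t x).inverse v

/-- `(x, v)` is a (Filippov) solution on `[t₀, t₁]` of the closed loop
`ẋ = f(t,x) + G(t,x) u`, `v̇ = -k₂ φ₂(x)`. As `f`, `G`, `G₀` and `φ₁` are continuous in the state,
only `φ₂` has to be regularized. -/
def IsSolution (t₀ t₁ : ℝ) (x v : ℝ → Vec n) : Prop :=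
  HasACDeriv x (fun s => S.f P s (x s) + S.G s (x s) (S.control P k₁ s (x s) (v s))) t₀ t₁ ∧
  ∃ w : ℝ → Vec n, (∀ᵐ s, s ∈ Icc t₀ t₁ → w s ∈ filippov P.φ₂ (x s)) ∧
    HasACDeriv v (fun s => -(k₂ • w s)) t₀ t₁

/-- A solution on `[t₀, ∞)`. -/
def IsGlobalSolution (t₀ : ℝ) (x v : ℝ → Vec n) : Prop :=
  ∀ t₁, t₀ ≤ t₁ → S.IsSolution P k₁ k₂ t₀ t₁ x v

/-- The variable `z = v + b⁻¹ (I + Δ_G)⁻¹ f₂` along `(x, v)`. -/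
def z (x v : ℝ → Vec n) (t : ℝ) : Vec n := v t + P.b⁻¹ • S.h t (x t)

end System

/-- Global robust finite-time stability of `(x, z) = 0` with the gains `k₁, k₂`: for all systems
that are admissible for the given constants, solutions exist and are forward complete, and the
origin is Lyapunov stable and globally attractive in finite time; both properties are uniform
over all these systems and all initial times. -/
structure GloballyRobustlyFiniteTimeStable (n : ℕ) (P : Design) (B : Bounds) (k₁ k₂ : ℝ) :
    Prop where
  /-- Every initial condition is the start of a solution on `[t₀, ∞)`. -/
  exists_solution : ∀ S : System n, S.Admissible P B → ∀ t₀ : ℝ, 0 ≤ t₀ → ∀ x₀ v₀ : Vec n,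
    ∃ x v : ℝ → Vec n, S.IsGlobalSolution P k₁ k₂ t₀ x v ∧ x t₀ = x₀ ∧ v t₀ = v₀
  /-- Every solution on a bounded interval `[t₀, τ)` can be continued to `[t₀, ∞)`. -/
  continuation : ∀ S : System n, S.Admissible P B → ∀ t₀ τ : ℝ, 0 ≤ t₀ → t₀ < τ →
    ∀ x v : ℝ → Vec n, (∀ t₁, t₀ ≤ t₁ → t₁ < τ → S.IsSolution P k₁ k₂ t₀ t₁ x v) →
    ∃ x' v' : ℝ → Vec n, S.IsGlobalSolution P k₁ k₂ t₀ x' v' ∧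
      ∀ t ∈ Ico t₀ τ, x' t = x t ∧ v' t = v t
  stable : ∀ ε : ℝ, 0 < ε → ∃ δ : ℝ, 0 < δ ∧
    ∀ S : System n, S.Admissible P B → ∀ t₀ : ℝ, 0 ≤ t₀ →
    ∀ x v : ℝ → Vec n, S.IsGlobalSolution P k₁ k₂ t₀ x v →
      ‖x t₀‖ < δ → ‖S.z P x v t₀‖ < δ →
      ∀ t, t₀ ≤ t → ‖x t‖ < ε ∧ ‖S.z P x v t‖ < ε
  finite_time : ∀ R : ℝ, 0 < R → ∃ T : ℝ, 0 < T ∧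
    ∀ S : System n, S.Admissible P B → ∀ t₀ : ℝ, 0 ≤ t₀ →
    ∀ x v : ℝ → Vec n, S.IsGlobalSolution P k₁ k₂ t₀ x v →
      ‖x t₀‖ ≤ R → ‖S.z P x v t₀‖ ≤ R →
      ∀ t, t₀ + T ≤ t → x t = 0 ∧ S.z P x v t = 0

end MGSTA

end

/-! In the coordinates `(x, z)` the closed loop is `ẋ = Δ₁φ₁ - k₁Gφ₁ + b(I + Δ_G)z` and, where `x ≠
0`, `ż = -k₂φ₂ + b⁻¹(Δ₂φ₂ + Δ₃ẋ)`. The Lyapunov function is `V = (k₂/b)‖φ₁‖² - 2q φ₁·z + ‖z‖²`.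
Since `J` is symmetric, `Jφ₁ = cφ₁` and `φ₂ = cφ₁`, every term of `V̇` carries the factor `c`,
except the `Δ₃` terms, which are absorbed because `c ≥ β`. The weight `k₂/b` cancels the nominal
coupling of `φ₁` and `z`. After division by `c`, the leading part is at most `-(k₂/b)k₁g_m‖φ₁‖² +
2√(k₂²γ₅ + (qk₁)²γ₃ + k₂qk₁γ₄) ‖φ₁‖‖z‖ - qbγ₁‖z‖²`. With `s = k₂/(qk₁)` this form is negative
definite iff `s²γ₅ + γ₃ + sγ₄ < sγ₁g_m`, and some `s > 0` satisfies this precisely because `γ₁g_m >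
γ₄ + 2√(γ₃γ₅)`. Taking `q` large, and then `k₁` large compared with `q`, makes all remaining terms
negligible, however large the `δᵢ` are (`exists_gains_aux`, `exists_gains`).

Hence `V̇ ≤ -const · c V`. Since `c ≥ α(1-p)‖x‖^{-p}` and `V ≥ const · ‖x‖^{2(1-p)}`, the power
`V^θ` with `θ = p/(2(1-p))` decreases at a constant rate (`rpow_lyapDeriv_le`), which yields
finite-time convergence and stability uniformly in the system.

The difficulty is `x = 0`, where `φ₁` is not differentiable. If `x(u) = 0` and `z(u) ≠ 0`, then `x`
is nonzero on some interval to the right of `u` (`eventually_ne_zero`), so the decrease holds just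
after `u` and extends to `u` by continuity. One-sided comparison lemmas then give the global
estimate (`rpow_lyap_le`).

Existence comes from Euler polygons. Their limit solves the `x`-equation by dominated convergence,
and in the `v`-equation the defect concentrated on `{x = 0}` is shown to lie in the Filippov set
(`exists_filippov_selection`). For continuation, the decrease of `V` bounds the solution, which is
therefore Lipschitz up to the end of its interval and can be restarted there. -/

noncomputable section

open Filter Topology
open scoped InnerProductSpace

namespace MGSTA

variable {n : ℕ}

section

/-! ### Absolutely continuous curves -/

/-- The increments of `f` are dominated by those of a primitive of `ρ`, which is absolutely
continuous. -/
theorem absolutelyContinuousOnInterval_of_dist_le_integral {X : Type*} [PseudoMetricSpace X]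
    {f : ℝ → X} {ρ : ℝ → ℝ} {a b : ℝ} (hab : a ≤ b) (hρ : IntervalIntegrable ρ volume a b)
    (h : ∀ s ∈ Icc a b, ∀ t ∈ Icc a b, s ≤ t → dist (f s) (f t) ≤ ∫ τ in s..t, ρ τ) :
    AbsolutelyContinuousOnInterval f a b := by
  have hg := hρ.absolutelyContinuousOnInterval_intervalIntegral (c := a) (by simp)
  have key : ∀ s ∈ Icc a b, ∀ t ∈ Icc a b, s ≤ t →
      dist (f s) (f t) ≤ dist (∫ τ in a..s, ρ τ) (∫ τ in a..t, ρ τ) := by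
    intro s hs t ht hst
    rw [dist_comm (∫ τ in a..s, ρ τ), Real.dist_eq,
      intervalIntegral.integral_interval_sub_left]
    · exact (h s hs t ht hst).trans (le_abs_self _)
    · exact hρ.mono_set (by rw [uIcc_of_le hab, uIcc_of_le ht.1]; exact Icc_subset_Icc_right ht.2)
    · exact hρ.mono_set (by rw [uIcc_of_le hab, uIcc_of_le hs.1]; exact Icc_subset_Icc_right hs.2)
  refine squeeze_zero' (Eventually.of_forall fun _ => Finset.sum_nonneg fun _ _ => dist_nonneg)
    ?_ hg
  have hev : ∀ᶠ E in AbsolutelyContinuousOnInterval.totalLengthFilter ⊓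
      𝓟 (AbsolutelyContinuousOnInterval.disjWithin a b),
      E ∈ AbsolutelyContinuousOnInterval.disjWithin a b :=
    eventually_inf_principal.mpr (by simp)
  filter_upwards [hev] with E hE
  refine Finset.sum_le_sum fun i hi => ?_
  obtain ⟨h1, h2⟩ := hE.1 i hi
  rw [uIcc_of_le hab] at h1 h2
  rcases le_total (E.2 i).1 (E.2 i).2 with hle | hle
  · exact key _ h1 _ h2 hle
  · rw [dist_comm, dist_comm (∫ τ in a..(E.2 i).1, ρ τ)]
    exact key _ h2 _ h1 hle

theorem le_sub_mul_of_ae_hasDerivAt_le {g : ℝ → ℝ} {a b κ : ℝ} (hab : a ≤ b)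
    (hg : AbsolutelyContinuousOnInterval g a b)
    (h : ∀ᵐ s, s ∈ Ioo a b → ∃ D, HasDerivAt g D s ∧ D ≤ -κ) :
    g b ≤ g a - κ * (b - a) := by
  have h1 := hg.integral_deriv_eq_sub
  have h2 : ∫ x in a..b, deriv g x ≤ ∫ _ in a..b, (-κ) := by
    refine intervalIntegral.integral_mono_ae_restrict hab hg.intervalIntegrable_deriv (by simp) ?_
    rw [EventuallyLE, ← Measure.restrict_congr_set Ioo_ae_eq_Icc,
      ae_restrict_iff' measurableSet_Ioo]
    filter_upwards [h] with s hs hs'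
    obtain ⟨D, hD, hle⟩ := hs hs'
    rwa [hD.deriv]
  rw [h1, intervalIntegral.integral_const, smul_eq_mul] at h2
  linarith

/-- The decrease is required only where `W > 0`: against the barrier raised by `ε`, a point with `W
≤ 0` is passed by continuity alone. Thus nothing has to be known about trajectories at the origin.
-/
theorem le_max_of_eventually_decrease {W : ℝ → ℝ} {a b κ : ℝ} (hab : a ≤ b) (hκ : 0 ≤ κ)
    (hc : ContinuousOn W (Icc a b))
    (h : ∀ u ∈ Ico a b, 0 < W u → ∀ᶠ s in 𝓝[>] u, W s ≤ W u - κ * (s - u)) :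
    W b ≤ max (W a - κ * (b - a)) 0 := by
  refine le_of_forall_pos_le_add fun ε hε => ?_
  have hm : ContinuousOn (fun t => max (W a - κ * (t - a)) 0 + ε) (Icc a b) := by fun_prop
  have hcl : IsClosed ({t | W t ≤ max (W a - κ * (t - a)) 0 + ε} ∩ Icc a b) := by
    rw [inter_comm]
    exact isClosed_Icc.isClosed_le hc hm
  refine hcl.Icc_subset_of_forall_mem_nhdsWithin ?_ ?_ (right_mem_Icc.2 hab)
  · change W a ≤ max (W a - κ * (a - a)) 0 + ε
    rw [sub_self, mul_zero, sub_zero]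
    linarith [le_max_left (W a) 0]
  · rintro u ⟨hu, hu'⟩
    change W u ≤ max (W a - κ * (u - a)) 0 + ε at hu
    rcases lt_or_ge 0 (W u) with hpos | hneg
    · filter_upwards [h u hu' hpos, self_mem_nhdsWithin] with s hs hsu
      rcases max_cases (W a - κ * (u - a)) 0 with ⟨h1, _⟩ | ⟨h1, h2⟩
      · rw [h1] at hu
        linarith [le_max_left (W a - κ * (s - a)) 0]
      · rw [h1] at hu
        have : 0 ≤ κ * (s - u) := mul_nonneg hκ (sub_nonneg.2 (le_of_lt hsu))
        linarith [le_max_right (W a - κ * (s - a)) 0]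
    · have hcont : ContinuousWithinAt W (Ioi u) u := by
        refine (hc u (Ico_subset_Icc_self hu')).mono_of_mem_nhdsWithin ?_
        exact mem_of_superset (Ioo_mem_nhdsGT hu'.2)
          fun s hs => ⟨hu'.1.trans hs.1.le, hs.2.le⟩
      filter_upwards [hcont.eventually_lt_const (lt_of_le_of_lt hneg hε)] with s hs
      linarith [le_max_right (W a - κ * (s - a)) 0]

/-- Here the decrease is required only at points where the bound already holds, so that the bound
itself may be used to verify it. -/
theorem le_sub_mul_of_eventually_decrease {W : ℝ → ℝ} {a b κ : ℝ} (hab : a ≤ b)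
    (hc : ContinuousOn W (Icc a b))
    (h : ∀ u ∈ Ico a b, W u ≤ W a - κ * (u - a) → ∀ᶠ s in 𝓝[>] u, W s ≤ W u - κ * (s - u)) :
    W b ≤ W a - κ * (b - a) := by
  have hm : ContinuousOn (fun t => W a - κ * (t - a)) (Icc a b) := by fun_prop
  have hcl : IsClosed ({t | W t ≤ W a - κ * (t - a)} ∩ Icc a b) := by
    rw [inter_comm]
    exact isClosed_Icc.isClosed_le hc hm
  refine hcl.Icc_subset_of_forall_mem_nhdsWithin (by simp) ?_ (right_mem_Icc.2 hab)
  rintro u ⟨hu, hu'⟩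
  change W u ≤ W a - κ * (u - a) at hu
  filter_upwards [h u hu' hu] with s hs
  linarith

namespace HasACDeriv

variable {y η y' η' : ℝ → Vec n} {a b c d : ℝ}

theorem sub_eq (h : HasACDeriv y η a b) {s t : ℝ} (hs : s ∈ Icc a b) (ht : t ∈ Icc a b) :
    y t - y s = ∫ τ in s..t, η τ := by
  rw [h.2 t ht, h.2 s hs, add_sub_add_left_eq_sub, intervalIntegral.integral_interval_sub_left]
  · exact h.1.mono_set (by
      rw [uIcc_of_le (ht.1.trans ht.2), uIcc_of_le ht.1]; exact Icc_subset_Icc_right ht.2)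
  · exact h.1.mono_set (by
      rw [uIcc_of_le (ht.1.trans ht.2), uIcc_of_le hs.1]; exact Icc_subset_Icc_right hs.2)

theorem mono (h : HasACDeriv y η a b) (hac : a ≤ c) (hcd : c ≤ d) (hdb : d ≤ b) :
    HasACDeriv y η c d := by
  refine ⟨h.1.mono_set ?_, fun t ht => ?_⟩
  · rw [uIcc_of_le hcd, uIcc_of_le (hac.trans (hcd.trans hdb))]
    exact Icc_subset_Icc hac hdb
  · rw [← h.sub_eq ⟨hac, hcd.trans hdb⟩ ⟨hac.trans ht.1, ht.2.trans hdb⟩]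
    abel

theorem norm_sub_le (h : HasACDeriv y η a b) {s t : ℝ} (hs : s ∈ Icc a b) (ht : t ∈ Icc a b)
    (hst : s ≤ t) : ‖y t - y s‖ ≤ ∫ τ in s..t, ‖η τ‖ := by
  rw [h.sub_eq hs ht]
  exact intervalIntegral.norm_integral_le_integral_norm hst

theorem absolutelyContinuous (h : HasACDeriv y η a b) (hab : a ≤ b) :
    AbsolutelyContinuousOnInterval y a b := by
  refine absolutelyContinuousOnInterval_of_dist_le_integral hab h.1.norm fun s hs t ht hst => ?_
  rw [dist_comm, dist_eq_norm]
  exact h.norm_sub_le hs ht hst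

theorem continuousOn (h : HasACDeriv y η a b) (hab : a ≤ b) : ContinuousOn y (Icc a b) := by
  have := (h.absolutelyContinuous hab).continuousOn
  rwa [uIcc_of_le hab] at this

theorem ae_hasDerivAt (h : HasACDeriv y η a b) :
    ∀ᵐ s, s ∈ Ioo a b → HasDerivAt y (η s) s := by
  filter_upwards [h.1.ae_hasDerivAt_integral] with s hs hs'
  have hab : a ≤ b := hs'.1.le.trans hs'.2.le
  rw [uIcc_of_le hab] at hs
  have h1 := (hs (Ioo_subset_Icc_self hs') a (left_mem_Icc.2 hab)).const_add (y a)
  refine h1.congr_of_eventuallyEq ?_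
  filter_upwards [Ioo_mem_nhds hs'.1 hs'.2] with t ht
  exact h.2 t (Ioo_subset_Icc_self ht)

theorem trans (h₁ : HasACDeriv y η a b) (h₂ : HasACDeriv y η b c) (hab : a ≤ b) (hbc : b ≤ c) :
    HasACDeriv y η a c := by
  refine ⟨h₁.1.trans h₂.1, fun t ht => ?_⟩
  rcases le_total t b with htb | htb
  · exact h₁.2 t ⟨ht.1, htb⟩
  · have hbt : IntervalIntegrable η volume b t := h₂.1.mono_set (by
      rw [uIcc_of_le hbc, uIcc_of_le htb]; exact Icc_subset_Icc_right ht.2)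
    rw [h₂.2 t ⟨htb, ht.2⟩, h₁.2 b (right_mem_Icc.2 hab), add_assoc,
      intervalIntegral.integral_add_adjacent_intervals h₁.1 hbt]

theorem congr (h : HasACDeriv y η a b) (hab : a ≤ b) (hy : ∀ t ∈ Icc a b, y' t = y t)
    (hη : ∀ᵐ s, s ∈ Ioo a b → η' s = η s) : HasACDeriv y' η' a b := by
  have hae : ∀ t ∈ Icc a b, ∀ᵐ s, s ∈ uIoc a t → η s = η' s := by
    intro t ht
    have hne : ∀ᵐ s : ℝ, s ≠ t := by simp [ae_iff, measure_singleton]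
    filter_upwards [hη, hne] with s hs hst hs'
    rw [uIoc_of_le ht.1] at hs'
    exact (hs ⟨hs'.1, lt_of_lt_of_le (lt_of_le_of_ne hs'.2 hst) ht.2⟩).symm
  refine ⟨h.1.congr_ae ?_, fun t ht => ?_⟩
  · rw [EventuallyEq, ae_restrict_iff' measurableSet_uIoc]
    exact hae b (right_mem_Icc.2 hab)
  · rw [hy t ht, hy a (left_mem_Icc.2 hab), h.2 t ht,
      intervalIntegral.integral_congr_ae (hae t ht)]

theorem add (h : HasACDeriv y η a b) (h' : HasACDeriv y' η' a b) :
    HasACDeriv (fun t => y t + y' t) (fun t => η t + η' t) a b := by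
  refine ⟨h.1.add h'.1, fun t ht => ?_⟩
  have hs : uIcc a t ⊆ uIcc a b := by
    rw [uIcc_of_le (ht.1.trans ht.2), uIcc_of_le ht.1]; exact Icc_subset_Icc_right ht.2
  simp only [intervalIntegral.integral_add (h.1.mono_set hs) (h'.1.mono_set hs), h.2 t ht,
    h'.2 t ht]
  abel

theorem const_smul (h : HasACDeriv y η a b) (r : ℝ) :
    HasACDeriv (fun t => r • y t) (fun t => r • η t) a b := by
  refine ⟨h.1.smul r, fun t ht => ?_⟩
  simp only [intervalIntegral.integral_smul, h.2 t ht, smul_add]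

/-- The Lipschitz bound makes the derivative bounded, hence integrable. The difference of `y` and
the primitive of its derivative is absolutely continuous with zero derivative almost everywhere,
hence constant. -/
theorem of_lipschitzOnWith {K : NNReal} (hab : a ≤ b) (hy : LipschitzOnWith K y (Icc a b))
    (h : ∀ᵐ s, s ∈ Ioo a b → HasDerivAt y (η s) s) : HasACDeriv y η a b := by
  have hbd : ∀ᵐ s, s ∈ Ioo a b → ‖deriv y s‖ ≤ K := by
    filter_upwards [h] with s hs hs'
    rw [(hs hs').deriv]
    exact (hs hs').le_of_lipschitzOn (Icc_mem_nhds hs'.1 hs'.2) hy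
  have hint : IntervalIntegrable (deriv y) volume a b := by
    rw [intervalIntegrable_iff_integrableOn_Ioo_of_le hab]
    refine Measure.integrableOn_of_bounded (M := K) (by simp)
      (measurable_deriv y).aestronglyMeasurable ?_
    rw [ae_restrict_iff' measurableSet_Ioo]
    exact hbd
  have hac : AbsolutelyContinuousOnInterval y a b := by
    refine LipschitzOnWith.absolutelyContinuousOnInterval (K := K) ?_
    rwa [uIcc_of_le hab]
  have hbase : HasACDeriv (fun t => y a + ∫ s in a..t, deriv y s) (deriv y) a b :=
    ⟨hint, fun t _ => by simp⟩
  have hsub := hac.sub (hbase.absolutelyContinuous hab)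
  have hne : ∀ᵐ s : ℝ, s ≠ a ∧ s ≠ b := by
    have h1 : ∀ᵐ s : ℝ, s ≠ a := by simp [ae_iff, measure_singleton]
    have h2 : ∀ᵐ s : ℝ, s ≠ b := by simp [ae_iff, measure_singleton]
    exact h1.and h2
  obtain ⟨C, hC⟩ := hsub.const_of_ae_hasDerivAt_zero (by
    filter_upwards [h, hbase.ae_hasDerivAt, hne] with s h1 h2 hs hs'
    rw [uIcc_of_le hab] at hs'
    have hs'' : s ∈ Ioo a b := ⟨lt_of_le_of_ne hs'.1 hs.1.symm, lt_of_le_of_ne hs'.2 hs.2⟩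
    have := (h1 hs'').sub (h2 hs'')
    rwa [(h1 hs'').deriv, sub_self] at this)
  rw [uIcc_of_le hab] at hC
  have hC0 : C = 0 := by
    rw [← hC a (left_mem_Icc.2 hab)]; simp
  refine hbase.congr hab (fun t ht => ?_) ?_
  · have := hC t ht
    rw [hC0] at this
    exact sub_eq_zero.1 this
  · filter_upwards [h] with s hs hs'
    exact (hs hs').deriv.symm

end HasACDeriv

/-- Near `u` the curve stays where `x ≠ 0` and where the `C¹` function `Φ` is Lipschitz. So `Φ`
along the curve is absolutely continuous there, and the almost-everywhere bound can be integrated.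
-/
theorem eventually_decrease_of_ae_deriv_le {x z ξ ζ : ℝ → Vec n} {a b κ u : ℝ}
    (hx : HasACDeriv x ξ a b) (hz : HasACDeriv z ζ a b) (hu : u ∈ Ico a b)
    {Φ : Vec n × Vec n → ℝ} (hΦ : ContDiffAt ℝ 1 Φ (x u, z u)) (hxu : x u ≠ 0)
    (hD : ∀ᵐ s, s ∈ Ioo a b → x s ≠ 0 →
      ∃ D, HasDerivAt (fun t => Φ (x t, z t)) D s ∧ D ≤ -κ) :
    ∀ᶠ s in 𝓝[>] u, Φ (x s, z s) ≤ Φ (x u, z u) - κ * (s - u) := by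
  obtain ⟨K, U, hU, hLip⟩ := hΦ.exists_lipschitzOnWith
  have hab : a ≤ b := hu.1.trans hu.2.le
  have hmem : u ∈ Icc a b := ⟨hu.1, hu.2.le⟩
  have hcx := (hx.continuousOn hab) u hmem
  have hcz := (hz.continuousOn hab) u hmem
  have hev : ∀ᶠ s in 𝓝[Icc a b] u, (x s, z s) ∈ U ∧ x s ≠ 0 :=
    ((hcx.prodMk hcz).eventually hU).and (hcx.eventually_ne hxu)
  have hev' : ∀ᶠ s in 𝓝[≥] u, (x s, z s) ∈ U ∧ x s ≠ 0 := by
    refine hev.filter_mono (nhdsWithin_le_of_mem ?_)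
    exact mem_of_superset (Icc_mem_nhdsGE hu.2) (Icc_subset_Icc_left hu.1)
  obtain ⟨r, hr, hrU⟩ := (mem_nhdsGE_iff_exists_Icc_subset (α := ℝ)).1 hev'
  have hur : u < r := hr
  filter_upwards [Ioo_mem_nhdsGT (lt_min hur hu.2)] with s hs
  have hsr : s ≤ r := hs.2.le.trans (min_le_left _ _)
  have hsb : s ≤ b := hs.2.le.trans (min_le_right _ _)
  have hx' := hx.mono hu.1 hs.1.le hsb
  have hz' := hz.mono hu.1 hs.1.le hsb
  refine le_sub_mul_of_ae_hasDerivAt_le (g := fun t => Φ (x t, z t)) hs.1.le ?_ ?_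
  · refine absolutelyContinuousOnInterval_of_dist_le_integral
      (ρ := fun τ => K * (‖ξ τ‖ + ‖ζ τ‖)) hs.1.le ((hx'.1.norm.add hz'.1.norm).const_mul _) ?_
    intro s₁ h1 s₂ h2 h12
    have hm : ∀ t ∈ Icc u s, (x t, z t) ∈ U := fun t ht => (hrU ⟨ht.1, ht.2.trans hsr⟩).1
    refine (hLip.dist_le_mul _ (hm s₁ h1) _ (hm s₂ h2)).trans ?_
    have hsub : uIcc s₁ s₂ ⊆ uIcc u s := by
      rw [uIcc_of_le h12, uIcc_of_le hs.1.le]; exact Icc_subset_Icc h1.1 h2.2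
    rw [intervalIntegral.integral_const_mul, intervalIntegral.integral_add
      (hx'.1.norm.mono_set hsub) (hz'.1.norm.mono_set hsub)]
    refine mul_le_mul_of_nonneg_left ?_ K.2
    have e1 := hx'.norm_sub_le h1 h2 h12
    have e2 := hz'.norm_sub_le h1 h2 h12
    rw [dist_comm, Prod.dist_eq, dist_eq_norm, dist_eq_norm]
    exact max_le (by linarith [norm_nonneg (z s₂ - z s₁)]) (by linarith [norm_nonneg (x s₂ - x s₁)])
  · filter_upwards [hD] with t ht htm
    exact ht ⟨hu.1.trans_lt htm.1, htm.2.trans_le hsb⟩ (hrU ⟨htm.1.le, htm.2.le.trans hsr⟩).2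

end

section

/-! ### The functions `φ₁`, `φ₂` and the Jacobian -/

namespace Design

variable {P : Design}

@[simp] theorem φ₁_zero : P.φ₁ (0 : Vec n) = 0 := by simp [φ₁]

@[simp] theorem φ₂_zero : P.φ₂ (0 : Vec n) = 0 := by simp [φ₂]

theorem Valid.p_lt_one (hP : P.Valid) : P.p < 1 := by linarith [hP.p_le]

theorem Valid.gain_pos (hP : P.Valid) (x : Vec n) : 0 < P.α * ‖x‖ ^ (-P.p) + P.β := by
  have h1 := hP.α_pos
  have h2 := hP.β_pos
  positivity

theorem Valid.β_le_c (hP : P.Valid) (x : Vec n) : P.β ≤ P.c x := by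
  have h1 := hP.α_pos
  have h3 : 0 < 1 - P.p := by linarith [hP.p_le]
  have : 0 ≤ P.α * (1 - P.p) * ‖x‖ ^ (-P.p) := by positivity
  simp only [c]
  linarith

theorem Valid.c_pos (hP : P.Valid) (x : Vec n) : 0 < P.c x := hP.β_pos.trans_le (hP.β_le_c x)

theorem Valid.norm_φ₁ (hP : P.Valid) (x : Vec n) :
    ‖P.φ₁ x‖ = P.α * ‖x‖ ^ (1 - P.p) + P.β * ‖x‖ := by
  rw [φ₁, norm_smul, Real.norm_of_nonneg (hP.gain_pos x).le]
  rcases eq_or_ne x 0 with rfl | hx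
  · have : 1 - P.p ≠ 0 := by have := hP.p_le; intro h; linarith
    simp [Real.zero_rpow this]
  · have hx' : 0 < ‖x‖ := norm_pos_iff.2 hx
    rw [show 1 - P.p = -P.p + 1 by ring, Real.rpow_add_one hx'.ne']
    ring

theorem rpow_le_one_add {r q : ℝ} (hr : 0 ≤ r) (hq0 : 0 ≤ q) (hq : q ≤ 1) : r ^ q ≤ 1 + r := by
  rcases le_total r 1 with h | h
  · exact (Real.rpow_le_one hr h hq0).trans (by linarith)
  · calc r ^ q ≤ r ^ (1 : ℝ) := Real.rpow_le_rpow_of_exponent_le h hq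
      _ ≤ 1 + r := by rw [Real.rpow_one]; linarith

theorem Valid.norm_φ₁_le (hP : P.Valid) (x : Vec n) :
    ‖P.φ₁ x‖ ≤ (P.α + P.β) * (1 + ‖x‖) := by
  rw [hP.norm_φ₁]
  have h1 := mul_le_mul_of_nonneg_left (rpow_le_one_add (norm_nonneg x)
    (by linarith [hP.p_le] : 0 ≤ 1 - P.p) (by linarith [hP.p_pos])) hP.α_pos.le
  nlinarith [hP.β_pos, norm_nonneg x]

theorem Valid.β_mul_le_norm_φ₁ (hP : P.Valid) (x : Vec n) : P.β * ‖x‖ ≤ ‖P.φ₁ x‖ := by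
  rw [hP.norm_φ₁]
  have := hP.α_pos
  have : 0 ≤ P.α * ‖x‖ ^ (1 - P.p) := by positivity
  linarith

theorem Valid.φ₁_ne_zero (hP : P.Valid) {x : Vec n} (hx : x ≠ 0) : P.φ₁ x ≠ 0 :=
  smul_ne_zero (hP.gain_pos x).ne' hx

theorem contDiffAt_φ₁ {x : Vec n} (hx : x ≠ 0) : ContDiffAt ℝ 1 P.φ₁ x := by
  unfold φ₁
  have h : ContDiffAt ℝ 1 (fun y : Vec n => ‖y‖ ^ (-P.p)) x :=
    (contDiffAt_norm ℝ hx).rpow_const_of_ne (norm_ne_zero_iff.2 hx)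
  exact ((contDiffAt_const.mul h).add contDiffAt_const).smul contDiffAt_id

theorem Valid.continuous_φ₁ (hP : P.Valid) : Continuous (P.φ₁ : Vec n → Vec n) := by
  refine continuous_iff_continuousAt.2 fun x => ?_
  rcases eq_or_ne x 0 with rfl | hx
  · rw [ContinuousAt, φ₁_zero]
    refine squeeze_zero_norm (fun y => (hP.norm_φ₁ y).le) ?_
    have hq : 0 ≤ 1 - P.p := by linarith [hP.p_le]
    have hc : Continuous fun y : Vec n => P.α * ‖y‖ ^ (1 - P.p) + P.β * ‖y‖ :=
      (continuous_const.mul ((Real.continuous_rpow_const hq).comp continuous_norm)).add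
        (continuous_const.mul continuous_norm)
    have := hc.tendsto 0
    rwa [norm_zero, Real.zero_rpow (by linarith [hP.p_le]), mul_zero, mul_zero, add_zero] at this
  · exact (contDiffAt_φ₁ hx).continuousAt

theorem continuousAt_φ₂ {x : Vec n} (hx : x ≠ 0) : ContinuousAt P.φ₂ x := by
  unfold φ₂ c
  have h : ContDiffAt ℝ 1 (fun y : Vec n => ‖y‖ ^ (-P.p)) x :=
    (contDiffAt_norm ℝ hx).rpow_const_of_ne (norm_ne_zero_iff.2 hx)
  exact ((continuousAt_const.mul h.continuousAt).add continuousAt_const).smul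
    (contDiffAt_φ₁ hx).continuousAt

theorem J_apply (x u : Vec n) : P.J x u = (P.α * ‖x‖ ^ (-P.p) + P.β) • u
    - (P.α * P.p * (‖x‖ ^ (-P.p) / ‖x‖ ^ 2) * ⟪x, u⟫_ℝ) • x := by
  simp [J, smul_smul]

theorem hasDerivAt_φ₁ {y : ℝ → Vec n} {y' : Vec n} {s : ℝ} (hy : HasDerivAt y y' s)
    (hs : y s ≠ 0) : HasDerivAt (fun t => P.φ₁ (y t)) (P.J (y s) y') s := by
  have hpos : 0 < ‖y s‖ := norm_pos_iff.2 hs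
  have h1 : HasDerivAt (fun t => ‖y t‖) (⟪y s, y'⟫_ℝ / ‖y s‖) s := by
    have := hy.norm_sq.sqrt (by positivity)
    simp only [Real.sqrt_sq (norm_nonneg _)] at this
    convert this using 1
    field_simp
  have h2 := ((h1.rpow_const (p := -P.p) (Or.inl hpos.ne')).const_mul P.α).add_const P.β
  have h3 := h2.smul hy
  have e : P.J (y s) y' = (P.α * ‖y s‖ ^ (-P.p) + P.β) • y' +
      (P.α * (⟪y s, y'⟫_ℝ / ‖y s‖ * -P.p * ‖y s‖ ^ (-P.p - 1))) • y s := by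
    rw [J_apply, Real.rpow_sub_one hpos.ne', sub_eq_add_neg, ← neg_smul]
    congr 2
    field_simp
  rw [e]
  exact h3

theorem inner_J_left (x u w : Vec n) : ⟪P.J x u, w⟫_ℝ = ⟪u, P.J x w⟫_ℝ := by
  simp only [J_apply, inner_sub_left, inner_sub_right, real_inner_smul_left,
    real_inner_smul_right]
  rw [real_inner_comm u x]
  ring

/-- `φ₁(x)` is radial, and the radial direction is an eigenvector of `J` with eigenvalue `c`. This
is what ties `φ₂ = cφ₁` to the dynamics of `φ₁`. -/
theorem J_φ₁ (x : Vec n) : P.J x (P.φ₁ x) = P.c x • P.φ₁ x := by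
  rcases eq_or_ne x 0 with rfl | hx
  · simp
  have hpos : 0 < ‖x‖ := norm_pos_iff.2 hx
  rw [J_apply, φ₁, c, real_inner_smul_right, real_inner_self_eq_norm_sq, smul_smul, smul_smul,
    ← sub_smul]
  congr 1
  field_simp
  ring

theorem Jn_apply (x u : Vec n) : P.Jn x u = (P.c x)⁻¹ • P.J x u := rfl

theorem Valid.J_eq (hP : P.Valid) (x u : Vec n) : P.J x u = P.c x • P.Jn x u := by
  rw [Jn_apply, smul_inv_smul₀ (hP.c_pos x).ne']

/-- `𝒥` has eigenvalue `1` in the radial direction and `(α‖x‖^{-p} + β)/c ≥ 1` orthogonally to it.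
-/
theorem Valid.norm_sq_le_inner_Jn (hP : P.Valid) {x : Vec n} (hx : x ≠ 0) (u : Vec n) :
    ‖u‖ ^ 2 ≤ ⟪P.Jn x u, u⟫_ℝ := by
  have hpos : 0 < ‖x‖ := norm_pos_iff.2 hx
  have hq : 0 < ‖x‖ ^ (-P.p) := Real.rpow_pos_of_pos hpos _
  rw [Jn_apply, real_inner_smul_left, inv_mul_eq_div, le_div_iff₀ (hP.c_pos x), J_apply,
    inner_sub_left, real_inner_smul_left, real_inner_smul_left, real_inner_self_eq_norm_sq]
  have hcs : ⟪x, u⟫_ℝ * ⟪x, u⟫_ℝ ≤ ‖x‖ ^ 2 * ‖u‖ ^ 2 := by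
    have := real_inner_mul_inner_self_le x u
    rwa [real_inner_self_eq_norm_sq, real_inner_self_eq_norm_sq] at this
  have h1 : P.α * P.p * (‖x‖ ^ (-P.p) / ‖x‖ ^ 2) * ⟪x, u⟫_ℝ * ⟪x, u⟫_ℝ
      ≤ P.α * P.p * ‖x‖ ^ (-P.p) * ‖u‖ ^ 2 := by
    have hk : 0 ≤ P.α * P.p * (‖x‖ ^ (-P.p) / ‖x‖ ^ 2) := by
      have := hP.α_pos; have := hP.p_pos; positivity
    calc _ = P.α * P.p * (‖x‖ ^ (-P.p) / ‖x‖ ^ 2) * (⟪x, u⟫_ℝ * ⟪x, u⟫_ℝ) := by ring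
      _ ≤ P.α * P.p * (‖x‖ ^ (-P.p) / ‖x‖ ^ 2) * (‖x‖ ^ 2 * ‖u‖ ^ 2) :=
        mul_le_mul_of_nonneg_left hcs hk
      _ = _ := by field_simp
  rw [c]
  linarith

theorem Valid.norm_le_norm_Jn (hP : P.Valid) {x : Vec n} (hx : x ≠ 0) (u : Vec n) :
    ‖u‖ ≤ ‖P.Jn x u‖ := by
  rcases eq_or_ne u 0 with rfl | hu
  · simp
  have h1 := (hP.norm_sq_le_inner_Jn hx u).trans (real_inner_le_norm _ _)
  have hpos : 0 < ‖u‖ := norm_pos_iff.2 hu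
  nlinarith

/-- A crude constant from the triangle inequality: `α(1 + p) ≤ 3α(1 - p)` because `p ≤ 1/2`. -/
theorem Valid.norm_Jn_le (hP : P.Valid) {x : Vec n} (hx : x ≠ 0) (u : Vec n) :
    ‖P.Jn x u‖ ≤ 3 * ‖u‖ := by
  have hpos : 0 < ‖x‖ := norm_pos_iff.2 hx
  have hq : 0 < ‖x‖ ^ (-P.p) := Real.rpow_pos_of_pos hpos _
  have hα := hP.α_pos
  have hp := hP.p_pos
  rw [Jn_apply, norm_smul, norm_inv, Real.norm_of_nonneg (hP.c_pos x).le, inv_mul_eq_div,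
    div_le_iff₀ (hP.c_pos x), J_apply]
  refine (norm_sub_le _ _).trans ?_
  rw [norm_smul, norm_smul, Real.norm_of_nonneg (hP.gain_pos x).le, norm_mul,
    Real.norm_of_nonneg (by positivity : 0 ≤ P.α * P.p * (‖x‖ ^ (-P.p) / ‖x‖ ^ 2))]
  have h1 : P.α * P.p * (‖x‖ ^ (-P.p) / ‖x‖ ^ 2) * ‖⟪x, u⟫_ℝ‖ * ‖x‖
      ≤ P.α * P.p * ‖x‖ ^ (-P.p) * ‖u‖ := by
    calc _ ≤ P.α * P.p * (‖x‖ ^ (-P.p) / ‖x‖ ^ 2) * (‖x‖ * ‖u‖) * ‖x‖ := by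
          gcongr
          exact norm_inner_le_norm x u
      _ = _ := by field_simp
  rw [c]
  have h2 : 0 ≤ P.α * ‖x‖ ^ (-P.p) * ‖u‖ := by positivity
  have h3 : 0 ≤ P.β * ‖u‖ := mul_nonneg hP.β_pos.le (norm_nonneg _)
  have h4 : P.α * ‖x‖ ^ (-P.p) * ‖u‖ * P.p ≤ P.α * ‖x‖ ^ (-P.p) * ‖u‖ * (1 / 2) :=
    mul_le_mul_of_nonneg_left hP.p_le h2
  nlinarith

/-- The radial profile of `φ₂`: `‖φ₂ x‖ = ψ ‖x‖` for `x ≠ 0`. -/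
def ψ (P : Design) (r : ℝ) : ℝ :=
  P.α ^ 2 * (1 - P.p) * r ^ (1 - 2 * P.p) + P.α * P.β * (2 - P.p) * r ^ (1 - P.p) + P.β ^ 2 * r

theorem Valid.continuous_ψ (hP : P.Valid) : Continuous P.ψ := by
  have h1 : Continuous fun r : ℝ => r ^ (1 - 2 * P.p) :=
    Real.continuous_rpow_const (by linarith [hP.p_le])
  have h2 : Continuous fun r : ℝ => r ^ (1 - P.p) :=
    Real.continuous_rpow_const (by linarith [hP.p_le])
  unfold ψ
  fun_prop

theorem Valid.monotoneOn_ψ (hP : P.Valid) : MonotoneOn P.ψ (Ici 0) := by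
  intro r hr s hs hrs
  have hr' : 0 ≤ r := hr
  have h1 : r ^ (1 - 2 * P.p) ≤ s ^ (1 - 2 * P.p) :=
    Real.rpow_le_rpow hr' hrs (by linarith [hP.p_le])
  have h2 : r ^ (1 - P.p) ≤ s ^ (1 - P.p) := Real.rpow_le_rpow hr' hrs (by linarith [hP.p_le])
  have := hP.α_pos
  have := hP.β_pos
  have h3 : 0 < 1 - P.p := by linarith [hP.p_le]
  have h4 : 0 < 2 - P.p := by linarith [hP.p_le]
  unfold ψ
  gcongr

theorem Valid.ψ_nonneg (hP : P.Valid) {r : ℝ} (hr : 0 ≤ r) : 0 ≤ P.ψ r := by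
  have := hP.α_pos
  have := hP.β_pos
  have h3 : 0 < 1 - P.p := by linarith [hP.p_le]
  have h4 : 0 < 2 - P.p := by linarith [hP.p_le]
  unfold ψ
  positivity

theorem φ₂_eq (x : Vec n) (hx : x ≠ 0) : P.φ₂ x = (P.ψ ‖x‖ * ‖x‖⁻¹) • x := by
  have hpos : 0 < ‖x‖ := norm_pos_iff.2 hx
  have e1 : ‖x‖ ^ (1 - P.p) = ‖x‖ * ‖x‖ ^ (-P.p) := by
    rw [sub_eq_add_neg, Real.rpow_add hpos, Real.rpow_one]
  have e2 : ‖x‖ ^ (1 - 2 * P.p) = ‖x‖ * ‖x‖ ^ (-P.p) * ‖x‖ ^ (-P.p) := by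
    rw [show 1 - 2 * P.p = 1 + -P.p + -P.p by ring, Real.rpow_add hpos, Real.rpow_add hpos,
      Real.rpow_one]
  rw [φ₂, φ₁, smul_smul, c, ψ, e1, e2]
  congr 1
  field_simp
  ring

theorem Valid.norm_φ₂ (hP : P.Valid) (x : Vec n) : ‖P.φ₂ x‖ ≤ P.ψ ‖x‖ := by
  rcases eq_or_ne x 0 with rfl | hx
  · simpa using hP.ψ_nonneg le_rfl
  have hpos : 0 < ‖x‖ := norm_pos_iff.2 hx
  rw [φ₂_eq x hx, norm_smul, norm_mul, Real.norm_of_nonneg (hP.ψ_nonneg hpos.le), norm_inv,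
    norm_norm, mul_assoc, inv_mul_cancel₀ hpos.ne', mul_one]

theorem Valid.ψ_le (hP : P.Valid) {r : ℝ} (hr : 0 ≤ r) :
    P.ψ r ≤ (P.α ^ 2 * (1 - P.p) + P.α * P.β * (2 - P.p) + P.β ^ 2) * (1 + r) := by
  have h1 := rpow_le_one_add hr (by linarith [hP.p_le] : 0 ≤ 1 - 2 * P.p) (by linarith [hP.p_pos])
  have h2 := rpow_le_one_add hr (by linarith [hP.p_le] : 0 ≤ 1 - P.p) (by linarith [hP.p_pos])
  have := hP.α_pos
  have := hP.β_pos
  have h3 : 0 < 1 - P.p := by linarith [hP.p_le]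
  have h4 : 0 < 2 - P.p := by linarith [hP.p_le]
  unfold ψ
  rw [add_mul, add_mul]
  gcongr
  linarith

/-! ### The Filippov regularization of `φ₂` -/

theorem mem_filippov_of_continuousAt {g : Vec n → Vec n} {x : Vec n} (hg : ContinuousAt g x) :
    g x ∈ filippov g x := by
  simp only [filippov, mem_iInter]
  intro r hr N hN
  have hd : Dense {y : Vec n | y ∉ N} :=
    Measure.dense_of_ae (μ := volume) (measure_eq_zero_iff_ae_notMem.1 hN)
  refine closure_subset_closedConvexHull ?_
  have hx : x ∈ closure (Metric.ball x r ∩ {y : Vec n | y ∉ N}) :=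
    hd.open_subset_closure_inter Metric.isOpen_ball (Metric.mem_ball_self hr)
  exact hg.continuousWithinAt.mem_closure_image hx

theorem filippov_subset_of_continuousAt {g : Vec n → Vec n} {x : Vec n} (hg : ContinuousAt g x) :
    filippov g x ⊆ {g x} := by
  intro w hw
  simp only [filippov, mem_iInter] at hw
  rw [mem_singleton_iff, ← dist_le_zero]
  refine le_of_forall_pos_le_add fun ε hε => ?_
  obtain ⟨r, hr, hrg⟩ := Metric.continuousAt_iff.1 hg ε hε
  have h := closedConvexHull_min (𝕜 := ℝ) (s := g '' (Metric.ball x r \ ∅))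
    (t := Metric.closedBall (g x) ε) ?_ (convex_closedBall _ _) Metric.isClosed_closedBall
    (hw r hr ∅ measure_empty)
  · rw [zero_add]; exact h
  · rintro _ ⟨y, hy, rfl⟩
    exact (hrg hy.1).le

theorem eq_φ₂_of_mem_filippov {x w : Vec n} (hx : x ≠ 0) (hw : w ∈ filippov P.φ₂ x) :
    w = P.φ₂ x := filippov_subset_of_continuousAt (continuousAt_φ₂ hx) hw

theorem Valid.norm_le_of_mem_filippov (hP : P.Valid) {x w : Vec n} (hw : w ∈ filippov P.φ₂ x) :
    ‖w‖ ≤ P.ψ (‖x‖ + 1) := by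
  simp only [filippov, mem_iInter] at hw
  have h := closedConvexHull_min (𝕜 := ℝ) (s := P.φ₂ '' (Metric.ball x 1 \ ∅))
    (t := Metric.closedBall 0 (P.ψ (‖x‖ + 1))) ?_ (convex_closedBall _ _)
    Metric.isClosed_closedBall (hw 1 one_pos ∅ measure_empty)
  · simpa using h
  · rintro _ ⟨y, hy, rfl⟩
    rw [mem_closedBall_zero_iff]
    refine (hP.norm_φ₂ y).trans (hP.monotoneOn_ψ (norm_nonneg y) (by positivity : 0 ≤ ‖x‖ + 1) ?_)
    have h1 : dist y x < 1 := hy.1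
    rw [dist_eq_norm] at h1
    linarith [norm_le_norm_add_norm_sub' y x]

/-- Along a ray `φ₂(ρe) = ψ(ρ)e → ψ(0)e`, and these values are approached off any null set, so the
convex hull contains the ball. The convention `0 ^ 0 = 1` makes `ψ 0 = α²/2` for `p = 1/2`, the size
of the jump of `φ₂` at the origin; for `p < 1/2` one has `ψ 0 = 0` and the ball is a point. -/
theorem Valid.closedBall_subset_filippov (hP : P.Valid) :
    Metric.closedBall (0 : Vec n) (P.ψ 0) ⊆ filippov P.φ₂ 0 := by
  -- In dimension zero a sphere of positive radius is empty and its hull is not the ball.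
  rcases Nat.eq_zero_or_pos n with rfl | hn
  · intro w _
    have : w = P.φ₂ (0 : Vec 0) := Subsingleton.elim _ _
    rw [this]
    refine mem_filippov_of_continuousAt ?_
    exact continuous_of_discreteTopology.continuousAt
  have : Nonempty (Fin n) := ⟨⟨0, hn⟩⟩
  have : Nontrivial (Vec n) := inferInstance
  rw [← convexHull_sphere_eq_closedBall (0 : Vec n) (hP.ψ_nonneg le_rfl)]
  simp only [filippov]
  refine subset_iInter fun r => subset_iInter fun hr => subset_iInter fun N =>
    subset_iInter fun hN => ?_
  refine convexHull_min ?_ convex_closedConvexHull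
  intro w hw
  refine closure_subset_closedConvexHull ?_
  have hex : ∃ e : Vec n, ‖e‖ = 1 ∧ w = P.ψ 0 • e := by
    rw [mem_sphere_zero_iff_norm] at hw
    rcases eq_or_ne w 0 with rfl | hw0
    · obtain ⟨e, he⟩ := exists_norm_eq (Vec n) zero_le_one
      exact ⟨e, he, by rw [← hw]; simp⟩
    · have : 0 < ‖w‖ := norm_pos_iff.2 hw0
      exact ⟨‖w‖⁻¹ • w, by rw [norm_smul, norm_inv, norm_norm, inv_mul_cancel₀ this.ne'],
        by rw [← hw, smul_inv_smul₀ this.ne']⟩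
  obtain ⟨e, he, rfl⟩ := hex
  have hd : Dense {y : Vec n | y ∉ N} :=
    Measure.dense_of_ae (μ := volume) (measure_eq_zero_iff_ae_notMem.1 hN)
  have hmem : ∀ ρ ∈ Ioo 0 r, P.ψ ρ • e ∈ closure (P.φ₂ '' (Metric.ball 0 r \ N)) := by
    intro ρ hρ
    have hn1 : ‖ρ • e‖ = ρ := by rw [norm_smul, he, mul_one, Real.norm_of_nonneg hρ.1.le]
    have hne : ρ • e ≠ 0 := by rw [← norm_pos_iff, hn1]; exact hρ.1
    have hx : ρ • e ∈ closure (Metric.ball 0 r ∩ {y : Vec n | y ∉ N}) :=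
      hd.open_subset_closure_inter Metric.isOpen_ball (by simpa [hn1] using hρ.2)
    have := (continuousAt_φ₂ (P := P) hne).continuousWithinAt.mem_closure_image hx
    rwa [φ₂_eq _ hne, hn1, smul_smul, mul_assoc, inv_mul_cancel₀ hρ.1.ne', mul_one] at this
  refine isClosed_closure.mem_of_tendsto (f := fun ρ => P.ψ ρ • e) (b := 𝓝[>] (0 : ℝ)) ?_ ?_
  · exact ((hP.continuous_ψ.tendsto 0).mono_left nhdsWithin_le_nhds).smul_const e
  · filter_upwards [Ioo_mem_nhdsGT hr] with ρ hρ using hmem ρ hρ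

end Design

end

section

/-! ### Consequences of the standing assumptions -/

theorem inner_le_of_le {M N : Mat n} (h : M ≤ N) (u : Vec n) : ⟪M u, u⟫_ℝ ≤ ⟪N u, u⟫_ℝ := by
  have h1 := ((ContinuousLinearMap.le_def _ _).1 h).inner_nonneg_left u
  rw [sub_apply, inner_sub_left] at h1
  linarith

theorem inner_sym (M : Mat n) (u : Vec n) : ⟪((2 : ℝ) • sym M) u, u⟫_ℝ = 2 * ⟪M u, u⟫_ℝ := by
  simp only [sym, smul_smul]
  norm_num
  rw [inner_add_left, ContinuousLinearMap.adjoint_inner_left, real_inner_comm (M u) u]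
  ring

theorem norm_le_of_gram_le {M : Mat n} {γ : ℝ} (hγ : 0 ≤ γ) (h : gram M ≤ γ • (1 : Mat n))
    (u : Vec n) : ‖M u‖ ≤ √γ * ‖u‖ := by
  have h1 := inner_le_of_le h u
  simp only [gram, ContinuousLinearMap.comp_apply, ContinuousLinearMap.adjoint_inner_left,
    real_inner_self_eq_norm_sq, smul_apply, one_apply_eq_self,
    real_inner_smul_left] at h1
  refine abs_le_of_sq_le_sq' ?_ (by positivity) |>.2
  rw [mul_pow, Real.sq_sqrt hγ]
  exact h1

namespace System.Admissible

variable {S : System n} {P : Design} {B : Bounds} {t : ℝ} {x : Vec n}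

theorem inner_G (hS : S.Admissible P B) (ht : 0 ≤ t) (x u : Vec n) :
    B.gm * ‖u‖ ^ 2 ≤ 2 * ⟪S.G t x u, u⟫_ℝ := by
  have h1 := inner_le_of_le (hS.G_lower t x ht) u
  simp only [add_apply, smul_apply, one_apply_eq_self, inner_add_left,
    ContinuousLinearMap.adjoint_inner_left, real_inner_smul_left,
    real_inner_self_eq_norm_sq] at h1
  rw [real_inner_comm (S.G t x u) u] at h1
  linarith

theorem inner_Jn_add (hS : S.Admissible P B) (ht : 0 ≤ t) (hx : x ≠ 0) (u : Vec n) :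
    B.γ₁ * ‖u‖ ^ 2 ≤ 2 * ⟪P.Jn x (u + S.ΔG t x u), u⟫_ℝ := by
  have h1 := inner_le_of_le (hS.γ₁_bound t x ht hx) u
  rw [inner_sym] at h1
  simpa [real_inner_smul_left, real_inner_self_eq_norm_sq] using h1

theorem inner_ΔG_Jn (hS : S.Admissible P B) (ht : 0 ≤ t) (hx : x ≠ 0) (u : Vec n) :
    2 * ⟪S.ΔG t x (P.Jn x (S.G t x u)), u⟫_ℝ ≤ B.γ₄ * ‖u‖ ^ 2 := by
  have h1 := inner_le_of_le (hS.γ₄_bound t x ht hx) u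
  rw [inner_sym] at h1
  simpa [real_inner_smul_left, real_inner_self_eq_norm_sq] using h1

theorem norm_Jn_G (hS : S.Admissible P B) (hB : B.Valid) (ht : 0 ≤ t) (hx : x ≠ 0) (u : Vec n) :
    ‖P.Jn x (S.G t x u)‖ ≤ √B.γ₃ * ‖u‖ :=
  norm_le_of_gram_le hB.γ₃_nonneg (hS.γ₃_bound t x ht hx) u

theorem norm_adjoint_ΔG (hS : S.Admissible P B) (hB : B.Valid) (ht : 0 ≤ t) (x u : Vec n) :
    ‖(S.ΔG t x).adjoint u‖ ≤ √B.γ₅ * ‖u‖ :=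
  norm_le_of_gram_le hB.γ₅_nonneg (hS.γ₅_bound t x ht) u

theorem norm_ΔG (hS : S.Admissible P B) (hB : B.Valid) (ht : 0 ≤ t) (x u : Vec n) :
    ‖S.ΔG t x u‖ ≤ √B.γ₅ * ‖u‖ := by
  refine ContinuousLinearMap.le_of_opNorm_le _ ?_ u
  rw [← LinearIsometryEquiv.norm_map ContinuousLinearMap.adjoint]
  exact ContinuousLinearMap.opNorm_le_bound _ (Real.sqrt_nonneg _)
    (hS.norm_adjoint_ΔG hB ht x)

theorem norm_add_ΔG (hS : S.Admissible P B) (hB : B.Valid) (ht : 0 ≤ t) (x u : Vec n) :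
    ‖(1 + S.ΔG t x) u‖ ≤ (1 + √B.γ₅) * ‖u‖ := by
  rw [add_apply, one_apply_eq_self]
  linarith [norm_add_le u (S.ΔG t x u), hS.norm_ΔG hB ht x u]

theorem norm_Δ₁ (hS : S.Admissible P B) (ht : 0 ≤ t) (x u : Vec n) :
    ‖S.Δ₁ t x u‖ ≤ B.δ₁ * ‖u‖ := ContinuousLinearMap.le_of_opNorm_le _ (hS.Δ₁_le t x ht) u

theorem norm_Δ₂ (hS : S.Admissible P B) (ht : 0 ≤ t) (x u : Vec n) :
    ‖S.Δ₂ t x u‖ ≤ B.δ₂ * ‖u‖ := ContinuousLinearMap.le_of_opNorm_le _ (hS.Δ₂_le t x ht) u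

theorem norm_Δ₃ (hS : S.Admissible P B) (ht : 0 ≤ t) (x u : Vec n) :
    ‖S.Δ₃ t x u‖ ≤ B.δ₃ * ‖u‖ := ContinuousLinearMap.le_of_opNorm_le _ (hS.Δ₃_le t x ht) u

theorem continuous_ΔG_apply (hS : S.Admissible P B) (ht : 0 ≤ t) :
    Continuous fun y : Vec n × Vec n => (1 + S.ΔG t y.1) y.2 := by
  have h := (hS.ΔG_reg.1 t ht).comp (continuous_fst (X := Vec n) (Y := Vec n))
  exact (continuous_const.add h).clm_apply continuous_snd

theorem continuous_G_apply (hS : S.Admissible P B) (ht : 0 ≤ t) :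
    Continuous fun y : Vec n × Vec n => S.G t y.1 y.2 := by
  have h := (hS.G₀_reg.1 t ht).comp (continuous_fst (X := Vec n) (Y := Vec n))
  exact (hS.continuous_ΔG_apply ht).comp
    (continuous_fst.prodMk (h.clm_apply continuous_snd))

/-- For `x ≠ 0` this follows from `‖u‖ ≤ ‖𝒥u‖` and the `γ₃` bound. It extends to `x = 0` by
continuity, since the punctured space is dense when `n > 0`. -/
theorem norm_G (hS : S.Admissible P B) (hP : P.Valid) (hB : B.Valid) (ht : 0 ≤ t)
    (x u : Vec n) : ‖S.G t x u‖ ≤ √B.γ₃ * ‖u‖ := by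
  rcases Nat.eq_zero_or_pos n with rfl | hn
  · rw [Subsingleton.elim (S.G t x u) 0, norm_zero]
    positivity
  have : Nonempty (Fin n) := ⟨⟨0, hn⟩⟩
  have hcl : IsClosed {y : Vec n | ‖S.G t y u‖ ≤ √B.γ₃ * ‖u‖} :=
    isClosed_le ((hS.continuous_G_apply ht).comp
      (continuous_id.prodMk continuous_const)).norm continuous_const
  have hsub : ({0}ᶜ : Set (Vec n)) ⊆ {y : Vec n | ‖S.G t y u‖ ≤ √B.γ₃ * ‖u‖} := fun y hy =>
    (hP.norm_le_norm_Jn hy _).trans (hS.norm_Jn_G hB ht hy u)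
  have hd : Dense ({0}ᶜ : Set (Vec n)) := dense_compl_singleton 0
  exact hcl.closure_subset_iff.2 hsub (hd x)

/-- `G` is injective because its symmetric part is positive definite. As `G₀` is onto, `I + Δ_G` is
injective too, hence bijective in finite dimension. -/
theorem isInvertible (hS : S.Admissible P B) (hB : B.Valid) (ht : 0 ≤ t) (x : Vec n) :
    (1 + S.ΔG t x).IsInvertible := by
  have hG : Function.Injective (S.G t x) := by
    refine (injective_iff_map_eq_zero _).2 fun u hu => ?_
    have h1 := hS.inner_G ht x u
    rw [hu, inner_zero_left, mul_zero] at h1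
    have h2 : ‖u‖ ^ 2 ≤ 0 := by
      by_contra! h
      linarith [mul_pos hB.gm_pos h]
    exact norm_eq_zero.1 (pow_eq_zero_iff two_ne_zero |>.1 (le_antisymm h2 (sq_nonneg _)))
  have hA : Function.Injective (1 + S.ΔG t x : Mat n) := by
    intro u w huw
    obtain ⟨u', rfl⟩ := (hS.G₀_inv t x ht).surjective u
    obtain ⟨w', rfl⟩ := (hS.G₀_inv t x ht).surjective w
    exact congrArg _ (hG huw)
  exact ⟨(LinearEquiv.ofInjectiveEndo (1 + S.ΔG t x : Mat n).toLinearMap hA).toContinuousLinearEquiv,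
    by ext; rfl⟩

theorem f₂_eq (hS : S.Admissible P B) (hB : B.Valid) (ht : 0 ≤ t) (x : Vec n) :
    S.f₂ t x = (1 + S.ΔG t x) (S.h t x) :=
  ((hS.isInvertible hB ht x).self_apply_inverse _).symm

/-- The right-hand side of the closed-loop equation for `x`. -/
def _root_.MGSTA.System.field (S : System n) (P : Design) (k₁ t : ℝ) (y : Vec n × Vec n) : Vec n :=
  S.f P t y.1 + S.G t y.1 (S.control P k₁ t y.1 y.2)

theorem field_eq (hS : S.Admissible P B) (ht : 0 ≤ t) (k₁ : ℝ) (x v : Vec n) :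
    S.field P k₁ t (x, v)
      = S.f P t x - k₁ • S.G t x (P.φ₁ x) + P.b • (1 + S.ΔG t x) v := by
  have : S.G t x ((S.G₀ t x).inverse v) = (1 + S.ΔG t x) v := by
    rw [System.G, ContinuousLinearMap.comp_apply, (hS.G₀_inv t x ht).self_apply_inverse]
  simp only [System.field, System.control, map_add, map_neg, map_smul, this]
  abel

theorem field_eq_z (hS : S.Admissible P B) (hP : P.Valid) (hB : B.Valid) (ht : 0 ≤ t) (k₁ : ℝ)
    (x v : Vec n) : S.field P k₁ t (x, v) = S.Δ₁ t x (P.φ₁ x) - k₁ • S.G t x (P.φ₁ x)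
      + P.b • (1 + S.ΔG t x) (v + P.b⁻¹ • S.h t x) := by
  rw [hS.field_eq ht, System.f, hS.f₂_eq hB ht, map_add, map_smul, smul_add,
    smul_inv_smul₀ hP.b_pos.ne']
  abel

theorem continuous_field (hS : S.Admissible P B) (hP : P.Valid) (ht : 0 ≤ t) (k₁ : ℝ) :
    Continuous (S.field P k₁ t) := by
  have h1 : Continuous fun y : Vec n × Vec n => S.G t y.1 (P.φ₁ y.1) :=
    (hS.continuous_G_apply ht).comp
      (continuous_fst.prodMk (hP.continuous_φ₁.comp continuous_fst))
  have h2 : Continuous fun y : Vec n × Vec n => S.f P t y.1 := (hS.f_reg.1 t ht).comp continuous_fst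
  have h3 : S.field P k₁ t = fun y => S.f P t y.1 - k₁ • S.G t y.1 (P.φ₁ y.1)
      + P.b • (1 + S.ΔG t y.1) y.2 := funext fun y => hS.field_eq ht k₁ y.1 y.2
  rw [h3]
  exact (h2.sub (h1.const_smul k₁)).add ((hS.continuous_ΔG_apply ht).const_smul P.b)

theorem measurable_field (hS : S.Admissible P B) (k₁ : ℝ) (y : Vec n × Vec n) :
    Measurable fun t : Ici (0 : ℝ) => S.field P k₁ t y := by
  have hA : Measurable fun t : Ici (0 : ℝ) => 1 + S.ΔG t y.1 :=
    measurable_const.add (hS.ΔG_reg.2 y.1)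
  have hG : Measurable fun t : Ici (0 : ℝ) => (1 + S.ΔG t y.1) (S.G₀ t y.1 (P.φ₁ y.1)) := by
    have hc : Continuous fun q : Mat n × Vec n => q.1 q.2 :=
      continuous_fst.clm_apply continuous_snd
    exact hc.measurable.comp (hA.prodMk ((hS.G₀_reg.2 y.1).apply_continuousLinearMap _))
  have h3 : (fun t : Ici (0 : ℝ) => S.field P k₁ t y) = fun t : Ici (0 : ℝ) =>
      S.f P t y.1 - k₁ • (1 + S.ΔG t y.1) (S.G₀ t y.1 (P.φ₁ y.1))
      + P.b • (1 + S.ΔG t y.1) y.2 := funext fun t => hS.field_eq t.2 k₁ y.1 y.2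
  rw [h3]
  exact ((hS.f_reg.2 y.1).sub (hG.const_smul k₁)).add
    ((hA.apply_continuousLinearMap _).const_smul P.b)

/-! ### Lipschitz dependence of `h` on `x` and linear growth of the field -/

theorem continuousOn_h (hS : S.Admissible P B) (x : Vec n) {T : ℝ} (hT : 0 ≤ T) :
    ContinuousOn (fun t => S.h t x) (Icc 0 T) := by
  obtain ⟨η, h1, -⟩ := hS.h_deriv 0 T (fun _ => x) (fun _ => 0) le_rfl hT ⟨by simp, by simp⟩
  exact h1.continuousOn hT

/-- The segment from `x` to `y` is traversed in a short time `ε`. The `Δ₂` part of the change of `h`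
is then `O(ε)`, while the `Δ₃` part is at most `δ₃` times the length, whatever the speed. Letting `ε
→ 0`, with `h` continuous in time at fixed `y`, leaves the second part only. -/
theorem norm_h_sub_le (hS : S.Admissible P B) (hP : P.Valid) (hB : B.Valid) (ht : 0 ≤ t)
    (x y : Vec n) : ‖S.h t y - S.h t x‖ ≤ B.δ₃ * ‖y - x‖ := by
  rcases eq_or_ne x y with rfl | hxy
  · simp
  set R := ‖x‖ + ‖y - x‖ with hR
  have key : ∀ ε > 0, ‖S.h (t + ε) y - S.h t x‖ ≤ B.δ₂ * P.ψ R * ε + B.δ₃ * ‖y - x‖ := by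
    intro ε hε
    let ξ : Vec n := ε⁻¹ • (y - x)
    let X : ℝ → Vec n := fun s => x + (s - t) • ξ
    have hX : HasACDeriv X (fun _ => ξ) t (t + ε) := ⟨by simp, fun s _ => by simp [X]⟩
    obtain ⟨η, h1, h2⟩ := hS.h_deriv t (t + ε) X (fun _ => ξ) ht (by linarith) hX
    have hξ : ξ ≠ 0 := smul_ne_zero (inv_ne_zero hε.ne') (sub_ne_zero.2 hxy.symm)
    -- The derivative formula for `h` is available only where the curve is nonzero; a nonconstant
    -- affine curve vanishes at most once.
    have hnull : ∀ᵐ s, X s ≠ 0 := by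
      have hss : Set.Subsingleton {s | X s = 0} := by
        intro s hs s' hs'
        have h3 : (s - s') • ξ = 0 := by
          have : X s - X s' = 0 := by rw [show X s = 0 from hs, show X s' = 0 from hs', sub_zero]
          rw [← this]
          simp only [X]
          module
        exact sub_eq_zero.1 ((smul_eq_zero.1 h3).resolve_right hξ)
      have := hss.measure_zero volume
      rw [measure_eq_zero_iff_ae_notMem] at this
      exact this
    have hnξ : ‖ξ‖ = ε⁻¹ * ‖y - x‖ := by
      rw [norm_smul, norm_inv, Real.norm_of_nonneg hε.le]
    have hbd : ∀ᵐ s, s ∈ uIoc t (t + ε) → ‖η s‖ ≤ B.δ₂ * P.ψ R + B.δ₃ * (ε⁻¹ * ‖y - x‖) := by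
      filter_upwards [h2, hnull] with s hs hs0 hst
      rw [uIoc_of_le (by linarith)] at hst
      have hs_nonneg : 0 ≤ s := ht.trans hst.1.le
      rw [hs (Ioc_subset_Icc_self hst) hs0]
      have hXs : ‖X s‖ ≤ R := by
        refine (norm_add_le _ _).trans ?_
        rw [hR, norm_smul, hnξ, Real.norm_of_nonneg (by linarith [hst.1])]
        have : (s - t) * (ε⁻¹ * ‖y - x‖) ≤ ε * (ε⁻¹ * ‖y - x‖) := by
          gcongr
          linarith [hst.2]
        rw [mul_inv_cancel_left₀ hε.ne'] at this
        linarith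
      have e1 : ‖P.φ₂ (X s)‖ ≤ P.ψ R :=
        (hP.norm_φ₂ _).trans (hP.monotoneOn_ψ (norm_nonneg _) ((norm_nonneg _).trans hXs) hXs)
      refine (norm_add_le _ _).trans (add_le_add ?_ ?_)
      · exact (hS.norm_Δ₂ hs_nonneg _ _).trans (mul_le_mul_of_nonneg_left e1 hB.δ₂_nonneg)
      · rw [← hnξ]
        exact hS.norm_Δ₃ hs_nonneg _ _
    have h3 := h1.sub_eq (left_mem_Icc.2 (by linarith)) (right_mem_Icc.2 (by linarith))
    have e2 : X (t + ε) = y := by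
      simp only [X, ξ, add_sub_cancel_left, smul_inv_smul₀ hε.ne', add_sub_cancel]
    have e3 : X t = x := by simp [X]
    simp only [e2, e3] at h3
    rw [h3]
    refine (intervalIntegral.norm_integral_le_of_norm_le_const_ae hbd).trans (le_of_eq ?_)
    rw [add_sub_cancel_left, abs_of_pos hε]
    field_simp
  have hc : Tendsto (fun ε => ‖S.h (t + ε) y - S.h t x‖) (𝓝[>] 0) (𝓝 ‖S.h t y - S.h t x‖) := by
    have h1 := hS.continuousOn_h y (T := t + 1) (by linarith) t ⟨ht, by linarith⟩
    have h2 : Tendsto (fun ε : ℝ => t + ε) (𝓝[>] 0) (𝓝[Icc 0 (t + 1)] t) := by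
      refine tendsto_nhdsWithin_iff.2 ⟨?_, ?_⟩
      · have : Tendsto (fun ε : ℝ => t + ε) (𝓝 0) (𝓝 (t + 0)) := by
          exact (continuous_const.add continuous_id).tendsto 0
        rw [add_zero] at this
        exact this.mono_left nhdsWithin_le_nhds
      · filter_upwards [Ioo_mem_nhdsGT one_pos] with ε hε
        exact ⟨by linarith [hε.1], by linarith [hε.2]⟩
    exact ((h1.tendsto.comp h2).sub_const _).norm
  have hr : Tendsto (fun ε => B.δ₂ * P.ψ R * ε + B.δ₃ * ‖y - x‖) (𝓝[>] 0)
      (𝓝 (B.δ₃ * ‖y - x‖)) := by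
    have : Continuous fun ε => B.δ₂ * P.ψ R * ε + B.δ₃ * ‖y - x‖ := by fun_prop
    have := this.tendsto 0
    rw [mul_zero, zero_add] at this
    exact this.mono_left nhdsWithin_le_nhds
  exact le_of_tendsto_of_tendsto hc hr (by
    filter_upwards [self_mem_nhdsWithin] with ε hε using key ε hε)

theorem exists_norm_h_le (hS : S.Admissible P B) (hP : P.Valid) (hB : B.Valid) {T : ℝ}
    (hT : 0 ≤ T) : ∃ H, 0 ≤ H ∧ ∀ t ∈ Icc 0 T, ∀ x, ‖S.h t x‖ ≤ H + B.δ₃ * ‖x‖ := by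
  obtain ⟨H, hH⟩ := isCompact_Icc.exists_bound_of_continuousOn (hS.continuousOn_h 0 hT)
  refine ⟨H, (norm_nonneg _).trans (hH 0 (left_mem_Icc.2 hT)), fun t ht x => ?_⟩
  have h1 := hS.norm_h_sub_le hP hB ht.1 0 x
  rw [sub_zero] at h1
  linarith [hH t ht, norm_le_norm_add_norm_sub' (S.h t x) (S.h t 0)]

theorem exists_norm_field_le (hS : S.Admissible P B) (hP : P.Valid) (hB : B.Valid) (k₁ : ℝ)
    {T : ℝ} (hT : 0 ≤ T) :
    ∃ C, 0 ≤ C ∧ ∀ t ∈ Icc 0 T, ∀ x v, ‖S.field P k₁ t (x, v)‖ ≤ C * (1 + ‖x‖ + ‖v‖) := by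
  obtain ⟨H, hH0, hH⟩ := hS.exists_norm_h_le hP hB hT
  have hα := hP.α_pos
  have hβ := hP.β_pos
  have hb := hP.b_pos
  have h1 := hB.δ₁_nonneg
  have h3 := hB.δ₃_nonneg
  refine ⟨(B.δ₁ + |k₁| * √B.γ₃) * (P.α + P.β) + (1 + √B.γ₅) * (H + B.δ₃ + P.b),
    by positivity, fun t ht x v => ?_⟩
  have e1 := hP.norm_φ₁_le x
  have e2 : ‖S.Δ₁ t x (P.φ₁ x)‖ ≤ B.δ₁ * ((P.α + P.β) * (1 + ‖x‖)) :=
    (hS.norm_Δ₁ ht.1 x _).trans (by gcongr)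
  have e3 : ‖k₁ • S.G t x (P.φ₁ x)‖ ≤ |k₁| * (√B.γ₃ * ((P.α + P.β) * (1 + ‖x‖))) := by
    rw [norm_smul, Real.norm_eq_abs]
    gcongr
    exact (hS.norm_G hP hB ht.1 x _).trans (by gcongr)
  have e4 : ‖S.f₂ t x‖ ≤ (1 + √B.γ₅) * (H + B.δ₃ * ‖x‖) := by
    rw [hS.f₂_eq hB ht.1]
    exact (hS.norm_add_ΔG hB ht.1 x _).trans (by gcongr; exact hH t ht x)
  have e5 : ‖P.b • (1 + S.ΔG t x) v‖ ≤ P.b * ((1 + √B.γ₅) * ‖v‖) := by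
    rw [norm_smul, Real.norm_of_nonneg hb.le]
    gcongr
    exact hS.norm_add_ΔG hB ht.1 x v
  have e6 : ‖S.field P k₁ t (x, v)‖ ≤ ‖S.Δ₁ t x (P.φ₁ x)‖ + ‖S.f₂ t x‖ + ‖k₁ • S.G t x (P.φ₁ x)‖
      + ‖P.b • (1 + S.ΔG t x) v‖ := by
    rw [hS.field_eq ht.1, System.f]
    refine (norm_add_le _ _).trans (add_le_add_left ((norm_sub_le _ _).trans
      (add_le_add_left (norm_add_le _ _) _)) _)
  have hx := norm_nonneg x
  have hv := norm_nonneg v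
  calc _ ≤ (B.δ₁ + |k₁| * √B.γ₃) * (P.α + P.β) * (1 + ‖x‖)
        + (1 + √B.γ₅) * (H + B.δ₃ * ‖x‖ + P.b * ‖v‖) := by linarith
    _ ≤ (B.δ₁ + |k₁| * √B.γ₃) * (P.α + P.β) * (1 + ‖x‖ + ‖v‖)
        + (1 + √B.γ₅) * ((H + B.δ₃ + P.b) * (1 + ‖x‖ + ‖v‖)) := by
      have : H + B.δ₃ * ‖x‖ + P.b * ‖v‖ ≤ (H + B.δ₃ + P.b) * (1 + ‖x‖ + ‖v‖) := by
        nlinarith [mul_nonneg hH0 hx, mul_nonneg hH0 hv, mul_nonneg h3 hv, mul_nonneg hb.le hx]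
      exact add_le_add (mul_le_mul_of_nonneg_left (by linarith) (by positivity))
        (mul_le_mul_of_nonneg_left this (by positivity))
    _ = _ := by ring

end System.Admissible

end

section

/-! ### Choice of the gains -/

/-- Determinant over trace is a lower bound for the smaller eigenvalue. Subtracting this multiple of
the identity leaves determinant `ε²`, so completing the square shows that the rest is nonnegative.
-/
theorem exists_quadratic_lower_bound {a c d : ℝ} (ha : 0 < a) (hc : 0 < c) (h : d ^ 2 < a * c) :
    ∃ ε, 0 < ε ∧ ∀ u w : ℝ, ε * (u ^ 2 + w ^ 2) ≤ a * u ^ 2 - 2 * d * (u * w) + c * w ^ 2 := by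
  have hac : 0 < a + c := by positivity
  refine ⟨(a * c - d ^ 2) / (a + c), div_pos (by linarith) hac, fun u w => ?_⟩
  set ε := (a * c - d ^ 2) / (a + c) with hε
  have h1 : ε * (a + c) = a * c - d ^ 2 := div_mul_cancel₀ _ hac.ne'
  have h2 : 0 < a - ε := by
    have : (a - ε) * (a + c) = a ^ 2 + d ^ 2 := by linarith
    by_contra! h3
    nlinarith [sq_nonneg d, mul_pos ha ha]
  have h3 : (a - ε) * (c - ε) - d ^ 2 = ε ^ 2 := by linarith
  have h4 : 0 ≤ (a - ε) * ((a - ε) * u ^ 2 - 2 * d * (u * w) + (c - ε) * w ^ 2) := by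
    have : (a - ε) * ((a - ε) * u ^ 2 - 2 * d * (u * w) + (c - ε) * w ^ 2)
        = ((a - ε) * u - d * w) ^ 2 + ((a - ε) * (c - ε) - d ^ 2) * w ^ 2 := by ring
    rw [this, h3]
    positivity
  have h5 := nonneg_of_mul_nonneg_right h4 h2
  linarith

/-- After division by `s` one minimizes `sγ₅ + γ₃/s`: the infimum `2√(γ₃γ₅)` is attained at `s =
√γ₃/√γ₅`. If `γ₅ = 0` or `γ₃ = 0`, a large or a small `s` comes close enough to it. -/
theorem exists_gain_ratio {γ₃ γ₄ γ₅ Γ : ℝ} (h3 : 0 ≤ γ₃) (h5 : 0 ≤ γ₅)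
    (h : γ₄ + 2 * √(γ₃ * γ₅) < Γ) : ∃ s, 0 < s ∧ s ^ 2 * γ₅ + γ₃ + s * γ₄ < s * Γ := by
  have hpos : 0 < Γ - γ₄ := by linarith [Real.sqrt_nonneg (γ₃ * γ₅)]
  rcases h5.eq_or_lt with rfl | h5
  · refine ⟨(γ₃ + 1) / (Γ - γ₄), by positivity, ?_⟩
    have : (γ₃ + 1) / (Γ - γ₄) * (Γ - γ₄) = γ₃ + 1 := div_mul_cancel₀ _ hpos.ne'
    linarith
  rcases h3.eq_or_lt with rfl | h3
  · refine ⟨(Γ - γ₄) / (2 * γ₅), by positivity, ?_⟩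
    have h1 : (Γ - γ₄) / (2 * γ₅) * (2 * γ₅) = Γ - γ₄ := div_mul_cancel₀ _ (by positivity)
    have h2 : 0 < (Γ - γ₄) / (2 * γ₅) := by positivity
    nlinarith
  · have h3' := Real.sqrt_pos.2 h3
    have h5' := Real.sqrt_pos.2 h5
    refine ⟨√γ₃ / √γ₅, by positivity, ?_⟩
    have h1 : √γ₃ / √γ₅ * √γ₅ = √γ₃ := div_mul_cancel₀ _ h5'.ne'
    set s := √γ₃ / √γ₅ with hs
    have hs0 : 0 < s := by positivity
    have e5 : √γ₅ ^ 2 = γ₅ := Real.sq_sqrt h5.le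
    have e3 : √γ₃ ^ 2 = γ₃ := Real.sq_sqrt h3.le
    rw [Real.sqrt_mul h3.le] at h
    have h6 : s ^ 2 * γ₅ = γ₃ := by rw [← e5, ← mul_pow, h1, e3]
    have h7 : s * (√γ₃ * √γ₅) = γ₃ := by
      rw [mul_comm √γ₃, ← mul_assoc, h1, ← sq, e3]
    nlinarith

/-- `A`, `D`, `C` are the coefficients of the quadratic form bounding `V̇/c`. Put `Y = 1/q`, `X =
1/k₁`, `k₂ = s q k₁`. Then `A`, `D`, `C` equal `q k₁²`, `q k₁`, `q` times expressions continuous in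
`X` and `Y`, so the powers cancel in `D² < AC`. In the limit `X = Y = 0` this is the inequality
satisfied by `s`. -/
theorem exists_gains_aux {P : Design} (hP : P.Valid) {B : Bounds} (hB : B.Valid)
    (hkey : B.γ₄ + 2 * √(B.γ₃ * B.γ₅) < B.γ₁ * B.gm) {δ₀ a g : ℝ} :
    ∃ q k₁ k₂, 0 < q ∧ 0 < k₁ ∧ 0 < k₂ ∧ q ^ 2 < k₂ / P.b ∧ ∃ A D C : ℝ,
      A = k₂ / P.b * (k₁ * B.gm - 2 * B.δ₁) - 2 * q * k₂ - 2 * q * B.δ₂ / P.b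
        - 2 * q * δ₀ * (B.δ₁ + k₁ * g) ∧
      C = q * P.b * B.γ₁ - 2 * δ₀ * (P.b * a) ∧
      D = √(k₂ ^ 2 * B.γ₅ + (q * k₁) ^ 2 * B.γ₃ + k₂ * (q * k₁) * B.γ₄) + 3 * q * B.δ₁
        + B.δ₂ / P.b + δ₀ * (B.δ₁ + k₁ * g) + q * δ₀ * (P.b * a) ∧
      0 < A ∧ 0 < C ∧ D ^ 2 < A * C := by
  obtain ⟨s, hs, hsΛ⟩ := exists_gain_ratio hB.γ₃_nonneg hB.γ₅_nonneg hkey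
  have hb := hP.b_pos
  have hgm := hB.gm_pos
  have hγ₁ := hB.γ₁_pos
  set Λ := s ^ 2 * B.γ₅ + B.γ₃ + s * B.γ₄ with hΛ
  have hΛ0 : 0 ≤ Λ := by
    have := hB.γ₃_nonneg; have := hB.γ₄_nonneg; have := hB.γ₅_nonneg; positivity
  let c : ℝ → ℝ := fun Y => P.b * B.γ₁ - 2 * δ₀ * (P.b * a) * Y
  let d : ℝ → ℝ → ℝ := fun Y X => √Λ + δ₀ * g * Y
    + X * (3 * B.δ₁ + B.δ₂ / P.b * Y + δ₀ * B.δ₁ * Y + δ₀ * (P.b * a))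
  have ev1 : ∀ᶠ Y in 𝓝[>] (0 : ℝ), 0 < c Y ∧ d Y 0 ^ 2 < s * B.gm / P.b * c Y := by
    refine (nhdsWithin_le_nhds (s := Ioi (0 : ℝ))) (Eventually.and ?_ ?_)
    · have hc : Continuous c := by fun_prop
      exact hc.continuousAt.eventually (lt_mem_nhds (by simp only [c]; simp; positivity))
    · have h1 : Continuous fun Y => d Y 0 ^ 2 := by fun_prop
      have h2 : Continuous fun Y => s * B.gm / P.b * c Y := by fun_prop
      refine h1.continuousAt.eventually_lt h2.continuousAt ?_
      simp only [c, d, mul_zero, add_zero, zero_mul, sub_zero, Real.sq_sqrt hΛ0]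
      have : s * B.gm / P.b * (P.b * B.γ₁) = s * (B.γ₁ * B.gm) := by field_simp
      rwa [this]
  -- The order matters: `A` contains the term `2 Y⁻¹ s X`, so `Y` is fixed before `X` tends to zero.
  obtain ⟨Y, ⟨hc, hd⟩, hY⟩ := (ev1.and self_mem_nhdsWithin).exists
  have hY0 : 0 < Y := hY
  let A : ℝ → ℝ := fun X => s * B.gm / P.b - X * (2 * s * B.δ₁ / P.b + 2 * Y⁻¹ * s + 2 * δ₀ * g)
    - X ^ 2 * (2 * B.δ₂ / P.b + 2 * δ₀ * B.δ₁)
  have ev2 : ∀ᶠ X in 𝓝[>] (0 : ℝ), 0 < A X ∧ d Y X ^ 2 < A X * c Y ∧ Y⁻¹ * P.b * X < s := by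
    refine (nhdsWithin_le_nhds (s := Ioi (0 : ℝ))) (Eventually.and ?_ (Eventually.and ?_ ?_))
    · have hA : Continuous A := by fun_prop
      exact hA.continuousAt.eventually (lt_mem_nhds (by simp only [A]; simp; positivity))
    · have h1 : Continuous fun X => d Y X ^ 2 := by fun_prop
      have h2 : Continuous fun X => A X * c Y := by fun_prop
      refine h1.continuousAt.eventually_lt h2.continuousAt ?_
      simpa [A] using hd
    · have h1 : Continuous fun X => Y⁻¹ * P.b * X := by fun_prop
      exact h1.continuousAt.eventually (gt_mem_nhds (by simpa using hs))
  obtain ⟨X, ⟨hA, hAd, hXs⟩, hX⟩ := (ev2.and self_mem_nhdsWithin).exists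
  have hX0 : 0 < X := hX
  have hq : 0 < Y⁻¹ := inv_pos.2 hY0
  have hk : 0 < X⁻¹ := inv_pos.2 hX0
  have hsq : √((s * Y⁻¹ * X⁻¹) ^ 2 * B.γ₅ + (Y⁻¹ * X⁻¹) ^ 2 * B.γ₃
      + s * Y⁻¹ * X⁻¹ * (Y⁻¹ * X⁻¹) * B.γ₄) = Y⁻¹ * X⁻¹ * √Λ := by
    rw [show (s * Y⁻¹ * X⁻¹) ^ 2 * B.γ₅ + (Y⁻¹ * X⁻¹) ^ 2 * B.γ₃
      + s * Y⁻¹ * X⁻¹ * (Y⁻¹ * X⁻¹) * B.γ₄ = (Y⁻¹ * X⁻¹) ^ 2 * Λ by rw [hΛ]; ring,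
      Real.sqrt_mul (sq_nonneg _), Real.sqrt_sq (by positivity)]
  refine ⟨Y⁻¹, X⁻¹, s * Y⁻¹ * X⁻¹, hq, hk, by positivity, ?_, Y⁻¹ * X⁻¹ ^ 2 * A X,
    Y⁻¹ * X⁻¹ * d Y X, Y⁻¹ * c Y, ?_, ?_, ?_, by positivity, by positivity, ?_⟩
  · rw [lt_div_iff₀ hb]
    have h1 : Y⁻¹ * X⁻¹ * (Y⁻¹ * P.b * X) < Y⁻¹ * X⁻¹ * s :=
      mul_lt_mul_of_pos_left hXs (by positivity)
    have h2 : Y⁻¹ * X⁻¹ * (Y⁻¹ * P.b * X) = Y⁻¹ ^ 2 * P.b := by field_simp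
    linarith
  · simp only [A]
    field_simp
    ring
  · simp only [c]
    field_simp
  · rw [hsq]
    simp only [d]
    field_simp
    ring
  · have h1 : (Y⁻¹ * X⁻¹) ^ 2 * d Y X ^ 2 < (Y⁻¹ * X⁻¹) ^ 2 * (A X * c Y) :=
      mul_lt_mul_of_pos_left hAd (by positivity)
    calc _ = (Y⁻¹ * X⁻¹) ^ 2 * d Y X ^ 2 := by ring
      _ < _ := h1
      _ = _ := by ring

/-! ### The Lyapunov function -/

/-- The quadratic form `(k₂ / b) ‖φ‖² - 2 q φ·z + ‖z‖²`, to be evaluated at `φ = φ₁(x)`. -/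
def lyap (P : Design) (q k₂ : ℝ) (φ z : Vec n) : ℝ :=
  k₂ / P.b * ‖φ‖ ^ 2 - 2 * q * ⟪φ, z⟫_ℝ + ‖z‖ ^ 2

/-- The derivative of `lyap` at `(φ, z)` in the direction `(φ', z')`. -/
def lyapDeriv (P : Design) (q k₂ : ℝ) (φ z φ' z' : Vec n) : ℝ :=
  2 * (k₂ / P.b) * ⟪φ', φ⟫_ℝ - 2 * q * (⟪φ', z⟫_ℝ + ⟪φ, z'⟫_ℝ) + 2 * ⟪z, z'⟫_ℝ

theorem hasDerivAt_lyap (P : Design) (q k₂ : ℝ) {φ z : ℝ → Vec n} {φ' z' : Vec n} {s : ℝ}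
    (hφ : HasDerivAt φ φ' s) (hz : HasDerivAt z z' s) :
    HasDerivAt (fun t => lyap P q k₂ (φ t) (z t)) (lyapDeriv P q k₂ (φ s) (z s) φ' z') s := by
  have h := ((hφ.norm_sq.const_mul (k₂ / P.b)).sub ((hφ.inner ℝ hz).const_mul (2 * q))).add
    hz.norm_sq
  have e : lyapDeriv P q k₂ (φ s) (z s) φ' z' = k₂ / P.b * (2 * ⟪φ s, φ'⟫_ℝ)
      - 2 * q * (⟪φ s, z'⟫_ℝ + ⟪φ', z s⟫_ℝ) + 2 * ⟪z s, z'⟫_ℝ := by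
    rw [lyapDeriv, real_inner_comm (φ s) φ']
    ring
  rw [e]
  exact h

theorem contDiff_lyap (P : Design) (q k₂ : ℝ) :
    ContDiff ℝ 1 fun y : Vec n × Vec n => lyap P q k₂ y.1 y.2 := by
  unfold lyap
  exact ((contDiff_const.mul (contDiff_fst.norm_sq ℝ)).sub
    (contDiff_const.mul (contDiff_fst.inner ℝ contDiff_snd))).add (contDiff_snd.norm_sq ℝ)

theorem lyap_le {P : Design} {q k₂ : ℝ} (hq : 0 ≤ q) (φ z : Vec n) :
    lyap P q k₂ φ z ≤ (|k₂ / P.b| + q + 1) * (‖φ‖ ^ 2 + ‖z‖ ^ 2) := by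
  have h1 := neg_le_of_abs_le (abs_real_inner_le_norm φ z)
  have h2 := two_mul_le_add_sq ‖φ‖ ‖z‖
  have h3 : -(2 * ⟪φ, z⟫_ℝ) ≤ ‖φ‖ ^ 2 + ‖z‖ ^ 2 := by linarith
  have h4 := mul_le_mul_of_nonneg_left h3 hq
  have h5 := mul_le_mul_of_nonneg_right (le_abs_self (k₂ / P.b)) (sq_nonneg ‖φ‖)
  have h6 := mul_nonneg (abs_nonneg (k₂ / P.b)) (sq_nonneg ‖z‖)
  rw [lyap]
  nlinarith [sq_nonneg ‖φ‖]

theorem exists_le_lyap {P : Design} {q k₂ : ℝ} (hP : P.Valid) (hk₂ : 0 < k₂)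
    (h : q ^ 2 < k₂ / P.b) :
    ∃ m, 0 < m ∧ ∀ (n : ℕ) (φ z : Vec n), m * (‖φ‖ ^ 2 + ‖z‖ ^ 2) ≤ lyap P q k₂ φ z := by
  obtain ⟨m, hm, hle⟩ := exists_quadratic_lower_bound (d := |q|) (div_pos hk₂ hP.b_pos) one_pos
    (by rw [sq_abs, mul_one]; exact h)
  refine ⟨m, hm, fun n φ z => (hle _ _).trans ?_⟩
  have h1 : q * ⟪φ, z⟫_ℝ ≤ |q| * (‖φ‖ * ‖z‖) := by
    refine (le_abs_self _).trans ?_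
    rw [abs_mul]
    exact mul_le_mul_of_nonneg_left (abs_real_inner_le_norm φ z) (abs_nonneg q)
  rw [lyap]
  linarith

/-- The right-hand side of the equation for `x` in the coordinates `(x, z)`. -/
def System.velocity (S : System n) (P : Design) (k₁ t : ℝ) (x z : Vec n) : Vec n :=
  S.Δ₁ t x (P.φ₁ x) - k₁ • S.G t x (P.φ₁ x) + P.b • (1 + S.ΔG t x) z

theorem System.Admissible.norm_velocity_le {S : System n} {P : Design} {B : Bounds}
    (hS : S.Admissible P B) (hP : P.Valid) (hB : B.Valid) {t k₁ : ℝ} (ht : 0 ≤ t) (hk₁ : 0 ≤ k₁)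
    (x z : Vec n) : ‖S.velocity P k₁ t x z‖
      ≤ (B.δ₁ + k₁ * √B.γ₃) * ‖P.φ₁ x‖ + P.b * (1 + √B.γ₅) * ‖z‖ := by
  have e1 := hS.norm_Δ₁ ht x (P.φ₁ x)
  have e2 : ‖k₁ • S.G t x (P.φ₁ x)‖ ≤ k₁ * (√B.γ₃ * ‖P.φ₁ x‖) := by
    rw [norm_smul, Real.norm_of_nonneg hk₁]
    exact mul_le_mul_of_nonneg_left (hS.norm_G hP hB ht x _) hk₁
  have e3 : ‖P.b • (1 + S.ΔG t x) z‖ ≤ P.b * ((1 + √B.γ₅) * ‖z‖) := by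
    rw [norm_smul, Real.norm_of_nonneg hP.b_pos.le]
    exact mul_le_mul_of_nonneg_left (hS.norm_add_ΔG hB ht x _) hP.b_pos.le
  calc _ ≤ ‖S.Δ₁ t x (P.φ₁ x)‖ + ‖k₁ • S.G t x (P.φ₁ x)‖ + ‖P.b • (1 + S.ΔG t x) z‖ :=
        (norm_add_le _ _).trans (add_le_add_left (norm_sub_le _ _) _)
    _ ≤ _ := by linarith

/-- Expanding the square, the inner product of the two summands is a multiple of `⟪Δ_G 𝒥 G φ, φ⟫`.
Bounding the sum as a whole lets `γ₄` control this product, which is sharper than the triangle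
inequality. -/
theorem System.Admissible.norm_cross_le {S : System n} {P : Design} {B : Bounds}
    (hS : S.Admissible P B) (hB : B.Valid) {t ρ k : ℝ} {x : Vec n} (ht : 0 ≤ t)
    (hx : x ≠ 0) (hρ : 0 ≤ ρ) (hk : 0 ≤ k) (φ : Vec n) :
    ‖k • (S.ΔG t x).adjoint φ + ρ • P.Jn x (S.G t x φ)‖
      ≤ √(k ^ 2 * B.γ₅ + ρ ^ 2 * B.γ₃ + k * ρ * B.γ₄) * ‖φ‖ := by
  have h3 := hB.γ₃_nonneg
  have h4 := hB.γ₄_nonneg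
  have h5 := hB.γ₅_nonneg
  refine abs_le_of_sq_le_sq' ?_ (by positivity) |>.2
  rw [mul_pow, Real.sq_sqrt (by positivity), norm_add_sq_real, norm_smul, norm_smul, mul_pow,
    mul_pow, Real.norm_eq_abs, Real.norm_eq_abs, sq_abs, sq_abs, real_inner_smul_left,
    real_inner_smul_right, ContinuousLinearMap.adjoint_inner_left]
  have e1 := hS.norm_adjoint_ΔG hB ht x φ
  have e2 := hS.norm_Jn_G hB ht hx φ
  have e3 := hS.inner_ΔG_Jn ht hx φ
  rw [real_inner_comm] at e3
  have e1' : ‖(S.ΔG t x).adjoint φ‖ ^ 2 ≤ B.γ₅ * ‖φ‖ ^ 2 := by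
    have := pow_le_pow_left₀ (norm_nonneg _) e1 2
    rwa [mul_pow, Real.sq_sqrt h5] at this
  have e2' : ‖P.Jn x (S.G t x φ)‖ ^ 2 ≤ B.γ₃ * ‖φ‖ ^ 2 := by
    have := pow_le_pow_left₀ (norm_nonneg _) e2 2
    rwa [mul_pow, Real.sq_sqrt h3] at this
  have f1 := mul_le_mul_of_nonneg_left e1' (sq_nonneg k)
  have f2 := mul_le_mul_of_nonneg_left e2' (sq_nonneg ρ)
  have f3 := mul_le_mul_of_nonneg_left e3 (mul_nonneg hk hρ)
  linarith

/-- Along the closed loop the Lyapunov function decreases, with a rate independent of the system. -/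
theorem exists_gains {P : Design} (hP : P.Valid) {B : Bounds} (hB : B.Valid)
    (hkey : B.γ₄ + 2 * √(B.γ₃ * B.γ₅) < B.γ₁ * B.gm) :
    ∃ q k₁ k₂ ε, 0 < q ∧ 0 < k₁ ∧ 0 < k₂ ∧ 0 < ε ∧ q ^ 2 < k₂ / P.b ∧
      ∀ (n : ℕ) (S : System n), S.Admissible P B → ∀ t, 0 ≤ t → ∀ x z : Vec n, x ≠ 0 →
        lyapDeriv P q k₂ (P.φ₁ x) z (P.J x (S.velocity P k₁ t x z))
          (-(k₂ • P.φ₂ x) + P.b⁻¹ • (S.Δ₂ t x (P.φ₂ x) + S.Δ₃ t x (S.velocity P k₁ t x z)))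
        ≤ -(P.c x * (ε * (‖P.φ₁ x‖ ^ 2 + ‖z‖ ^ 2))) := by
  -- `a` and `g` bound the norms of `I + Δ_G` and `G`. The factor `1/β` in `δ₀` pays for writing the
  -- `Δ₃` terms, which lack the factor `c`, as multiples of `c ≥ β`.
  obtain ⟨q, k₁, k₂, hq, hk₁, hk₂, hqk, A, D, C, hA, hC, hD, hA0, hC0, hDAC⟩ :=
    exists_gains_aux hP hB hkey (δ₀ := B.δ₃ / (P.β * P.b)) (a := 1 + √B.γ₅) (g := √B.γ₃)
  obtain ⟨ε, hε, hquad⟩ := exists_quadratic_lower_bound hA0 hC0 hDAC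
  refine ⟨q, k₁, k₂, ε, hq, hk₁, hk₂, hε, hqk, fun n S hS t ht x z hx => ?_⟩
  have hb := hP.b_pos
  have hβ := hP.β_pos
  have hc := hP.c_pos x
  have hβc := hP.β_le_c x
  set φ := P.φ₁ x with hφ
  set c := P.c x with hcdef
  set X := S.velocity P k₁ t x z with hX
  have hφ₂ : P.φ₂ x = c • φ := rfl
  set u := ‖φ‖ with hu
  set w := ‖z‖ with hw
  have hu0 : 0 ≤ u := norm_nonneg _
  have hw0 : 0 ≤ w := norm_nonneg _
  set δ₀ := B.δ₃ / (P.β * P.b) with hδ₀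
  have hδ₀0 : 0 ≤ δ₀ := div_nonneg hB.δ₃_nonneg (by positivity)
  -- the velocity
  set NX := (B.δ₁ + k₁ * √B.γ₃) * u + P.b * (1 + √B.γ₅) * w with hNX
  have hXle : ‖X‖ ≤ NX := hS.norm_velocity_le hP hB ht hk₁.le x z
  have hΔ₃ : ∀ y : Vec n, |P.b⁻¹ * ⟪y, S.Δ₃ t x X⟫_ℝ| ≤ c * (δ₀ * ‖y‖ * NX) := by
    intro y
    have h1 : |⟪y, S.Δ₃ t x X⟫_ℝ| ≤ ‖y‖ * (B.δ₃ * NX) :=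
      (abs_real_inner_le_norm _ _).trans (mul_le_mul_of_nonneg_left ((hS.norm_Δ₃ ht x X).trans
        (mul_le_mul_of_nonneg_left hXle hB.δ₃_nonneg)) (norm_nonneg _))
    have hNX0 : 0 ≤ NX := (norm_nonneg _).trans hXle
    have h2 : P.b⁻¹ * (‖y‖ * (B.δ₃ * NX)) = P.β * (δ₀ * ‖y‖ * NX) := by
      rw [hδ₀]; field_simp
    rw [abs_mul, abs_of_pos (inv_pos.2 hb)]
    refine (mul_le_mul_of_nonneg_left h1 (inv_pos.2 hb).le).trans ?_
    rw [h2]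
    exact mul_le_mul_of_nonneg_right hβc (by positivity)
  have hΔ₂ : ∀ y : Vec n, |P.b⁻¹ * ⟪y, S.Δ₂ t x (P.φ₂ x)⟫_ℝ| ≤ c * (B.δ₂ / P.b * (‖y‖ * u)) := by
    intro y
    rw [hφ₂, map_smul, real_inner_smul_right, abs_mul, abs_mul, abs_of_pos (inv_pos.2 hb),
      abs_of_pos hc]
    have h1 : |⟪y, S.Δ₂ t x φ⟫_ℝ| ≤ ‖y‖ * (B.δ₂ * u) :=
      (abs_real_inner_le_norm _ _).trans (mul_le_mul_of_nonneg_left (hS.norm_Δ₂ ht x φ)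
        (norm_nonneg _))
    calc P.b⁻¹ * (c * |⟪y, S.Δ₂ t x φ⟫_ℝ|) ≤ P.b⁻¹ * (c * (‖y‖ * (B.δ₂ * u))) := by gcongr
      _ = _ := by ring
  -- the four terms of the derivative
  have t1 : ⟪P.J x X, φ⟫_ℝ = c * (⟪S.Δ₁ t x φ, φ⟫_ℝ - k₁ * ⟪S.G t x φ, φ⟫_ℝ
      + P.b * (⟪z, φ⟫_ℝ + ⟪S.ΔG t x z, φ⟫_ℝ)) := by
    rw [Design.inner_J_left, hφ, Design.J_φ₁, real_inner_smul_right, ← hφ, hX, System.velocity,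
      inner_add_left, inner_sub_left, real_inner_smul_left, real_inner_smul_left, add_apply,
      inner_add_left, one_apply_eq_self]
  have t2 : ⟪P.J x X, z⟫_ℝ = c * (⟪P.Jn x (S.Δ₁ t x φ), z⟫_ℝ - k₁ * ⟪P.Jn x (S.G t x φ), z⟫_ℝ
      + P.b * ⟪P.Jn x (z + S.ΔG t x z), z⟫_ℝ) := by
    rw [hP.J_eq, real_inner_smul_left, hX, System.velocity, map_add, map_sub, map_smul, map_smul,
      inner_add_left, inner_sub_left, real_inner_smul_left, real_inner_smul_left, add_apply,
      one_apply_eq_self]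
  have t34 : ∀ y : Vec n, ⟪y, -(k₂ • P.φ₂ x) + P.b⁻¹ • (S.Δ₂ t x (P.φ₂ x) + S.Δ₃ t x X)⟫_ℝ
      = -(k₂ * (c * ⟪y, φ⟫_ℝ)) + (P.b⁻¹ * ⟪y, S.Δ₂ t x (P.φ₂ x)⟫_ℝ
        + P.b⁻¹ * ⟪y, S.Δ₃ t x X⟫_ℝ) := by
    intro y
    rw [inner_add_right, inner_neg_right, real_inner_smul_right, real_inner_smul_right,
      inner_add_right, mul_add]
    nth_rewrite 1 [hφ₂]
    rw [real_inner_smul_right]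
  have hcross := hS.norm_cross_le hB ht hx (mul_pos hq hk₁).le hk₂.le φ
  set R := √(k₂ ^ 2 * B.γ₅ + (q * k₁) ^ 2 * B.γ₃ + k₂ * (q * k₁) * B.γ₄) with hR
  have b0 : k₂ * ⟪S.ΔG t x z, φ⟫_ℝ + q * k₁ * ⟪P.Jn x (S.G t x φ), z⟫_ℝ ≤ R * u * w := by
    have h1 : k₂ * ⟪S.ΔG t x z, φ⟫_ℝ + q * k₁ * ⟪P.Jn x (S.G t x φ), z⟫_ℝ
        = ⟪k₂ • (S.ΔG t x).adjoint φ + (q * k₁) • P.Jn x (S.G t x φ), z⟫_ℝ := by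
      rw [inner_add_left, real_inner_smul_left, real_inner_smul_left,
        ContinuousLinearMap.adjoint_inner_left, real_inner_comm φ]
    rw [h1]
    exact (real_inner_le_norm _ _).trans (mul_le_mul_of_nonneg_right hcross hw0)
  have b1 : ⟪S.Δ₁ t x φ, φ⟫_ℝ ≤ B.δ₁ * u ^ 2 := by
    refine (real_inner_le_norm _ _).trans ?_
    rw [sq, ← mul_assoc]
    exact mul_le_mul_of_nonneg_right (hS.norm_Δ₁ ht x φ) hu0
  have b2 := hS.inner_G ht x φ
  have b3 : -⟪P.Jn x (S.Δ₁ t x φ), z⟫_ℝ ≤ 3 * B.δ₁ * (u * w) := by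
    refine (neg_le_abs _).trans ((abs_real_inner_le_norm _ _).trans ?_)
    have := (hP.norm_Jn_le hx (S.Δ₁ t x φ)).trans
      (mul_le_mul_of_nonneg_left (hS.norm_Δ₁ ht x φ) (by norm_num))
    calc _ ≤ 3 * (B.δ₁ * u) * w := mul_le_mul_of_nonneg_right this hw0
      _ = _ := by ring
  have b4 := hS.inner_Jn_add ht hx z
  have b5 := neg_le_of_abs_le (hΔ₂ φ)
  have b6 := le_of_abs_le (hΔ₂ z)
  have b7 := neg_le_of_abs_le (hΔ₃ φ)
  have b8 := le_of_abs_le (hΔ₃ z)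
  -- The derivative divided by `c`, with the `Δ₂` and `Δ₃` terms already replaced by their bounds.
  -- The two terms `k₂⟪z, φ⟫` cancel, and the surviving cross terms are those of `b0`.
  have hbr : 2 * (k₂ / P.b) * (⟪S.Δ₁ t x φ, φ⟫_ℝ - k₁ * ⟪S.G t x φ, φ⟫_ℝ
        + P.b * (⟪z, φ⟫_ℝ + ⟪S.ΔG t x z, φ⟫_ℝ))
      - 2 * q * (⟪P.Jn x (S.Δ₁ t x φ), z⟫_ℝ - k₁ * ⟪P.Jn x (S.G t x φ), z⟫_ℝ
        + P.b * ⟪P.Jn x (z + S.ΔG t x z), z⟫_ℝ)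
      + 2 * q * (k₂ * u ^ 2 + B.δ₂ / P.b * (u * u) + δ₀ * u * NX)
      + 2 * (-(k₂ * ⟪z, φ⟫_ℝ) + B.δ₂ / P.b * (w * u) + δ₀ * w * NX)
      ≤ -(A * u ^ 2 - 2 * D * (u * w) + C * w ^ 2) := by
    have hkb : 0 < k₂ / P.b := by positivity
    have e1 := mul_le_mul_of_nonneg_left b1 hkb.le
    have e2 := mul_le_mul_of_nonneg_left b2 (mul_pos hkb hk₁).le
    have e3 := mul_le_mul_of_nonneg_left b3 hq.le
    have e4 := mul_le_mul_of_nonneg_left b4 (mul_pos hq hb).le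
    have e5 : k₂ / P.b * (P.b * (⟪z, φ⟫_ℝ + ⟪S.ΔG t x z, φ⟫_ℝ))
        = k₂ * (⟪z, φ⟫_ℝ + ⟪S.ΔG t x z, φ⟫_ℝ) := by field_simp
    rw [hA, hC, hD, hNX]
    linear_combination 2 * e1 + e2 + 2 * e3 + e4 + 2 * e5 + 2 * b0
  have hfin := mul_le_mul_of_nonneg_left (hbr.trans (neg_le_neg (hquad u w))) hc.le
  rw [lyapDeriv, t1, t2, t34 φ, t34 z, real_inner_self_eq_norm_sq]
  have g5 := mul_le_mul_of_nonneg_left b5 hq.le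
  have g7 := mul_le_mul_of_nonneg_left b7 hq.le
  linear_combination hfin + 2 * g5 + 2 * g7 + 2 * b6 + 2 * b8

end

section

/-! ### Decrease of the Lyapunov function along solutions -/

/-- Gains `k₁, k₂` for which `lyap P q k₂` is a strict Lyapunov function. -/
structure LyapunovGains (n : ℕ) (P : Design) (B : Bounds) (q k₁ k₂ ε m : ℝ) : Prop where
  q_pos : 0 < q
  k₁_pos : 0 < k₁
  k₂_pos : 0 < k₂
  ε_pos : 0 < ε
  m_pos : 0 < m
  le_lyap : ∀ φ z : Vec n, m * (‖φ‖ ^ 2 + ‖z‖ ^ 2) ≤ lyap P q k₂ φ z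
  lyapDeriv_le : ∀ S : System n, S.Admissible P B → ∀ t, 0 ≤ t → ∀ x z : Vec n, x ≠ 0 →
    lyapDeriv P q k₂ (P.φ₁ x) z (P.J x (S.velocity P k₁ t x z))
      (-(k₂ • P.φ₂ x) + P.b⁻¹ • (S.Δ₂ t x (P.φ₂ x) + S.Δ₃ t x (S.velocity P k₁ t x z)))
    ≤ -(P.c x * (ε * (‖P.φ₁ x‖ ^ 2 + ‖z‖ ^ 2)))

theorem exists_lyapunovGains (n : ℕ) {P : Design} (hP : P.Valid) {B : Bounds} (hB : B.Valid)
    (hkey : B.γ₄ + 2 * √(B.γ₃ * B.γ₅) < B.γ₁ * B.gm) :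
    ∃ q k₁ k₂ ε m, LyapunovGains n P B q k₁ k₂ ε m := by
  obtain ⟨q, k₁, k₂, ε, hq, hk₁, hk₂, hε, hqk, h⟩ := exists_gains hP hB hkey
  obtain ⟨m, hm, hle⟩ := exists_le_lyap hP hk₂ hqk
  exact ⟨q, k₁, k₂, ε, m, hq, hk₁, hk₂, hε, hm, hle n, h n⟩

/-- A solution of the closed loop in the coordinates `(x, z)`. -/
structure System.IsTransformedSolution (S : System n) (P : Design) (k₁ k₂ t₀ t₁ : ℝ)
    (x z : ℝ → Vec n) : Prop where
  x_deriv : HasACDeriv x (fun s => S.velocity P k₁ s (x s) (z s)) t₀ t₁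
  z_deriv : ∃ ζ : ℝ → Vec n, HasACDeriv z ζ t₀ t₁ ∧ ∀ᵐ s, s ∈ Icc t₀ t₁ → x s ≠ 0 →
    ζ s = -(k₂ • P.φ₂ (x s)) + P.b⁻¹ • (S.Δ₂ s (x s) (P.φ₂ (x s))
      + S.Δ₃ s (x s) (S.velocity P k₁ s (x s) (z s)))

variable {S : System n} {P : Design} {B : Bounds} {q k₁ k₂ ε m t₀ t₁ : ℝ} {x z v : ℝ → Vec n}

theorem System.IsSolution.transform (hS : S.Admissible P B) (hP : P.Valid) (hB : B.Valid)
    (ht₀ : 0 ≤ t₀) (ht : t₀ ≤ t₁) (h : S.IsSolution P k₁ k₂ t₀ t₁ x v) :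
    S.IsTransformedSolution P k₁ k₂ t₀ t₁ x (S.z P x v) := by
  obtain ⟨hx, w, hw, hv⟩ := h
  have hvel : ∀ s, 0 ≤ s → S.f P s (x s) + S.G s (x s) (S.control P k₁ s (x s) (v s))
      = S.velocity P k₁ s (x s) (S.z P x v s) := fun s hs =>
    hS.field_eq_z hP hB hs k₁ (x s) (v s)
  obtain ⟨η, hη, hη'⟩ := hS.h_deriv t₀ t₁ x _ ht₀ ht hx
  refine ⟨hx.congr ht (fun _ _ => rfl) (Eventually.of_forall fun s hs =>
    (hvel s (ht₀.trans hs.1.le)).symm), _, hv.add (hη.const_smul P.b⁻¹), ?_⟩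
  filter_upwards [hw, hη'] with s h1 h2 hs hxs
  rw [h2 hs hxs, Design.eq_φ₂_of_mem_filippov hxs (h1 hs), hvel s (ht₀.trans hs.1)]

/-- Where `x ≠ 0` near time `u`, the function `g = ⟪φ₁(x), z(u)⟫` grows at a rate at least `μ > 0`,
by the `γ₁` bound; moreover `g ≠ 0` forces `x ≠ 0`. Starting from `g(u) = 0`, either `g > 0`
immediately, or `g` and hence `x` vanish on an interval. The latter would give `ẋ = b(I + Δ_G)z = 0`
there with `z ≠ 0`, contradicting invertibility. -/
theorem System.IsTransformedSolution.eventually_ne_zero (hS : S.Admissible P B) (hP : P.Valid)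
    (hB : B.Valid) (hk₁ : 0 ≤ k₁) (h₀ : 0 ≤ t₀)
    (h : S.IsTransformedSolution P k₁ k₂ t₀ t₁ x z) {u : ℝ} (hu : u ∈ Ico t₀ t₁)
    (hxu : x u = 0) (hzu : z u ≠ 0) : ∀ᶠ s in 𝓝[>] u, x s ≠ 0 := by
  have hb := hP.b_pos
  have hγ₁ := hB.γ₁_pos
  have hzpos : 0 < ‖z u‖ := norm_pos_iff.2 hzu
  have ht : t₀ ≤ t₁ := hu.1.trans hu.2.le
  obtain ⟨ζ, hz, -⟩ := h.z_deriv
  have hcx := h.x_deriv.continuousOn ht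
  have hcz := hz.continuousOn ht
  -- `e` bounds the part of the velocity other than `b(I + Δ_G)z(u)`. The main part contributes at
  -- least `bγ₁‖z(u)‖²/2` and the error at most `3e‖z(u)‖`, so the threshold `1/12` leaves
  -- `bγ₁‖z(u)‖²/4`.
  let e : ℝ → ℝ := fun s => (B.δ₁ + k₁ * √B.γ₃) * ‖P.φ₁ (x s)‖ + P.b * (1 + √B.γ₅) * ‖z s - z u‖
  have hce : ContinuousOn e (Icc t₀ t₁) :=
    (continuousOn_const.mul (hP.continuous_φ₁.comp_continuousOn hcx).norm).add
      (continuousOn_const.mul (hcz.sub continuousOn_const).norm)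
  have hmem : u ∈ Icc t₀ t₁ := Ico_subset_Icc_self hu
  have hev : ∀ᶠ s in 𝓝[Icc t₀ t₁] u, e s < P.b * B.γ₁ * ‖z u‖ / 12 ∧ z s ≠ 0 := by
    refine ((hce u hmem).eventually (gt_mem_nhds ?_)).and ((hcz u hmem).eventually_ne hzu)
    simp only [e, hxu, Design.φ₁_zero, norm_zero, mul_zero, sub_self, add_zero]
    positivity
  have hev' : ∀ᶠ s in 𝓝[≥] u, e s < P.b * B.γ₁ * ‖z u‖ / 12 ∧ z s ≠ 0 :=
    hev.filter_mono (nhdsWithin_le_of_mem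
      (mem_of_superset (Icc_mem_nhdsGE hu.2) (Icc_subset_Icc_left hu.1)))
  obtain ⟨r', hr', hr'U⟩ := (mem_nhdsGE_iff_exists_Icc_subset (α := ℝ)).1 hev'
  obtain ⟨r, hur, hrt, hrU⟩ : ∃ r, u < r ∧ r ≤ t₁ ∧
      ∀ s ∈ Icc u r, e s < P.b * B.γ₁ * ‖z u‖ / 12 ∧ z s ≠ 0 :=
    ⟨min r' t₁, lt_min hr' hu.2, min_le_right _ _,
      fun s hs => hr'U ⟨hs.1, hs.2.trans (min_le_left _ _)⟩⟩
  have hx' := h.x_deriv.mono hu.1 hur.le hrt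
  have hz' := hz.mono hu.1 hur.le hrt
  let g : ℝ → ℝ := fun s => ⟪P.φ₁ (x s), z u⟫_ℝ
  have hcg : ContinuousOn g (Icc u r) :=
    (hP.continuous_φ₁.comp_continuousOn (hx'.continuousOn hur.le)).inner continuousOn_const
  have hg0 : ∀ s, g s ≠ 0 → x s ≠ 0 := by
    intro s hs hxs
    exact hs (by simp [g, hxs])
  set μ := P.β * (P.b * B.γ₁ * ‖z u‖ ^ 2 / 4) with hμ
  have hμ0 : 0 < μ := by have := hP.β_pos; positivity
  have stepA : ∀ s ∈ Ico u r, x s ≠ 0 → ∀ᶠ s' in 𝓝[>] s, -g s' ≤ -g s - μ * (s' - s) := by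
    intro s hs hxs
    refine eventually_decrease_of_ae_deriv_le hx' hz' hs
      (Φ := fun y => -⟪P.φ₁ y.1, z u⟫_ℝ) ?_ hxs ?_
    · exact (((Design.contDiffAt_φ₁ hxs).comp (x s, z s) contDiffAt_fst).inner ℝ
        contDiffAt_const).neg
    · filter_upwards [hx'.ae_hasDerivAt] with τ hτ hτm hxτ
      have hτ0 : 0 ≤ τ := h₀.trans (hu.1.trans hτm.1.le)
      refine ⟨_, ((Design.hasDerivAt_φ₁ (hτ hτm) hxτ).inner ℝ (hasDerivAt_const τ (z u))).neg, ?_⟩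
      rw [inner_zero_right, zero_add, neg_le_neg_iff, hP.J_eq, real_inner_smul_left]
      have e1 : S.velocity P k₁ τ (x τ) (z τ) = S.velocity P k₁ τ (x τ) (z τ - z u)
          + P.b • (z u + S.ΔG τ (x τ) (z u)) := by
        simp only [System.velocity, map_sub, add_apply, one_apply_eq_self]
        module
      have e2 := (hP.norm_Jn_le hxτ (S.velocity P k₁ τ (x τ) (z τ - z u))).trans
        (mul_le_mul_of_nonneg_left (hS.norm_velocity_le hP hB hτ0 hk₁ (x τ) (z τ - z u))
          (by norm_num))
      have e3 := hS.inner_Jn_add hτ0 hxτ (z u)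
      have e4 : -⟪P.Jn (x τ) (S.velocity P k₁ τ (x τ) (z τ - z u)), z u⟫_ℝ
          ≤ 3 * (P.b * B.γ₁ * ‖z u‖ / 12) * ‖z u‖ := by
        refine (neg_le_abs _).trans ((abs_real_inner_le_norm _ _).trans ?_)
        refine mul_le_mul_of_nonneg_right (e2.trans ?_) hzpos.le
        exact mul_le_mul_of_nonneg_left (hrU τ (Ioo_subset_Icc_self hτm)).1.le (by norm_num)
      have e5 : P.b * B.γ₁ * ‖z u‖ ^ 2 / 4
          ≤ ⟪P.Jn (x τ) (S.velocity P k₁ τ (x τ) (z τ)), z u⟫_ℝ := by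
        rw [e1, map_add, map_smul, inner_add_left, real_inner_smul_left]
        have := mul_le_mul_of_nonneg_left e3 hb.le
        linarith
      rw [hμ]
      exact mul_le_mul (hP.β_le_c _) e5 (by positivity) (hP.c_pos _).le
  have stepB : ∀ s ∈ Icc u r, 0 ≤ g s := by
    intro s hs
    have := le_max_of_eventually_decrease (W := fun t => -g t) (κ := 0) hs.1 le_rfl
      (hcg.mono (Icc_subset_Icc_right hs.2)).neg (by
        intro τ hτ hpos
        have hτ' : τ ∈ Ico u r := ⟨hτ.1, hτ.2.trans_le hs.2⟩
        filter_upwards [stepA τ hτ' (hg0 τ (by intro h0; simp [h0] at hpos)),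
          self_mem_nhdsWithin] with s' hs' hlt
        have : 0 ≤ μ * (s' - τ) := mul_nonneg hμ0.le (sub_nonneg.2 (le_of_lt hlt))
        linarith)
    have hgu : g u = 0 := by simp [g, hxu]
    simp only [hgu, neg_zero, zero_mul, sub_zero, max_self] at this
    linarith
  have stepC : ∀ s ∈ Icc u r, 0 < g s → ∀ s' ∈ Icc s r, g s ≤ g s' := by
    intro s hs hpos s' hs'
    have := le_sub_mul_of_eventually_decrease (W := fun t => -g t) (κ := 0) hs'.1
      (hcg.mono (Icc_subset_Icc hs.1 hs'.2)).neg (by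
        intro τ hτ hle
        have hτ' : τ ∈ Ico u r := ⟨hs.1.trans hτ.1, hτ.2.trans_le hs'.2⟩
        have hgτ : g τ ≠ 0 := by
          intro h0
          simp only [h0] at hle
          linarith
        filter_upwards [stepA τ hτ' (hg0 τ hgτ), self_mem_nhdsWithin] with s'' hs'' hlt
        have : 0 ≤ μ * (s'' - τ) := mul_nonneg hμ0.le (sub_nonneg.2 (le_of_lt hlt))
        linarith)
    linarith
  by_cases hall : ∀ s ∈ Ioo u r, 0 < g s
  · filter_upwards [Ioo_mem_nhdsGT hur] with s hs
    exact hg0 s (hall s hs).ne'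
  exfalso
  push Not at hall
  obtain ⟨s₂, hs₂, hg₂⟩ := hall
  have hgz : ∀ s ∈ Icc u s₂, g s = 0 := by
    intro s hs
    have hsr : s ∈ Icc u r := ⟨hs.1, hs.2.trans hs₂.2.le⟩
    refine le_antisymm ?_ (stepB s hsr)
    by_contra! hpos
    linarith [stepC s hsr hpos s₂ ⟨hs.2, hs₂.2.le⟩]
  -- If `x` were nonzero at such a time, `g` would strictly increase just after it.
  have hxz : ∀ s ∈ Ioo u s₂, x s = 0 := by
    intro s hs
    by_contra hne
    have h1 := stepA s ⟨hs.1.le, hs.2.trans hs₂.2⟩ hne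
    obtain ⟨s', hs', hm⟩ := (h1.and (Ioo_mem_nhdsGT hs.2)).exists
    rw [hgz s (Ioo_subset_Icc_self hs), hgz s' ⟨hs.1.le.trans hm.1.le, hm.2.le⟩] at hs'
    have : 0 < μ * (s' - s) := mul_pos hμ0 (sub_pos.2 hm.1)
    linarith
  obtain ⟨s, hs, hsd⟩ := (Measure.dense_of_ae hx'.ae_hasDerivAt).exists_mem_open isOpen_Ioo
    (nonempty_Ioo.2 hs₂.1)
  have hsr : s ∈ Ioo u r := ⟨hsd.1, hsd.2.trans hs₂.2⟩
  have h1 : HasDerivAt x _ s := hs hsr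
  have h2 : HasDerivAt x 0 s := by
    refine (hasDerivAt_const s (0 : Vec n)).congr_of_eventuallyEq ?_
    filter_upwards [Ioo_mem_nhds hsd.1 hsd.2] with t ht using hxz t ht
  have h3 := h1.unique h2
  have hs0 : 0 ≤ s := h₀.trans (hu.1.trans hsd.1.le)
  simp only [System.velocity, hxz s hsd, Design.φ₁_zero, map_zero, smul_zero, sub_zero,
    zero_add] at h3
  have h4 := (smul_eq_zero.1 h3).resolve_left hb.ne'
  have h5 : z s = 0 := (hS.isInvertible hB hs0 0).injective (by rw [h4, map_zero])
  exact (hrU s (Ioo_subset_Icc_self hsr)).2 h5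

/-! ### Constant-rate decrease of `lyap ^ θ` -/

theorem contDiffAt_lyap_φ₁ (P : Design) (q k₂ : ℝ) {y : Vec n × Vec n} (hy : y.1 ≠ 0) :
    ContDiffAt ℝ 1 (fun y : Vec n × Vec n => lyap P q k₂ (P.φ₁ y.1) y.2) y := by
  have h1 : ContDiffAt ℝ 1 (fun y : Vec n × Vec n => P.φ₁ y.1) y :=
    (Design.contDiffAt_φ₁ hy).comp y contDiffAt_fst
  exact ContDiffAt.comp (g := fun y : Vec n × Vec n => lyap P q k₂ y.1 y.2)
    (f := fun y : Vec n × Vec n => (P.φ₁ y.1, y.2)) y (contDiff_lyap P q k₂).contDiffAt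
    (h1.prodMk contDiffAt_snd)

/-- The exponent for which the power of the Lyapunov function decreases at a constant rate. -/
def Design.θ (P : Design) : ℝ := P.p / (2 * (1 - P.p))

theorem Design.Valid.θ_pos (hP : P.Valid) : 0 < P.θ :=
  div_pos hP.p_pos (by linarith [hP.p_le])

/-- The rate of decrease of `lyap ^ θ`. -/
def lyapRate (P : Design) (q k₂ ε m : ℝ) : ℝ :=
  P.θ * (ε / (|k₂ / P.b| + q + 1)) * (P.α * (1 - P.p) * (m * P.α ^ 2) ^ P.θ)

namespace LyapunovGains

theorem lyapRate_pos (hL : LyapunovGains n P B q k₁ k₂ ε m) (hP : P.Valid) :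
    0 < lyapRate P q k₂ ε m := by
  have h1 := hP.θ_pos
  have h2 := hP.α_pos
  have h3 : 0 < 1 - P.p := by linarith [hP.p_le]
  have h4 := hL.q_pos
  have h5 := hL.ε_pos
  have h6 := hL.m_pos
  unfold lyapRate
  positivity

theorem lyap_nonneg (hL : LyapunovGains n P B q k₁ k₂ ε m) (φ z : Vec n) :
    0 ≤ lyap P q k₂ φ z := by
  refine le_trans ?_ (hL.le_lyap φ z)
  have := hL.m_pos
  positivity

theorem lyap_pos (hL : LyapunovGains n P B q k₁ k₂ ε m) {φ : Vec n} (hφ : φ ≠ 0) (z : Vec n) :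
    0 < lyap P q k₂ φ z := by
  refine lt_of_lt_of_le ?_ (hL.le_lyap φ z)
  have := hL.m_pos
  have : 0 < ‖φ‖ := norm_pos_iff.2 hφ
  positivity

/-- `V̇ ≤ -(ε/M)cV` gives `d(V^θ)/dt ≤ -θ(ε/M)c V^θ`. Here `V^θ ≥ const · ‖x‖^p`, which exactly
offsets the singularity `‖x‖^{-p}` of `c`. -/
theorem rpow_lyapDeriv_le (hL : LyapunovGains n P B q k₁ k₂ ε m) (hP : P.Valid)
    {x z : Vec n} {D : ℝ} (hx : x ≠ 0)
    (hD : D ≤ -(P.c x * (ε * (‖P.φ₁ x‖ ^ 2 + ‖z‖ ^ 2)))) :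
    D * P.θ * lyap P q k₂ (P.φ₁ x) z ^ (P.θ - 1) ≤ -lyapRate P q k₂ ε m := by
  have hθ := hP.θ_pos
  have hα := hP.α_pos
  have hp1 : 0 < 1 - P.p := by linarith [hP.p_le]
  have hq := hL.q_pos
  have hε := hL.ε_pos
  have hm := hL.m_pos
  have hr : 0 < ‖x‖ := norm_pos_iff.2 hx
  set V := lyap P q k₂ (P.φ₁ x) z with hV
  have hVpos : 0 < V := hL.lyap_pos (hP.φ₁_ne_zero hx) z
  set M := |k₂ / P.b| + q + 1 with hM
  have hMpos : 0 < M := by positivity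
  have h1 : V ≤ M * (‖P.φ₁ x‖ ^ 2 + ‖z‖ ^ 2) := lyap_le hq.le _ _
  have h2 : D ≤ -(P.c x * (ε / M * V)) := by
    refine hD.trans (neg_le_neg (mul_le_mul_of_nonneg_left ?_ (hP.c_pos x).le))
    rw [div_mul_eq_mul_div, div_le_iff₀ hMpos, mul_assoc, mul_comm _ M]
    exact mul_le_mul_of_nonneg_left h1 hε.le
  have h3 : (m * P.α ^ 2) ^ P.θ * ‖x‖ ^ P.p ≤ V ^ P.θ := by
    have e1 : P.α * ‖x‖ ^ (1 - P.p) ≤ ‖P.φ₁ x‖ := by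
      rw [hP.norm_φ₁]
      have := hP.β_pos
      have : 0 ≤ P.β * ‖x‖ := by positivity
      linarith
    have e2 : m * P.α ^ 2 * (‖x‖ ^ (1 - P.p)) ^ 2 ≤ V := by
      refine le_trans ?_ (hL.le_lyap (P.φ₁ x) z)
      have := pow_le_pow_left₀ (by positivity) e1 2
      rw [mul_pow] at this
      rw [mul_assoc]
      exact mul_le_mul_of_nonneg_left (by linarith [sq_nonneg ‖z‖]) hm.le
    -- This identity dictates the value of `θ`: `2(1 - p)θ = p`.
    have e3 : ((‖x‖ ^ (1 - P.p)) ^ 2) ^ P.θ = ‖x‖ ^ P.p := by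
      rw [← Real.rpow_natCast, ← Real.rpow_mul hr.le, ← Real.rpow_mul hr.le, Design.θ]
      congr 1
      push_cast
      field_simp
    rw [← e3, ← Real.mul_rpow (by positivity) (by positivity)]
    exact Real.rpow_le_rpow (by positivity) e2 hθ.le
  have h4 : P.α * (1 - P.p) * ‖x‖ ^ (-P.p) ≤ P.c x := by
    rw [Design.c]; linarith [hP.β_pos]
  have h5 : P.α * (1 - P.p) * (m * P.α ^ 2) ^ P.θ ≤ P.c x * V ^ P.θ := by
    calc P.α * (1 - P.p) * (m * P.α ^ 2) ^ P.θ
        = P.α * (1 - P.p) * ‖x‖ ^ (-P.p) * ((m * P.α ^ 2) ^ P.θ * ‖x‖ ^ P.p) := by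
          rw [Real.rpow_neg hr.le]
          field_simp
      _ ≤ P.c x * V ^ P.θ := mul_le_mul h4 h3 (by positivity) (hP.c_pos x).le
  have h6 : V * V ^ (P.θ - 1) = V ^ P.θ := by
    rw [Real.rpow_sub_one hVpos.ne']
    field_simp
  have h7 : 0 ≤ P.θ * V ^ (P.θ - 1) := by positivity
  calc D * P.θ * V ^ (P.θ - 1) = D * (P.θ * V ^ (P.θ - 1)) := by ring
    _ ≤ -(P.c x * (ε / M * V)) * (P.θ * V ^ (P.θ - 1)) := mul_le_mul_of_nonneg_right h2 h7
    _ = -(P.θ * (ε / M) * (P.c x * V ^ P.θ)) := by rw [← h6]; ring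
    _ ≤ -(P.θ * (ε / M) * (P.α * (1 - P.p) * (m * P.α ^ 2) ^ P.θ)) :=
      neg_le_neg (mul_le_mul_of_nonneg_left h5 (by positivity))

/-- At times with `x ≠ 0` the decrease is local. At a time with `x = 0` and `V > 0` one has `z ≠ 0`,
so `x` is nonzero just afterwards. -/
theorem rpow_lyap_le (hL : LyapunovGains n P B q k₁ k₂ ε m) (hP : P.Valid) (hB : B.Valid)
    (hS : S.Admissible P B) (h₀ : 0 ≤ t₀) (ht : t₀ ≤ t₁)
    (h : S.IsTransformedSolution P k₁ k₂ t₀ t₁ x z) :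
    lyap P q k₂ (P.φ₁ (x t₁)) (z t₁) ^ P.θ
      ≤ max (lyap P q k₂ (P.φ₁ (x t₀)) (z t₀) ^ P.θ - lyapRate P q k₂ ε m * (t₁ - t₀)) 0 := by
  obtain ⟨ζ, hz, hζ⟩ := h.z_deriv
  have hx := h.x_deriv
  set κ := lyapRate P q k₂ ε m with hκ
  have hκ0 : 0 < κ := hL.lyapRate_pos hP
  let W : ℝ → ℝ := fun t => lyap P q k₂ (P.φ₁ (x t)) (z t) ^ P.θ
  have hcW : ContinuousOn W (Icc t₀ t₁) := by
    have h1 : ContinuousOn (fun t => (P.φ₁ (x t), z t)) (Icc t₀ t₁) :=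
      (hP.continuous_φ₁.comp_continuousOn (hx.continuousOn ht)).prodMk (hz.continuousOn ht)
    exact ((contDiff_lyap P q k₂).continuous.comp_continuousOn h1).rpow_const
      fun _ _ => Or.inr hP.θ_pos.le
  have hreg : ∀ u ∈ Ico t₀ t₁, x u ≠ 0 → ∀ᶠ s in 𝓝[>] u, W s ≤ W u - κ * (s - u) := by
    intro u hu hxu
    refine eventually_decrease_of_ae_deriv_le hx hz hu
      (Φ := fun y => lyap P q k₂ (P.φ₁ y.1) y.2 ^ P.θ) ?_ hxu ?_
    · exact (contDiffAt_lyap_φ₁ P q k₂ (y := (x u, z u)) hxu).rpow_const_of_ne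
        (hL.lyap_pos (hP.φ₁_ne_zero hxu) _).ne'
    · filter_upwards [hx.ae_hasDerivAt, hz.ae_hasDerivAt, hζ] with s h1 h2 h3 hs hxs
      have hs0 : 0 ≤ s := h₀.trans hs.1.le
      have hzs := h2 hs
      rw [h3 (Ioo_subset_Icc_self hs) hxs] at hzs
      refine ⟨_, (hasDerivAt_lyap P q k₂ (Design.hasDerivAt_φ₁ (h1 hs) hxs) hzs).rpow_const
        (Or.inl (hL.lyap_pos (hP.φ₁_ne_zero hxs) _).ne'), ?_⟩
      exact hL.rpow_lyapDeriv_le hP hxs (hL.lyapDeriv_le S hS s hs0 (x s) (z s) hxs)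
  refine le_max_of_eventually_decrease (W := W) ht hκ0.le hcW fun u hu hWu => ?_
  by_cases hxu : x u = 0
  swap
  · exact hreg u hu hxu
  have hzu : z u ≠ 0 := by
    intro hzu
    simp [W, hxu, hzu, lyap, Real.zero_rpow hP.θ_pos.ne'] at hWu
  have hiso := h.eventually_ne_zero hS hP hB hL.k₁_pos.le h₀ hu hxu hzu
  obtain ⟨r, hr, hrne⟩ := (mem_nhdsGT_iff_exists_Ioo_subset (a := u)).1 hiso
  filter_upwards [Ioo_mem_nhdsGT (lt_min hr hu.2)] with s hs
  have hsr : s < r := hs.2.trans_le (min_le_left _ _)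
  have hst : s < t₁ := hs.2.trans_le (min_le_right _ _)
  have hWs : 0 < W s := Real.rpow_pos_of_pos (hL.lyap_pos (hP.φ₁_ne_zero (hrne ⟨hs.1, hsr⟩)) _) _
  -- The estimate holds on `[s', s]`, where `x ≠ 0`; the maximum with zero is not active since `W s
  -- > 0`. Letting `s'` tend to `u` includes the exceptional time.
  have key : ∀ s' ∈ Ioo u s, W s ≤ W s' - κ * (s - s') := by
    intro s' hs'
    have h1 := le_max_of_eventually_decrease (W := W) hs'.2.le hκ0.le
      (hcW.mono (Icc_subset_Icc (hu.1.trans hs'.1.le) hst.le)) fun τ hτ _ =>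
        hreg τ ⟨hu.1.trans (hs'.1.le.trans hτ.1), hτ.2.trans hst⟩
          (hrne ⟨hs'.1.trans_le hτ.1, hτ.2.trans hsr⟩)
    rcases le_max_iff.1 h1 with h2 | h2
    · exact h2
    · linarith
  have hlim : Tendsto (fun s' => W s' - κ * (s - s')) (𝓝[>] u) (𝓝 (W u - κ * (s - u))) := by
    have h1 : ContinuousWithinAt W (Ioi u) u :=
      (hcW u (Ico_subset_Icc_self hu)).mono_of_mem_nhdsWithin
        (mem_of_superset (Ioo_mem_nhdsGT hu.2) fun s hs => ⟨hu.1.trans hs.1.le, hs.2.le⟩)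
    have h2 : Continuous fun s' => κ * (s - s') := by fun_prop
    exact h1.tendsto.sub ((h2.tendsto u).mono_left nhdsWithin_le_nhds)
  exact ge_of_tendsto hlim (by filter_upwards [Ioo_mem_nhdsGT hs.1] with s' hs' using key s' hs')

theorem lyap_antitone (hL : LyapunovGains n P B q k₁ k₂ ε m) (hP : P.Valid) (hB : B.Valid)
    (hS : S.Admissible P B) (h₀ : 0 ≤ t₀) (ht : t₀ ≤ t₁)
    (h : S.IsTransformedSolution P k₁ k₂ t₀ t₁ x z) :
    lyap P q k₂ (P.φ₁ (x t₁)) (z t₁) ≤ lyap P q k₂ (P.φ₁ (x t₀)) (z t₀) := by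
  have h1 := hL.rpow_lyap_le hP hB hS h₀ ht h
  have h2 : 0 ≤ lyapRate P q k₂ ε m * (t₁ - t₀) :=
    mul_nonneg (hL.lyapRate_pos hP).le (sub_nonneg.2 ht)
  have h3 : 0 ≤ lyap P q k₂ (P.φ₁ (x t₀)) (z t₀) ^ P.θ :=
    Real.rpow_nonneg (hL.lyap_nonneg _ _) _
  refine (Real.rpow_le_rpow_iff (hL.lyap_nonneg _ _) (hL.lyap_nonneg _ _) hP.θ_pos).1
    (h1.trans (max_le (by linarith) h3))

/-! ### Uniform stability and finite-time convergence -/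

theorem stable (hL : LyapunovGains n P B q k₁ k₂ ε m) (hP : P.Valid) (hB : B.Valid)
    (ε' : ℝ) (hε' : 0 < ε') : ∃ δ : ℝ, 0 < δ ∧
    ∀ S : System n, S.Admissible P B → ∀ t₀ : ℝ, 0 ≤ t₀ →
    ∀ x v : ℝ → Vec n, S.IsGlobalSolution P k₁ k₂ t₀ x v →
      ‖x t₀‖ < δ → ‖S.z P x v t₀‖ < δ →
      ∀ t, t₀ ≤ t → ‖x t‖ < ε' ∧ ‖S.z P x v t‖ < ε' := by
  have hm := hL.m_pos
  have hβ := hP.β_pos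
  set M := |k₂ / P.b| + q + 1 with hM
  -- `‖φ₁(x)‖ < βε'` forces `‖x‖ < ε'`, so it suffices to keep both `‖φ₁(x)‖` and `‖z‖` below `c`.
  set c := min (P.β * ε') ε' with hc
  have hc0 : 0 < c := lt_min (by positivity) hε'
  have hη : 0 < m * c ^ 2 / 2 := by positivity
  have hq : 0 ≤ 1 - P.p := by linarith [hP.p_le]
  have hc1 : Continuous fun r : ℝ => M * (P.α * r ^ (1 - P.p) + P.β * r) ^ 2 := by
    have := Real.continuous_rpow_const hq
    fun_prop
  have hc2 : Continuous fun r : ℝ => M * r ^ 2 := by fun_prop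
  have hev : ∀ᶠ r in 𝓝 (0 : ℝ), M * (P.α * r ^ (1 - P.p) + P.β * r) ^ 2 < m * c ^ 2 / 2 ∧
      M * r ^ 2 < m * c ^ 2 / 2 := by
    refine (hc1.continuousAt.eventually (gt_mem_nhds ?_)).and
      (hc2.continuousAt.eventually (gt_mem_nhds (by simpa using hη)))
    have h1p : 1 - P.p ≠ 0 := (sub_pos.2 hP.p_lt_one).ne'
    simpa [Real.zero_rpow h1p] using hη
  obtain ⟨δ, hδ, hball⟩ := Metric.eventually_nhds_iff.1 hev
  have habs : ∀ y : Vec n, ‖y‖ < δ → dist ‖y‖ 0 < δ := by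
    intro y hy
    rwa [Real.dist_eq, sub_zero, abs_norm]
  refine ⟨δ, hδ, fun S hS t₀ h₀ x v hsol hx₀ hz₀ t ht => ?_⟩
  have h1 := hL.lyap_antitone hP hB hS h₀ ht ((hsol t ht).transform hS hP hB h₀ ht)
  have h2 := lyap_le (P := P) (k₂ := k₂) hL.q_pos.le (P.φ₁ (x t₀)) (S.z P x v t₀)
  have h3 := hL.le_lyap (P.φ₁ (x t)) (S.z P x v t)
  have h4 := (hball (habs _ hx₀)).1
  have h5 := (hball (habs _ hz₀)).2
  rw [← hP.norm_φ₁] at h4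
  have h6 : m * (‖P.φ₁ (x t)‖ ^ 2 + ‖S.z P x v t‖ ^ 2) < m * c ^ 2 := by
    rw [← hM, mul_add] at h2
    linarith
  have h7 := lt_of_mul_lt_mul_left h6 hm.le
  constructor
  · have h8 : ‖P.φ₁ (x t)‖ < P.β * ε' :=
      (abs_lt_of_sq_lt_sq' (by linarith [sq_nonneg ‖S.z P x v t‖]) hc0.le).2.trans_le
        (min_le_left _ _)
    exact lt_of_mul_lt_mul_left ((hP.β_mul_le_norm_φ₁ _).trans_lt h8) hβ.le
  · exact (abs_lt_of_sq_lt_sq' (by linarith [sq_nonneg ‖P.φ₁ (x t)‖]) hc0.le).2.trans_le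
      (min_le_right _ _)

theorem finite_time (hL : LyapunovGains n P B q k₁ k₂ ε m) (hP : P.Valid) (hB : B.Valid)
    (R : ℝ) (hR : 0 < R) : ∃ T : ℝ, 0 < T ∧
    ∀ S : System n, S.Admissible P B → ∀ t₀ : ℝ, 0 ≤ t₀ →
    ∀ x v : ℝ → Vec n, S.IsGlobalSolution P k₁ k₂ t₀ x v →
      ‖x t₀‖ ≤ R → ‖S.z P x v t₀‖ ≤ R →
      ∀ t, t₀ + T ≤ t → x t = 0 ∧ S.z P x v t = 0 := by
  have hm := hL.m_pos
  have hα := hP.α_pos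
  have hβ := hP.β_pos
  have hq := hL.q_pos
  have hκ := hL.lyapRate_pos hP
  set M := |k₂ / P.b| + q + 1 with hM
  set Vb := M * (((P.α + P.β) * (1 + R)) ^ 2 + R ^ 2) with hVb
  have hVb0 : 0 < Vb := by positivity
  -- `Vb` bounds the initial value of the Lyapunov function; its power, falling at the constant
  -- rate, is exhausted after this time.
  refine ⟨Vb ^ P.θ / lyapRate P q k₂ ε m, by positivity,
    fun S hS t₀ h₀ x v hsol hx₀ hz₀ t ht => ?_⟩
  have hT : 0 < Vb ^ P.θ / lyapRate P q k₂ ε m := by positivity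
  have htt : t₀ ≤ t := by linarith
  have h1 := hL.rpow_lyap_le hP hB hS h₀ htt ((hsol t htt).transform hS hP hB h₀ htt)
  have h2 : lyap P q k₂ (P.φ₁ (x t₀)) (S.z P x v t₀) ≤ Vb := by
    refine (lyap_le hq.le _ _).trans ?_
    rw [hVb]
    have := (hP.norm_φ₁_le (x t₀)).trans (mul_le_mul_of_nonneg_left
      (by linarith : 1 + ‖x t₀‖ ≤ 1 + R) (by positivity : 0 ≤ P.α + P.β))
    gcongr
  have h3 := Real.rpow_le_rpow (hL.lyap_nonneg _ _) h2 hP.θ_pos.le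
  have h4 : Vb ^ P.θ ≤ lyapRate P q k₂ ε m * (t - t₀) := by
    rw [← div_le_iff₀' hκ]
    linarith
  have h5 : lyap P q k₂ (P.φ₁ (x t)) (S.z P x v t) ^ P.θ ≤ 0 :=
    h1.trans (max_le (by linarith) le_rfl)
  have h6 : lyap P q k₂ (P.φ₁ (x t)) (S.z P x v t) = 0 := by
    by_contra hne
    have := Real.rpow_pos_of_pos (lt_of_le_of_ne (hL.lyap_nonneg _ _) (Ne.symm hne)) P.θ
    linarith
  have h7 := hL.le_lyap (P.φ₁ (x t)) (S.z P x v t)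
  rw [h6] at h7
  constructor
  · by_contra hx
    linarith [hL.lyap_pos (hP.φ₁_ne_zero hx) (S.z P x v t)]
  · have h8 : ‖P.φ₁ (x t)‖ ^ 2 + ‖S.z P x v t‖ ^ 2 ≤ 0 := by
      by_contra! h
      linarith [mul_pos hm h]
    have h9 : ‖S.z P x v t‖ ^ 2 = 0 :=
      le_antisymm (by linarith [sq_nonneg ‖P.φ₁ (x t)‖]) (sq_nonneg _)
    exact norm_eq_zero.1 (pow_eq_zero_iff two_ne_zero |>.1 h9)

end LyapunovGains

end

section

/-! ### Euler polygons -/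

section Euler

variable {E : Type*} [NormedAddCommGroup E] [NormedSpace ℝ E]

/-- The nodes of the Euler polygon of `ẏ = 𝓕(t, y)` with step `h`, with exact integration in time. -/
def eulerNode (𝓕 : ℝ → E → E) (t₀ h : ℝ) (y₀ : E) : ℕ → E
  | 0 => y₀
  | j + 1 => eulerNode 𝓕 t₀ h y₀ j
      + ∫ s in (t₀ + j * h)..(t₀ + (j + 1) * h), 𝓕 s (eulerNode 𝓕 t₀ h y₀ j)

/-- The piecewise constant function through the nodes. -/
def eulerStep (𝓕 : ℝ → E → E) (t₀ h : ℝ) (y₀ : E) (s : ℝ) : E :=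
  eulerNode 𝓕 t₀ h y₀ ⌊(s - t₀) / h⌋₊

/-- The Euler polygon. -/
def eulerCurve (𝓕 : ℝ → E → E) (t₀ h : ℝ) (y₀ : E) (t : ℝ) : E :=
  y₀ + ∫ s in t₀..t, 𝓕 s (eulerStep 𝓕 t₀ h y₀ s)

variable {𝓕 : ℝ → E → E} {t₀ h : ℝ} {y₀ : E}

theorem measurable_eulerStep [MeasurableSpace E] : Measurable (eulerStep 𝓕 t₀ h y₀) := by
  have h1 : Measurable fun s : ℝ => ⌊(s - t₀) / h⌋₊ :=
    Nat.measurable_floor.comp ((measurable_id.sub_const _).div_const _)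
  exact (measurable_from_top (f := eulerNode 𝓕 t₀ h y₀)).comp h1

/-- The step function takes countably many values, so measurability in time at each fixed state
suffices and `𝓕` need not be jointly measurable. -/
theorem measurable_field_eulerStep [MeasurableSpace E] (hm : ∀ y, Measurable fun t => 𝓕 t y) :
    Measurable fun s => 𝓕 s (eulerStep 𝓕 t₀ h y₀ s) := by
  have h1 : Measurable fun s : ℝ => ⌊(s - t₀) / h⌋₊ :=
    Nat.measurable_floor.comp ((measurable_id.sub_const _).div_const _)
  have h2 : Measurable fun p : ℕ × ℝ => 𝓕 p.2 (eulerNode 𝓕 t₀ h y₀ p.1) :=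
    measurable_from_prod_countable_right fun j => hm (eulerNode 𝓕 t₀ h y₀ j)
  exact h2.comp (h1.prodMk measurable_id)

variable {C T : ℝ}

/-- Discrete Grönwall: each step multiplies `1 + ‖node‖` by at most `1 + Ch ≤ exp(Ch)`. -/
theorem one_add_norm_eulerNode_le (hh : 0 < h) (hC : 0 ≤ C)
    (hg : ∀ t ∈ Icc t₀ T, ∀ y, ‖𝓕 t y‖ ≤ C * (1 + ‖y‖)) (j : ℕ) (hj : t₀ + j * h ≤ T) :
    1 + ‖eulerNode 𝓕 t₀ h y₀ j‖ ≤ (1 + ‖y₀‖) * Real.exp (C * (j * h)) := by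
  induction j with
  | zero => simp [eulerNode]
  | succ j ih =>
    push_cast at hj
    have hj' : t₀ + j * h ≤ T := by linarith
    have ih := ih hj'
    have hle : t₀ + j * h ≤ t₀ + (j + 1) * h := by linarith
    have h1 : ‖∫ s in (t₀ + j * h)..(t₀ + (j + 1) * h), 𝓕 s (eulerNode 𝓕 t₀ h y₀ j)‖
        ≤ C * (1 + ‖eulerNode 𝓕 t₀ h y₀ j‖) * |t₀ + (j + 1) * h - (t₀ + j * h)| := by
      refine intervalIntegral.norm_integral_le_of_norm_le_const fun s hs => ?_
      rw [uIoc_of_le hle] at hs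
      exact hg s ⟨by linarith [hs.1, mul_nonneg (Nat.cast_nonneg (α := ℝ) j) hh.le],
        hs.2.trans hj⟩ _
    rw [show t₀ + (j + 1) * h - (t₀ + j * h) = h by ring, abs_of_pos hh] at h1
    have h2 : 1 + C * h ≤ Real.exp (C * h) := by linarith [Real.add_one_le_exp (C * h)]
    have h3 : Real.exp (C * (((j + 1 : ℕ) : ℝ) * h))
        = Real.exp (C * (j * h)) * Real.exp (C * h) := by
      rw [← Real.exp_add]
      push_cast
      congr 1
      ring
    rw [h3, ← mul_assoc]
    calc 1 + ‖eulerNode 𝓕 t₀ h y₀ (j + 1)‖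
        ≤ 1 + (‖eulerNode 𝓕 t₀ h y₀ j‖ + C * (1 + ‖eulerNode 𝓕 t₀ h y₀ j‖) * h) := by
          rw [eulerNode]
          gcongr
          exact (norm_add_le _ _).trans (by linarith)
      _ = (1 + ‖eulerNode 𝓕 t₀ h y₀ j‖) * (1 + C * h) := by ring
      _ ≤ _ := mul_le_mul ih h2 (by positivity) (by positivity)

theorem floor_mul_le (hh : 0 < h) {s : ℝ} (hs : t₀ ≤ s) : t₀ + (⌊(s - t₀) / h⌋₊ : ℝ) * h ≤ s := by
  have h1 := Nat.floor_le (div_nonneg (sub_nonneg.2 hs) hh.le)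
  have h2 := (le_div_iff₀ hh).1 h1
  linarith

theorem lt_floor_add_one_mul (hh : 0 < h) (s : ℝ) :
    s < t₀ + ((⌊(s - t₀) / h⌋₊ : ℝ) + 1) * h := by
  have h1 := Nat.lt_floor_add_one ((s - t₀) / h)
  have h2 := (div_lt_iff₀ hh).1 h1
  linarith

theorem norm_eulerStep_le (hh : 0 < h) (hC : 0 ≤ C)
    (hg : ∀ t ∈ Icc t₀ T, ∀ y, ‖𝓕 t y‖ ≤ C * (1 + ‖y‖)) {s : ℝ} (hs : s ∈ Icc t₀ T) :
    ‖eulerStep 𝓕 t₀ h y₀ s‖ ≤ (1 + ‖y₀‖) * Real.exp (C * (T - t₀)) := by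
  have h1 := floor_mul_le hh hs.1
  have h2 := one_add_norm_eulerNode_le (y₀ := y₀) hh hC hg _ (h1.trans hs.2)
  have h3 : (1 + ‖y₀‖) * Real.exp (C * (⌊(s - t₀) / h⌋₊ * h))
      ≤ (1 + ‖y₀‖) * Real.exp (C * (T - t₀)) := by
    gcongr
    linarith [hs.2]
  rw [eulerStep]
  linarith

theorem norm_field_eulerStep_le (hh : 0 < h) (hC : 0 ≤ C)
    (hg : ∀ t ∈ Icc t₀ T, ∀ y, ‖𝓕 t y‖ ≤ C * (1 + ‖y‖)) {s : ℝ} (hs : s ∈ Icc t₀ T) :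
    ‖𝓕 s (eulerStep 𝓕 t₀ h y₀ s)‖
      ≤ C * (1 + (1 + ‖y₀‖) * Real.exp (C * (T - t₀))) :=
  (hg s hs _).trans (by gcongr; exact norm_eulerStep_le hh hC hg hs)

variable [FiniteDimensional ℝ E]

/-- An Arzelà–Ascoli argument: the values at the countably many times `max t₀ r`, `r` rational, lie
in a product of compact balls, which gives a subsequence converging at these times. The common
Lipschitz bounds carry the Cauchy property to every time. -/
theorem exists_subseq_tendsto_of_lipschitz {f : ℕ → ℝ → E} (h0 : ∀ k, f k t₀ = y₀)
    (hL : ∀ T, ∃ L, ∀ k, ∀ s ∈ Icc t₀ T, ∀ t ∈ Icc t₀ T, ‖f k t - f k s‖ ≤ L * |t - s|) :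
    ∃ σ : ℕ → ℕ, StrictMono σ ∧ ∃ y : ℝ → E, ∀ t, t₀ ≤ t →
      Tendsto (fun k => f (σ k) t) atTop (𝓝 (y t)) := by
  have : ProperSpace E := FiniteDimensional.proper_real E
  choose L hL using hL
  let a : ℚ → ℝ := fun r => max t₀ r
  have ha : ∀ r, t₀ ≤ a r := fun r => le_max_left _ _
  let K : Set (ℚ → E) := Set.pi univ fun r => Metric.closedBall y₀ (L (a r) * |a r - t₀|)
  have hK : IsCompact K := isCompact_univ_pi fun r => isCompact_closedBall _ _
  have hmem : ∀ k, (fun r => f k (a r)) ∈ K := by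
    intro k r _
    rw [Metric.mem_closedBall, dist_eq_norm, ← h0 k]
    exact hL (a r) k t₀ (left_mem_Icc.2 (ha r)) (a r) (right_mem_Icc.2 (ha r))
  obtain ⟨y', -, σ, hσ, hlim⟩ := hK.tendsto_subseq hmem
  rw [tendsto_pi_nhds] at hlim
  refine ⟨σ, hσ, ?_⟩
  have hex : ∀ t, t₀ ≤ t → ∃ l, Tendsto (fun k => f (σ k) t) atTop (𝓝 l) := by
    intro t ht
    refine cauchySeq_tendsto_of_complete (Metric.cauchySeq_iff'.2 fun ε hε => ?_)
    set Λ := |L (t + 1)| + 1 with hΛ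
    have hΛ0 : 0 < Λ := by positivity
    obtain ⟨r, hr1, hr2⟩ := exists_rat_btwn (show t < t + min 1 (ε / (4 * Λ)) from
      lt_add_of_pos_right _ (by positivity))
    have har : a r = r := max_eq_right (ht.trans hr1.le)
    have hr3 : (r : ℝ) ≤ t + 1 := hr2.le.trans (by gcongr; exact min_le_left _ _)
    have hr4 : (r : ℝ) - t < ε / (4 * Λ) := by linarith [min_le_right 1 (ε / (4 * Λ))]
    have hd : ∀ k, dist (f (σ k) t) (f (σ k) r) ≤ ε / 4 := by
      intro k
      rw [dist_comm, dist_eq_norm]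
      refine (hL (t + 1) (σ k) t ⟨ht, by linarith⟩ r ⟨ht.trans hr1.le, hr3⟩).trans ?_
      rw [abs_of_pos (by linarith : (0 : ℝ) < r - t)]
      calc L (t + 1) * (r - t) ≤ Λ * (ε / (4 * Λ)) :=
            mul_le_mul (by linarith [le_abs_self (L (t + 1))]) hr4.le (by linarith) hΛ0.le
        _ = ε / 4 := by field_simp
    have hcau := (hlim r).cauchySeq
    obtain ⟨N, hN⟩ := Metric.cauchySeq_iff'.1 hcau (ε / 4) (by positivity)
    refine ⟨N, fun k hk => ?_⟩
    have h1 := hN k hk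
    simp only [Function.comp_apply, har] at h1
    calc dist (f (σ k) t) (f (σ N) t)
        ≤ dist (f (σ k) t) (f (σ k) r) + dist (f (σ k) r) (f (σ N) r)
          + dist (f (σ N) r) (f (σ N) t) := dist_triangle4 _ _ _ _
      _ < ε := by linarith [hd k, hd N, dist_comm (f (σ N) r) (f (σ N) t)]
  choose! y hy using hex
  exact ⟨y, hy⟩

variable [MeasurableSpace E] [BorelSpace E]

theorem intervalIntegrable_field_eulerStep (hm : ∀ y, Measurable fun t => 𝓕 t y) (hh : 0 < h)
    (hC : 0 ≤ C) (hg : ∀ t ∈ Icc t₀ T, ∀ y, ‖𝓕 t y‖ ≤ C * (1 + ‖y‖)) {a b : ℝ}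
    (ha : a ∈ Icc t₀ T) (hb : b ∈ Icc t₀ T) :
    IntervalIntegrable (fun s => 𝓕 s (eulerStep 𝓕 t₀ h y₀ s)) volume a b := by
  have : ProperSpace E := FiniteDimensional.proper_real E
  rw [intervalIntegrable_iff]
  refine Measure.integrableOn_of_bounded (M := C * (1 + (1 + ‖y₀‖) * Real.exp (C * (T - t₀))))
    (by simp [uIoc]) (measurable_field_eulerStep hm).aestronglyMeasurable ?_
  rw [ae_restrict_iff' measurableSet_uIoc]
  refine Eventually.of_forall fun s hs => norm_field_eulerStep_le hh hC hg ?_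
  have := uIoc_subset_uIcc hs
  exact uIcc_subset_Icc ha hb this

theorem norm_eulerCurve_sub_le (hm : ∀ y, Measurable fun t => 𝓕 t y) (hh : 0 < h)
    (hC : 0 ≤ C) (hg : ∀ t ∈ Icc t₀ T, ∀ y, ‖𝓕 t y‖ ≤ C * (1 + ‖y‖)) {s t : ℝ}
    (hs : s ∈ Icc t₀ T) (ht : t ∈ Icc t₀ T) :
    ‖eulerCurve 𝓕 t₀ h y₀ t - eulerCurve 𝓕 t₀ h y₀ s‖
      ≤ C * (1 + (1 + ‖y₀‖) * Real.exp (C * (T - t₀))) * |t - s| := by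
  have ht₀ : t₀ ∈ Icc t₀ T := left_mem_Icc.2 (hs.1.trans hs.2)
  rw [eulerCurve, eulerCurve, add_sub_add_left_eq_sub, intervalIntegral.integral_interval_sub_left
    (intervalIntegrable_field_eulerStep hm hh hC hg ht₀ ht)
    (intervalIntegrable_field_eulerStep hm hh hC hg ht₀ hs)]
  refine intervalIntegral.norm_integral_le_of_norm_le_const fun τ hτ => ?_
  exact norm_field_eulerStep_le hh hC hg (uIcc_subset_Icc hs ht (uIoc_subset_uIcc hτ))

theorem eulerCurve_node (hm : ∀ y, Measurable fun t => 𝓕 t y) (hh : 0 < h)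
    (hC : 0 ≤ C) (hg : ∀ t ∈ Icc t₀ T, ∀ y, ‖𝓕 t y‖ ≤ C * (1 + ‖y‖)) (j : ℕ)
    (hj : t₀ + j * h ≤ T) : eulerCurve 𝓕 t₀ h y₀ (t₀ + j * h) = eulerNode 𝓕 t₀ h y₀ j := by
  induction j with
  | zero => simp [eulerNode, eulerCurve]
  | succ j ih =>
    push_cast at hj ⊢
    have hj0 : 0 ≤ (j : ℝ) * h := by positivity
    have hj' : t₀ + j * h ≤ T := by linarith
    have hle : t₀ + j * h ≤ t₀ + (j + 1) * h := by linarith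
    have m1 : t₀ ∈ Icc t₀ T := left_mem_Icc.2 (by linarith)
    have m2 : t₀ + j * h ∈ Icc t₀ T := ⟨by linarith, hj'⟩
    have m3 : t₀ + (j + 1) * h ∈ Icc t₀ T := ⟨by linarith, hj⟩
    have h1 : ∫ s in (t₀ + j * h)..(t₀ + (j + 1) * h), 𝓕 s (eulerStep 𝓕 t₀ h y₀ s)
        = ∫ s in (t₀ + j * h)..(t₀ + (j + 1) * h), 𝓕 s (eulerNode 𝓕 t₀ h y₀ j) := by
      refine intervalIntegral.integral_congr_ae ?_
      -- At the right end the floor has already jumped to `j + 1`.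
      have hne : ∀ᵐ s : ℝ, s ≠ t₀ + (j + 1) * h := by simp [ae_iff, measure_singleton]
      filter_upwards [hne] with s hs hs'
      rw [uIoc_of_le hle] at hs'
      have hlt : s < t₀ + (j + 1) * h := lt_of_le_of_ne hs'.2 hs
      have hfl : ⌊(s - t₀) / h⌋₊ = j := by
        rw [Nat.floor_eq_iff (div_nonneg (by linarith [hs'.1]) hh.le), le_div_iff₀ hh,
          div_lt_iff₀ hh]
        constructor <;> linarith [hs'.1]
      rw [eulerStep, hfl]
    rw [eulerNode, ← h1, ← ih hj', eulerCurve, eulerCurve, add_assoc,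
      intervalIntegral.integral_add_adjacent_intervals
      (intervalIntegrable_field_eulerStep hm hh hC hg m1 m2)
      (intervalIntegrable_field_eulerStep hm hh hC hg m2 m3)]

theorem norm_eulerStep_sub_eulerCurve_le (hm : ∀ y, Measurable fun t => 𝓕 t y) (hh : 0 < h)
    (hC : 0 ≤ C) (hg : ∀ t ∈ Icc t₀ T, ∀ y, ‖𝓕 t y‖ ≤ C * (1 + ‖y‖)) {s : ℝ}
    (hs : s ∈ Icc t₀ T) : ‖eulerStep 𝓕 t₀ h y₀ s - eulerCurve 𝓕 t₀ h y₀ s‖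
      ≤ C * (1 + (1 + ‖y₀‖) * Real.exp (C * (T - t₀))) * h := by
  have h1 := floor_mul_le hh hs.1
  have h2 := lt_floor_add_one_mul (t₀ := t₀) hh s
  rw [eulerStep, ← eulerCurve_node hm hh hC hg _ (h1.trans hs.2)]
  have h3 : 0 ≤ (⌊(s - t₀) / h⌋₊ : ℝ) * h := by positivity
  refine (norm_eulerCurve_sub_le hm hh hC hg hs ⟨by linarith, h1.trans hs.2⟩).trans ?_
  gcongr
  rw [abs_le]
  constructor <;> linarith

/-- No continuity in the state is assumed, since `φ₂` may jump at the origin. Hence the statement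
stops at the convergence of the arguments `ξ k` and of the integrals; identifying the limit of the
integrands is a separate matter. -/
theorem exists_euler_limit (hm : ∀ y, Measurable fun t => 𝓕 t y)
    (hg : ∀ T, ∃ C, 0 ≤ C ∧ ∀ t ∈ Icc t₀ T, ∀ y, ‖𝓕 t y‖ ≤ C * (1 + ‖y‖)) :
    ∃ (ξ : ℕ → ℝ → E) (y : ℝ → E), y t₀ = y₀ ∧ ContinuousOn y (Ici t₀) ∧
      (∀ k, Measurable (ξ k)) ∧ (∀ k, Measurable fun s => 𝓕 s (ξ k s)) ∧
      (∀ T, ∃ R, ∀ k, ∀ s ∈ Icc t₀ T, ‖ξ k s‖ ≤ R) ∧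
      (∀ s, t₀ ≤ s → Tendsto (fun k => ξ k s) atTop (𝓝 (y s))) ∧
      (∀ t, t₀ ≤ t → Tendsto (fun k => y₀ + ∫ s in t₀..t, 𝓕 s (ξ k s)) atTop (𝓝 (y t))) := by
  choose C hC hg using hg
  let hs : ℕ → ℝ := fun k => 1 / ((k : ℝ) + 1)
  have hs0 : ∀ k, 0 < hs k := fun k => by positivity
  obtain ⟨σ, hσ, y, hy⟩ := exists_subseq_tendsto_of_lipschitz (t₀ := t₀) (y₀ := y₀)
    (f := fun k => eulerCurve 𝓕 t₀ (hs k) y₀) (fun k => by simp [eulerCurve])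
    (fun T => ⟨_, fun k s hs' t ht => norm_eulerCurve_sub_le hm (hs0 k) (hC T) (hg T) hs' ht⟩)
  refine ⟨fun k => eulerStep 𝓕 t₀ (hs (σ k)) y₀, y, ?_, ?_, fun k => measurable_eulerStep,
    fun k => measurable_field_eulerStep hm,
    fun T => ⟨_, fun k s hs' => norm_eulerStep_le (hs0 _) (hC T) (hg T) hs'⟩, ?_, hy⟩
  · refine tendsto_nhds_unique (hy t₀ le_rfl) ?_
    simp [eulerCurve]
  · intro s hs'
    have hs'' : t₀ ≤ s := hs'
    set L := C (s + 1) * (1 + (1 + ‖y₀‖) * Real.exp (C (s + 1) * (s + 1 - t₀))) with hLdef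
    have hLip : ∀ t ∈ Icc t₀ (s + 1), ‖y t - y s‖ ≤ L * |t - s| := fun t ht =>
      le_of_tendsto ((hy t ht.1).sub (hy s hs'')).norm (Eventually.of_forall fun k =>
        norm_eulerCurve_sub_le hm (hs0 _) (hC _) (hg _) ⟨hs'', by linarith⟩ ht)
    rw [ContinuousWithinAt, tendsto_iff_norm_sub_tendsto_zero]
    have hlim : Tendsto (fun t => L * |t - s|) (𝓝[Ici t₀] s) (𝓝 0) := by
      have hc : Continuous fun t => L * |t - s| := by fun_prop
      have := hc.tendsto s
      rw [sub_self, abs_zero, mul_zero] at this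
      exact this.mono_left nhdsWithin_le_nhds
    refine squeeze_zero' (Eventually.of_forall fun _ => norm_nonneg _) ?_ hlim
    filter_upwards [self_mem_nhdsWithin,
      nhdsWithin_le_nhds (Iio_mem_nhds (lt_add_one s))] with t h1 h2
    exact hLip t ⟨h1, le_of_lt h2⟩
  · intro s hs'
    have h1 : Tendsto (fun k => eulerStep 𝓕 t₀ (hs (σ k)) y₀ s
        - eulerCurve 𝓕 t₀ (hs (σ k)) y₀ s) atTop (𝓝 0) := by
      set L := C s * (1 + (1 + ‖y₀‖) * Real.exp (C s * (s - t₀))) with hLdef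
      have hlim : Tendsto (fun k => L * hs (σ k)) atTop (𝓝 0) := by
        have := (tendsto_one_div_add_atTop_nhds_zero_nat (𝕜 := ℝ)).comp hσ.tendsto_atTop
        simpa [hs] using this.const_mul L
      exact squeeze_zero_norm (fun k => norm_eulerStep_sub_eulerCurve_le hm (hs0 _) (hC s) (hg s)
        ⟨hs', le_rfl⟩) hlim
    have h2 := h1.add (hy s hs')
    simpa using h2

end Euler

end

section

/-! ### Existence of solutions -/

section Integral

variable {E : Type*} [NormedAddCommGroup E]

theorem intervalIntegrable_of_norm_le {g : ℝ → E} {a b M : ℝ} (hab : a ≤ b)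
    (hm : AEStronglyMeasurable g volume) (hbd : ∀ s ∈ Icc a b, ‖g s‖ ≤ M) :
    IntervalIntegrable g volume a b := by
  rw [intervalIntegrable_iff_integrableOn_Ioc_of_le hab]
  refine Measure.integrableOn_of_bounded (M := M) (by simp) hm ?_
  rw [ae_restrict_iff' measurableSet_Ioc]
  exact Eventually.of_forall fun s hs => hbd s (Ioc_subset_Icc_self hs)

variable [NormedSpace ℝ E]

theorem tendsto_intervalIntegral_of_norm_le {G : ℕ → ℝ → E} {g : ℝ → E} {a b M : ℝ} (hab : a ≤ b)
    (hm : ∀ k, AEStronglyMeasurable (G k) volume) (hbd : ∀ k, ∀ s ∈ Icc a b, ‖G k s‖ ≤ M)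
    (hlim : ∀ s ∈ Icc a b, Tendsto (fun k => G k s) atTop (𝓝 (g s))) :
    IntervalIntegrable g volume a b ∧
      Tendsto (fun k => ∫ s in a..b, G k s) atTop (𝓝 (∫ s in a..b, g s)) := by
  have hlim' : ∀ᵐ s ∂volume.restrict (Ioc a b), Tendsto (fun k => G k s) atTop (𝓝 (g s)) := by
    rw [ae_restrict_iff' measurableSet_Ioc]
    exact Eventually.of_forall fun s hs => hlim s (Ioc_subset_Icc_self hs)
  constructor
  · rw [intervalIntegrable_iff_integrableOn_Ioc_of_le hab]
    refine (integrable_const M).mono'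
      (aestronglyMeasurable_of_tendsto_ae atTop (fun k => (hm k).restrict) hlim') ?_
    rw [ae_restrict_iff' measurableSet_Ioc]
    exact Eventually.of_forall fun s hs => le_of_tendsto (hlim s (Ioc_subset_Icc_self hs)).norm
      (Eventually.of_forall fun k => hbd k s (Ioc_subset_Icc_self hs))
  · refine intervalIntegral.tendsto_integral_filter_of_dominated_convergence (fun _ => M)
      (Eventually.of_forall fun k => (hm k).restrict) (Eventually.of_forall fun k =>
        Eventually.of_forall fun s hs => ?_) (by simp) (Eventually.of_forall fun s hs => ?_)
    · rw [uIoc_of_le hab] at hs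
      exact hbd k s (Ioc_subset_Icc_self hs)
    · rw [uIoc_of_le hab] at hs
      exact hlim s (Ioc_subset_Icc_self hs)

end Integral

theorem Design.measurable_φ₂ (P : Design) : Measurable (P.φ₂ : Vec n → Vec n) := by
  have h1 : Measurable fun x : Vec n => ‖x‖ ^ (-P.p) := measurable_norm.pow_const _
  unfold Design.φ₂ Design.c Design.φ₁
  exact ((h1.const_mul _).add_const _).smul (((h1.const_mul _).add_const _).smul measurable_id)

theorem Design.Valid.exists_norm_φ₂_le {P : Design} (hP : P.Valid) :
    ∃ C, 0 ≤ C ∧ ∀ (n : ℕ) (x : Vec n), ‖P.φ₂ x‖ ≤ C * (1 + ‖x‖) := by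
  have hα := hP.α_pos
  have hβ := hP.β_pos
  have h3 : 0 < 1 - P.p := by linarith [hP.p_le]
  have h4 : 0 < 2 - P.p := by linarith [hP.p_le]
  exact ⟨P.α ^ 2 * (1 - P.p) + P.α * P.β * (2 - P.p) + P.β ^ 2, by positivity,
    fun n x => (hP.norm_φ₂ x).trans (hP.ψ_le (norm_nonneg x))⟩

/-- A limit `N` of integrals of `φ₂` along curves converging to `x` is an integral of a selection
of the Filippov regularization along `x`. -/
theorem Design.Valid.exists_filippov_selection {P : Design} (hP : P.Valid) {t₀ : ℝ}
    {x : ℝ → Vec n} (hx : Continuous x) {χ : ℕ → ℝ → Vec n} (hχm : ∀ k, Measurable (χ k))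
    (hχb : ∀ T, ∃ R, ∀ k, ∀ s ∈ Icc t₀ T, ‖χ k s‖ ≤ R)
    (hχ : ∀ s, t₀ ≤ s → Tendsto (fun k => χ k s) atTop (𝓝 (x s))) {N : ℝ → Vec n}
    (hN : ∀ t, t₀ ≤ t → Tendsto (fun k => ∫ s in t₀..t, P.φ₂ (χ k s)) atTop (𝓝 (N t))) :
    ∃ w : ℝ → Vec n, ∀ T, t₀ ≤ T → (∀ᵐ s, s ∈ Icc t₀ T → w s ∈ filippov P.φ₂ (x s)) ∧
      HasACDeriv N w t₀ T := by
  have hφm := P.measurable_φ₂ (n := n)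
  have hφx : Measurable fun s => P.φ₂ (x s) := hφm.comp hx.measurable
  have hφχ : ∀ k, Measurable fun s => P.φ₂ (χ k s) := fun k => hφm.comp (hχm k)
  have hψ0 : 0 ≤ P.ψ 0 := hP.ψ_nonneg le_rfl
  -- uniform bounds
  have hbχ : ∀ T, ∃ R, ∀ s ∈ Icc t₀ T, (∀ k, ‖P.φ₂ (χ k s)‖ ≤ R ∧ P.ψ ‖χ k s‖ ≤ R) ∧
      ‖P.φ₂ (x s)‖ ≤ R := by
    intro T
    obtain ⟨R, hR⟩ := hχb T
    refine ⟨P.ψ R, fun s hs => ?_⟩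
    have h1 : ∀ k, P.ψ ‖χ k s‖ ≤ P.ψ R := fun k => hP.monotoneOn_ψ (norm_nonneg _)
      ((norm_nonneg _).trans (hR k s hs)) (hR k s hs)
    have h2 : ‖x s‖ ≤ R := le_of_tendsto (hχ s hs.1).norm (Eventually.of_forall fun k => hR k s hs)
    exact ⟨fun k => ⟨(hP.norm_φ₂ _).trans (h1 k), h1 k⟩, (hP.norm_φ₂ _).trans
      (hP.monotoneOn_ψ (norm_nonneg _) ((norm_nonneg _).trans h2) h2)⟩
  have hix : ∀ {s t}, t₀ ≤ s → s ≤ t → IntervalIntegrable (fun τ => P.φ₂ (x τ)) volume s t := by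
    intro s t hs hst
    obtain ⟨R, hR⟩ := hbχ t
    exact intervalIntegrable_of_norm_le hst hφx.aestronglyMeasurable
      fun τ hτ => (hR τ ⟨hs.trans hτ.1, hτ.2⟩).2
  have hiχ : ∀ k {s t}, t₀ ≤ s → s ≤ t →
      IntervalIntegrable (fun τ => P.φ₂ (χ k τ)) volume s t := by
    intro k s t hs hst
    obtain ⟨R, hR⟩ := hbχ t
    exact intervalIntegrable_of_norm_le hst (hφχ k).aestronglyMeasurable
      fun τ hτ => ((hR τ ⟨hs.trans hτ.1, hτ.2⟩).1 k).1
  let Z : Set ℝ := {τ | x τ = 0}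
  have hZc : IsClosed Z := isClosed_eq hx continuous_const
  -- the part of the limit that is concentrated on `Z`
  let e : ℝ → Vec n := fun t => N t - ∫ s in t₀..t, P.φ₂ (x s)
  have hesub : ∀ s t, t₀ ≤ s → s ≤ t →
      ‖e t - e s‖ ≤ ∫ τ in s..t, Z.indicator (fun _ => P.ψ 0) τ := by
    intro s t hs hst
    obtain ⟨R, hR⟩ := hbχ t
    -- `g k` dominates `‖φ₂(χ k) - φ₂(x)‖`. Off `Z` it tends to zero by continuity of `φ₂`; on `Z`,
    -- where `φ₂(x)` is assigned the value zero, it tends to `ψ 0`.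
    let g : ℕ → ℝ → ℝ := fun k τ => Z.indicator (fun τ => P.ψ ‖χ k τ‖) τ
      + Zᶜ.indicator (fun τ => ‖P.φ₂ (χ k τ) - P.φ₂ (x τ)‖) τ
    have hgm : ∀ k, Measurable (g k) := fun k =>
      ((hP.continuous_ψ.measurable.comp (hχm k).norm).indicator hZc.measurableSet).add
        (((hφχ k).sub hφx).norm.indicator hZc.measurableSet.compl)
    have hgb : ∀ k, ∀ τ ∈ Icc s t, ‖g k τ‖ ≤ R + R := by
      intro k τ hτ
      have h1 := hR τ ⟨hs.trans hτ.1, hτ.2⟩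
      have h2 := hP.ψ_nonneg (norm_nonneg (χ k τ))
      by_cases hz : τ ∈ Z
      · simp only [g, indicator_of_mem hz, indicator_of_notMem (notMem_compl_iff.2 hz), add_zero]
        rw [Real.norm_of_nonneg h2]
        linarith [(h1.1 k).2]
      · simp only [g, indicator_of_notMem hz, indicator_of_mem (mem_compl hz), zero_add]
        rw [norm_norm]
        exact (norm_sub_le _ _).trans (add_le_add (h1.1 k).1 h1.2)
    have hgl : ∀ τ ∈ Icc s t, Tendsto (fun k => g k τ) atTop
        (𝓝 (Z.indicator (fun _ => P.ψ 0) τ)) := by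
      intro τ hτ
      have h1 := hχ τ (hs.trans hτ.1)
      by_cases hz : τ ∈ Z
      · simp only [g, indicator_of_mem hz, indicator_of_notMem (notMem_compl_iff.2 hz), add_zero]
        rw [show x τ = 0 from hz] at h1
        have h2 := h1.norm
        rw [norm_zero] at h2
        exact (hP.continuous_ψ.tendsto 0).comp h2
      · simp only [g, indicator_of_notMem hz, indicator_of_mem (mem_compl hz), zero_add]
        have h2 := (((Design.continuousAt_φ₂ (P := P) hz).tendsto.comp h1).sub_const (P.φ₂ (x τ))).norm
        rwa [sub_self, norm_zero] at h2
    obtain ⟨-, hg⟩ := tendsto_intervalIntegral_of_norm_le hst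
      (fun k => (hgm k).aestronglyMeasurable) hgb hgl
    have ht := hs.trans hst
    have hlim : Tendsto (fun k => ‖∫ τ in s..t, (P.φ₂ (χ k τ) - P.φ₂ (x τ))‖) atTop
        (𝓝 ‖e t - e s‖) := by
      have h1 := (((hN t ht).sub (hN s hs)).sub_const (∫ τ in s..t, P.φ₂ (x τ))).norm
      have h2 : N t - N s - ∫ τ in s..t, P.φ₂ (x τ) = e t - e s := by
        simp only [e]
        rw [← intervalIntegral.integral_add_adjacent_intervals (hix le_rfl hs) (hix hs hst)]
        abel
      rw [h2] at h1
      refine h1.congr fun k => ?_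
      rw [intervalIntegral.integral_sub (hiχ k hs hst) (hix hs hst),
        ← intervalIntegral.integral_add_adjacent_intervals (hiχ k le_rfl hs) (hiχ k hs hst)]
      congr 1
      abel
    refine le_of_tendsto_of_tendsto' hlim hg fun k => ?_
    refine (intervalIntegral.norm_integral_le_integral_norm hst).trans ?_
    refine intervalIntegral.integral_mono_on hst ((hiχ k hs hst).sub (hix hs hst)).norm
      (intervalIntegrable_of_norm_le hst (hgm k).aestronglyMeasurable (hgb k)) fun τ hτ => ?_
    by_cases hz : τ ∈ Z
    · simp only [g, indicator_of_mem hz, indicator_of_notMem (notMem_compl_iff.2 hz), add_zero]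
      rw [show x τ = 0 from hz, Design.φ₂_zero, sub_zero]
      exact hP.norm_φ₂ _
    · simp only [g, indicator_of_notMem hz, indicator_of_mem (mem_compl hz), zero_add]
      exact le_rfl
  have heL : ∀ T, LipschitzOnWith (Real.toNNReal (P.ψ 0)) e (Icc t₀ T) := by
    intro T
    have h1 : ∀ s t, t₀ ≤ s → s ≤ t → ‖e t - e s‖ ≤ P.ψ 0 * |t - s| := by
      intro s t hs hst
      refine (hesub s t hs hst).trans ((le_abs_self _).trans ?_)
      rw [← Real.norm_eq_abs]
      refine intervalIntegral.norm_integral_le_of_norm_le_const fun τ _ => ?_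
      rw [Real.norm_of_nonneg (indicator_nonneg (fun _ _ => hψ0) _)]
      exact indicator_le_self' (fun _ _ => hψ0) τ
    refine LipschitzOnWith.of_dist_le_mul fun s hs t ht => ?_
    rw [Real.coe_toNNReal _ hψ0, dist_eq_norm, Real.dist_eq]
    rcases le_total s t with hst | hst
    · rw [norm_sub_rev, abs_sub_comm]
      exact h1 s t hs.1 hst
    · exact h1 t s ht.1 hst
  have hediff : ∀ T, ∀ᵐ s, s ∈ Ioo t₀ T → HasDerivAt e (deriv e s) s := by
    intro T
    filter_upwards [(heL T).ae_differentiableWithinAt_of_mem_real] with s hs hs'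
    exact ((hs (Ioo_subset_Icc_self hs')).differentiableAt (Icc_mem_nhds hs'.1 hs'.2)).hasDerivAt
  have heac : ∀ T, t₀ ≤ T → HasACDeriv e (deriv e) t₀ T := fun T hT =>
    HasACDeriv.of_lipschitzOnWith hT (heL T) (hediff T)
  -- Off `Z` the defect `e` is locally constant and the selection is `φ₂(x)`. On `Z` it is `e'`, of
  -- norm at most the Lipschitz constant `ψ 0`, hence in the Filippov set. No weak compactness is
  -- needed.
  refine ⟨fun s => deriv e s + P.φ₂ (x s), fun T hT => ⟨?_, ?_⟩⟩
  · have hne : ∀ᵐ s : ℝ, s ≠ t₀ ∧ s ≠ T := by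
      have h1 : ∀ᵐ s : ℝ, s ≠ t₀ := by simp [ae_iff, measure_singleton]
      have h2 : ∀ᵐ s : ℝ, s ≠ T := by simp [ae_iff, measure_singleton]
      exact h1.and h2
    filter_upwards [hediff T, hne] with s hs hsne hs'
    have hs'' : s ∈ Ioo t₀ T := ⟨lt_of_le_of_ne hs'.1 hsne.1.symm, lt_of_le_of_ne hs'.2 hsne.2⟩
    have hd := hs hs''
    by_cases hz : x s = 0
    · rw [hz, Design.φ₂_zero, add_zero]
      refine hP.closedBall_subset_filippov ?_
      rw [mem_closedBall_zero_iff]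
      have := hd.le_of_lipschitzOn (Icc_mem_nhds hs''.1 hs''.2) (heL T)
      rwa [Real.coe_toNNReal _ hψ0] at this
    · have h0 : HasDerivAt e 0 s := by
        have hev : ∀ᶠ t in 𝓝 s, t ∈ Zᶜ := hZc.isOpen_compl.mem_nhds hz
        obtain ⟨r, hr, hrZ⟩ := Metric.eventually_nhds_iff_ball.1 hev
        refine (hasDerivAt_const s (e s)).congr_of_eventuallyEq ?_
        filter_upwards [Metric.ball_mem_nhds s hr, Ioi_mem_nhds hs''.1] with t ht ht'
        have hzero : ∀ a b, a ≤ b → t₀ ≤ a → a ∈ Metric.ball s r → b ∈ Metric.ball s r →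
            e b - e a = 0 := by
          intro a b hab ha ham hbm
          refine norm_le_zero_iff.1 ((hesub a b ha hab).trans (le_of_eq ?_))
          refine intervalIntegral.integral_zero_ae (Eventually.of_forall fun τ hτ => ?_)
          rw [uIoc_of_le hab] at hτ
          refine indicator_of_notMem (hrZ τ ?_) _
          rw [Real.ball_eq_Ioo] at ham hbm ⊢
          exact ⟨ham.1.trans hτ.1, hτ.2.trans_lt hbm.2⟩
        rcases le_total s t with hst | hst
        · exact sub_eq_zero.1 (hzero s t hst hs''.1.le (Metric.mem_ball_self hr) ht)
        · exact (sub_eq_zero.1 (hzero t s hst (le_of_lt ht') ht (Metric.mem_ball_self hr))).symm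
      rw [hd.unique h0, zero_add]
      exact Design.mem_filippov_of_continuousAt (Design.continuousAt_φ₂ hz)
  · have hbase : HasACDeriv (fun t => ∫ s in t₀..t, P.φ₂ (x s)) (fun s => P.φ₂ (x s)) t₀ T :=
      ⟨hix le_rfl hT, fun t _ => by simp⟩
    refine ((heac T hT).add hbase).congr hT (fun t _ => ?_) (Eventually.of_forall fun _ _ => rfl)
    simp [e]

variable {S : System n} {P : Design} {B : Bounds}

theorem System.Admissible.exists_globalSolution (hS : S.Admissible P B) (hP : P.Valid)
    (hB : B.Valid) (k₁ : ℝ) {k₂ : ℝ} (hk₂ : k₂ ≠ 0) {t₀ : ℝ} (ht₀ : 0 ≤ t₀) (x₀ v₀ : Vec n) :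
    ∃ x v : ℝ → Vec n, S.IsGlobalSolution P k₁ k₂ t₀ x v ∧ x t₀ = x₀ ∧ v t₀ = v₀ := by
  -- Measurability in time is assumed for `t ≥ 0` only, so the first component is extended by zero
  -- to negative times.
  let 𝓕 : ℝ → Vec n × Vec n → Vec n × Vec n := fun t y =>
    ((Ici (0 : ℝ)).indicator (fun t => S.field P k₁ t y) t, -(k₂ • P.φ₂ y.1))
  have h𝓕 : ∀ t, t₀ ≤ t → ∀ y, 𝓕 t y = (S.field P k₁ t y, -(k₂ • P.φ₂ y.1)) := fun t ht y => by
    simp only [𝓕]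
    rw [indicator_of_mem (show t ∈ Ici (0 : ℝ) from ht₀.trans ht)]
  have hm : ∀ y, Measurable fun t => 𝓕 t y := by
    intro y
    refine Measurable.prodMk ?_ measurable_const
    refine measurable_of_restrict_of_restrict_compl measurableSet_Ici (s := Ici (0 : ℝ)) ?_ ?_
    · convert hS.measurable_field k₁ y using 1
      exact funext fun t => indicator_of_mem t.2 fun t => S.field P k₁ t y
    · convert measurable_const (a := (0 : Vec n)) using 1
      exact funext fun t => indicator_of_notMem t.2 fun t => S.field P k₁ t y
  obtain ⟨Cφ, hCφ, hφ⟩ := hP.exists_norm_φ₂_le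
  have hg : ∀ T, ∃ C, 0 ≤ C ∧ ∀ t ∈ Icc t₀ T, ∀ y, ‖𝓕 t y‖ ≤ C * (1 + ‖y‖) := by
    intro T
    obtain ⟨C, hC, hF⟩ := hS.exists_norm_field_le hP hB k₁ (T := max T 0) (le_max_right _ _)
    refine ⟨2 * C + |k₂| * Cφ, by positivity, fun t ht y => ?_⟩
    have h1 : ‖y.1‖ ≤ ‖y‖ := norm_fst_le y
    have h2 : ‖y.2‖ ≤ ‖y‖ := norm_snd_le y
    have h3 := hF t ⟨ht₀.trans ht.1, ht.2.trans (le_max_left _ _)⟩ y.1 y.2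
    have h4 : ‖-(k₂ • P.φ₂ y.1)‖ ≤ |k₂| * (Cφ * (1 + ‖y‖)) := by
      rw [norm_neg, norm_smul, Real.norm_eq_abs]
      gcongr
      exact (hφ n y.1).trans (by gcongr)
    have h5 : C * (1 + ‖y.1‖ + ‖y.2‖) ≤ C * (2 * (1 + ‖y‖)) := by
      gcongr
      linarith
    have h6 : 0 ≤ C * (1 + ‖y‖) := by positivity
    have h7 : 0 ≤ |k₂| * (Cφ * (1 + ‖y‖)) := by positivity
    rw [h𝓕 t ht.1, Prod.norm_def]
    exact max_le (by linarith) (by linarith)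
  obtain ⟨ξ, y₁, hy0, hyc, hξm, h𝓕m, hξb, hξ, hint⟩ :=
    exists_euler_limit (𝓕 := 𝓕) (t₀ := t₀) (y₀ := (x₀, v₀)) hm hg
  -- Freezing the limit before `t₀` makes it continuous on the whole line.
  let y : ℝ → Vec n × Vec n := fun t => y₁ (max t₀ t)
  have hyy : ∀ t, t₀ ≤ t → y t = y₁ t := fun t ht => by simp only [y, max_eq_right ht]
  have hyc' : Continuous y :=
    hyc.comp_continuous (continuous_const.max continuous_id) fun t =>
      mem_Ici.2 (le_max_left _ _)
  have hξ' : ∀ s, t₀ ≤ s → Tendsto (fun k => ξ k s) atTop (𝓝 (y s)) := fun s hs => by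
    rw [hyy s hs]; exact hξ s hs
  have hbd : ∀ T, ∃ M, ∀ k, ∀ s ∈ Icc t₀ T, ‖𝓕 s (ξ k s)‖ ≤ M := by
    intro T
    obtain ⟨R, hR⟩ := hξb T
    obtain ⟨C, hC, hF⟩ := hg T
    exact ⟨C * (1 + R), fun k s hs => (hF s hs _).trans (by gcongr; exact hR k s hs)⟩
  have hi : ∀ k t, t₀ ≤ t → IntervalIntegrable (fun s => 𝓕 s (ξ k s)) volume t₀ t := by
    intro k t ht
    obtain ⟨M, hM⟩ := hbd t
    exact intervalIntegrable_of_norm_le ht (h𝓕m k).aestronglyMeasurable (hM k)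
  refine ⟨fun t => (y t).1, fun t => (y t).2, ?_, by simp only [hyy t₀ le_rfl, hy0],
    by simp only [hyy t₀ le_rfl, hy0]⟩
  have hxlim : ∀ t, t₀ ≤ t → IntervalIntegrable (fun s => S.field P k₁ s (y s)) volume t₀ t ∧
      (y t).1 = x₀ + ∫ s in t₀..t, S.field P k₁ s (y s) := by
    intro t ht
    obtain ⟨M, hM⟩ := hbd t
    obtain ⟨h1, h2⟩ := tendsto_intervalIntegral_of_norm_le
      (G := fun k s => (𝓕 s (ξ k s)).1) (g := fun s => S.field P k₁ s (y s)) (M := M) ht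
      (fun k => (measurable_fst.comp (h𝓕m k)).aestronglyMeasurable)
      (fun k s hs => (norm_fst_le _).trans (hM k s hs)) (fun s hs => by
        have hc := (hS.continuous_field hP (ht₀.trans hs.1) k₁).continuousAt (x := y s)
        refine (hc.tendsto.comp (hξ' s hs.1)).congr fun k => ?_
        rw [h𝓕 s hs.1]
        rfl)
    refine ⟨h1, tendsto_nhds_unique ?_ (h2.const_add x₀)⟩
    have h3 := (continuous_fst.tendsto _).comp (hint t ht)
    rw [← hyy t ht] at h3
    refine h3.congr fun k => ?_
    have h4 : ∫ s in t₀..t, (𝓕 s (ξ k s)).1 = (∫ s in t₀..t, 𝓕 s (ξ k s)).1 :=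
      (ContinuousLinearMap.fst ℝ (Vec n) (Vec n)).intervalIntegral_comp_comm (hi k t ht)
    rw [h4]
    rfl
  have hvlim : ∀ t, t₀ ≤ t → Tendsto (fun k => ∫ s in t₀..t, P.φ₂ (ξ k s).1) atTop
      (𝓝 (k₂⁻¹ • (v₀ - (y t).2))) := by
    intro t ht
    have h3 := (continuous_snd.tendsto _).comp (hint t ht)
    rw [← hyy t ht] at h3
    refine ((h3.const_sub v₀).const_smul k₂⁻¹).congr fun k => ?_
    have h4 : ∫ s in t₀..t, (𝓕 s (ξ k s)).2 = (∫ s in t₀..t, 𝓕 s (ξ k s)).2 :=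
      (ContinuousLinearMap.snd ℝ (Vec n) (Vec n)).intervalIntegral_comp_comm (hi k t ht)
    have h5 : ∫ s in t₀..t, (𝓕 s (ξ k s)).2 = -(k₂ • ∫ s in t₀..t, P.φ₂ (ξ k s).1) := by
      simp only [𝓕, intervalIntegral.integral_neg, intervalIntegral.integral_smul]
    simp only [Function.comp_apply, Prod.snd_add]
    rw [← h4, h5]
    rw [sub_add_cancel_left, neg_neg, inv_smul_smul₀ hk₂]
  obtain ⟨w, hw⟩ := hP.exists_filippov_selection (t₀ := t₀) (x := fun t => (y t).1)
    (continuous_fst.comp hyc') (χ := fun k s => (ξ k s).1)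
    (fun k => measurable_fst.comp (hξm k))
    (fun T => (hξb T).imp fun R hR k s hs => (norm_fst_le _).trans (hR k s hs))
    (fun s hs => (continuous_fst.tendsto _).comp (hξ' s hs)) hvlim
  intro t₁ ht₁
  refine ⟨⟨(hxlim t₁ ht₁).1, fun t ht => ?_⟩, w, (hw t₁ ht₁).1, ?_⟩
  · change (y t).1 = (y t₀).1 + ∫ s in t₀..t, S.field P k₁ s (y s)
    rw [(hxlim t ht.1).2, hyy t₀ le_rfl, hy0]
  · have hconst : HasACDeriv (fun _ => v₀) (fun _ => 0) t₀ t₁ := ⟨by simp, fun t _ => by simp⟩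
    refine (hconst.add ((hw t₁ ht₁).2.const_smul (-k₂))).congr ht₁ (fun t _ => ?_)
      (Eventually.of_forall fun s _ => ?_)
    · simp only [neg_smul, smul_inv_smul₀ hk₂]
      abel
    · simp

end

section

/-! ### Continuation of solutions -/

variable {S : System n} {P : Design} {B : Bounds} {q k₁ k₂ ε m a b c : ℝ}
  {x v x' v' : ℝ → Vec n}

namespace System.IsSolution

theorem mono (h : S.IsSolution P k₁ k₂ a c x v) (hab : a ≤ b) (hbc : b ≤ c) :
    S.IsSolution P k₁ k₂ a b x v := by
  obtain ⟨hx, w, hw, hv⟩ := h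
  refine ⟨hx.mono le_rfl hab hbc, w, ?_, hv.mono le_rfl hab hbc⟩
  filter_upwards [hw] with s hs hs'
  exact hs ⟨hs'.1, hs'.2.trans hbc⟩

theorem congr (h : S.IsSolution P k₁ k₂ a b x v) (hab : a ≤ b)
    (hx : ∀ t ∈ Icc a b, x' t = x t) (hv : ∀ t ∈ Icc a b, v' t = v t) :
    S.IsSolution P k₁ k₂ a b x' v' := by
  obtain ⟨h1, w, hw, h2⟩ := h
  refine ⟨h1.congr hab hx (Eventually.of_forall fun s hs => ?_), w, ?_,
    h2.congr hab hv (Eventually.of_forall fun _ _ => rfl)⟩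
  · rw [hx s (Ioo_subset_Icc_self hs), hv s (Ioo_subset_Icc_self hs)]
  · filter_upwards [hw] with s hs hs'
    rw [hx s hs']
    exact hs hs'

theorem trans (h₁ : S.IsSolution P k₁ k₂ a b x v) (h₂ : S.IsSolution P k₁ k₂ b c x v)
    (hab : a ≤ b) (hbc : b ≤ c) : S.IsSolution P k₁ k₂ a c x v := by
  obtain ⟨hx₁, w₁, hw₁, hv₁⟩ := h₁
  obtain ⟨hx₂, w₂, hw₂, hv₂⟩ := h₂
  refine ⟨hx₁.trans hx₂ hab hbc, fun s => if s < b then w₁ s else w₂ s, ?_, ?_⟩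
  · filter_upwards [hw₁, hw₂] with s h1 h2 hs
    split_ifs with hsb
    · exact h1 ⟨hs.1, hsb.le⟩
    · exact h2 ⟨not_lt.1 hsb, hs.2⟩
  · refine HasACDeriv.trans (hv₁.congr hab (fun _ _ => rfl) ?_)
      (hv₂.congr hbc (fun _ _ => rfl) ?_) hab hbc
    · exact Eventually.of_forall fun s hs => by simp only [if_pos hs.2]
    · exact Eventually.of_forall fun s hs => by simp only [if_neg (not_lt.2 hs.1.le)]

end System.IsSolution

namespace LyapunovGains

/-- Monotonicity of the Lyapunov function bounds `φ₁(x)` and `z`, hence `x`. The bound on `v = z -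
b⁻¹h` then uses the linear growth of `h` on bounded time intervals. -/
theorem exists_bound (hL : LyapunovGains n P B q k₁ k₂ ε m) (hP : P.Valid) (hB : B.Valid)
    (hS : S.Admissible P B) {t₀ τ : ℝ} (ht₀ : 0 ≤ t₀) (hτ : t₀ < τ)
    (h : ∀ t₁, t₀ ≤ t₁ → t₁ < τ → S.IsSolution P k₁ k₂ t₀ t₁ x v) :
    ∃ R, 0 ≤ R ∧ ∀ t ∈ Ico t₀ τ, ‖x t‖ ≤ R ∧ ‖v t‖ ≤ R := by
  have hm := hL.m_pos
  have hβ := hP.β_pos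
  have hb := hP.b_pos
  set V₀ := lyap P q k₂ (P.φ₁ (x t₀)) (S.z P x v t₀) with hV₀
  set r := √(V₀ / m) with hr
  obtain ⟨H, hH0, hH⟩ := hS.exists_norm_h_le hP hB (ht₀.trans hτ.le)
  have hδ₃ := hB.δ₃_nonneg
  have hV₀' : 0 ≤ V₀ := hL.lyap_nonneg _ _
  have hr0 : 0 ≤ r := Real.sqrt_nonneg _
  have key : ∀ t ∈ Ico t₀ τ, ‖x t‖ ≤ r / P.β ∧ ‖S.z P x v t‖ ≤ r := by
    intro t ht
    have h1 := hL.lyap_antitone hP hB hS ht₀ ht.1 ((h t ht.1 ht.2).transform hS hP hB ht₀ ht.1)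
    have h2 := (hL.le_lyap (P.φ₁ (x t)) (S.z P x v t)).trans h1
    rw [← le_div_iff₀' hm] at h2
    constructor
    · rw [le_div_iff₀' hβ]
      exact (hP.β_mul_le_norm_φ₁ _).trans
        (Real.le_sqrt_of_sq_le (by linarith [sq_nonneg ‖S.z P x v t‖]))
    · exact Real.le_sqrt_of_sq_le (by linarith [sq_nonneg ‖P.φ₁ (x t)‖])
  refine ⟨max (r / P.β) (r + P.b⁻¹ * (H + B.δ₃ * (r / P.β))),
    le_max_of_le_left (by positivity), fun t ht => ?_⟩
  obtain ⟨h1, h2⟩ := key t ht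
  refine ⟨h1.trans (le_max_left _ _), le_trans ?_ (le_max_right _ _)⟩
  have h3 : v t = S.z P x v t - P.b⁻¹ • S.h t (x t) := by
    rw [System.z, add_sub_cancel_right]
  rw [h3]
  refine (norm_sub_le _ _).trans (add_le_add h2 ?_)
  rw [norm_smul, norm_inv, Real.norm_of_nonneg hb.le]
  gcongr
  exact (hH t ⟨ht₀.trans ht.1, ht.2.le⟩ _).trans (by gcongr)

theorem exists_lipschitz (hL : LyapunovGains n P B q k₁ k₂ ε m) (hP : P.Valid) (hB : B.Valid)
    (hS : S.Admissible P B) {t₀ τ : ℝ} (ht₀ : 0 ≤ t₀) (hτ : t₀ < τ)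
    (h : ∀ t₁, t₀ ≤ t₁ → t₁ < τ → S.IsSolution P k₁ k₂ t₀ t₁ x v) :
    ∃ K : NNReal, LipschitzOnWith K x (Ico t₀ τ) ∧ LipschitzOnWith K v (Ico t₀ τ) := by
  obtain ⟨R, hR0, hR⟩ := hL.exists_bound hP hB hS ht₀ hτ h
  obtain ⟨C, hC, hF⟩ := hS.exists_norm_field_le hP hB k₁ (ht₀.trans hτ.le)
  have hψ : 0 ≤ P.ψ (R + 1) := hP.ψ_nonneg (by positivity)
  set K := C * (1 + R + R) + |k₂| * P.ψ (R + 1) with hK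
  have hK1 : C * (1 + R + R) ≤ K := le_add_of_nonneg_right (by positivity)
  have hK2 : |k₂| * P.ψ (R + 1) ≤ K := le_add_of_nonneg_left (by positivity)
  have hK0 : 0 ≤ K := by positivity
  have key : ∀ s ∈ Ico t₀ τ, ∀ t ∈ Ico t₀ τ, s ≤ t →
      ‖x t - x s‖ ≤ K * |t - s| ∧ ‖v t - v s‖ ≤ K * |t - s| := by
    intro s hs t ht hst
    obtain ⟨hx, w, hw, hv⟩ := h t ht.1 ht.2
    have ms : s ∈ Icc t₀ t := ⟨hs.1, hst⟩
    have mt : t ∈ Icc t₀ t := ⟨ht.1, le_rfl⟩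
    have hsub : ∀ σ ∈ uIoc s t, σ ∈ Icc t₀ t := fun σ hσ => by
      rw [uIoc_of_le hst] at hσ
      exact ⟨hs.1.trans hσ.1.le, hσ.2⟩
    constructor
    · rw [hx.sub_eq ms mt]
      refine intervalIntegral.norm_integral_le_of_norm_le_const fun σ hσ => ?_
      have hσ' := hsub σ hσ
      have hRσ := hR σ ⟨hσ'.1, hσ'.2.trans_lt ht.2⟩
      refine ((hF σ ⟨ht₀.trans hσ'.1, hσ'.2.trans ht.2.le⟩ _ _).trans ?_).trans hK1
      exact mul_le_mul_of_nonneg_left (by linarith) hC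
    · rw [hv.sub_eq ms mt]
      refine intervalIntegral.norm_integral_le_of_norm_le_const_ae ?_
      filter_upwards [hw] with σ hσw hσ
      have hσ' := hsub σ hσ
      have hRσ := hR σ ⟨hσ'.1, hσ'.2.trans_lt ht.2⟩
      rw [norm_neg, norm_smul, Real.norm_eq_abs]
      refine le_trans (mul_le_mul_of_nonneg_left ?_ (abs_nonneg _)) hK2
      refine (hP.norm_le_of_mem_filippov (hσw hσ')).trans (hP.monotoneOn_ψ ?_ ?_ ?_)
      · exact (by positivity : 0 ≤ ‖x σ‖ + 1)
      · exact (by positivity : 0 ≤ R + 1)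
      · linarith [hRσ.1]
  refine ⟨Real.toNNReal K, LipschitzOnWith.of_dist_le_mul fun s hs t ht => ?_,
    LipschitzOnWith.of_dist_le_mul fun s hs t ht => ?_⟩
  all_goals
    rw [Real.coe_toNNReal _ hK0, dist_eq_norm, Real.dist_eq]
    rcases le_total s t with hst | hst
  · rw [norm_sub_rev, abs_sub_comm]
    exact (key s hs t ht hst).1
  · exact (key t ht s hs hst).1
  · rw [norm_sub_rev, abs_sub_comm]
    exact (key s hs t ht hst).2
  · exact (key t ht s hs hst).2

/-- Bounded solutions have bounded velocities, so they are Lipschitz on `[t₀, τ)` and extend to the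
closed interval as Lipschitz curves. -/
theorem exists_extension (hL : LyapunovGains n P B q k₁ k₂ ε m) (hP : P.Valid) (hB : B.Valid)
    (hS : S.Admissible P B) {t₀ τ : ℝ} (ht₀ : 0 ≤ t₀) (hτ : t₀ < τ)
    (h : ∀ t₁, t₀ ≤ t₁ → t₁ < τ → S.IsSolution P k₁ k₂ t₀ t₁ x v) :
    ∃ x' v' : ℝ → Vec n, S.IsSolution P k₁ k₂ t₀ τ x' v' ∧
      ∀ t ∈ Ico t₀ τ, x' t = x t ∧ v' t = v t := by
  have hk₂ := hL.k₂_pos.ne'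
  obtain ⟨K, hKx, hKv⟩ := hL.exists_lipschitz hP hB hS ht₀ hτ h
  obtain ⟨X, hX, hXx⟩ := hKx.extend_finite_dimension
  obtain ⟨V, hV, hVv⟩ := hKv.extend_finite_dimension
  obtain ⟨T, -, hTm, hTτ⟩ := exists_seq_strictMono_tendsto' hτ
  have hsol := fun j => h (T j) (hTm j).1.le (hTm j).2
  choose hx w hw hv using hsol
  have hev : ∀ s ∈ Ioo t₀ τ, ∀ᶠ t in 𝓝 s, t ∈ Ico t₀ τ := fun s hs =>
    mem_of_superset (Ioo_mem_nhds hs.1 hs.2) Ioo_subset_Ico_self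
  have hae : ∀ᵐ s, s ∈ Ioo t₀ τ →
      HasDerivAt X (S.field P k₁ s (x s, v s)) s ∧ ∃ y ∈ filippov P.φ₂ (x s),
        HasDerivAt V (-(k₂ • y)) s := by
    have h1 := ae_all_iff.2 fun j => (hx j).ae_hasDerivAt
    have h2 := ae_all_iff.2 fun j => (hv j).ae_hasDerivAt
    have h3 := ae_all_iff.2 hw
    filter_upwards [h1, h2, h3] with s h1 h2 h3 hs
    obtain ⟨j, hj⟩ := (hTτ.eventually (lt_mem_nhds hs.2)).exists
    have hsj : s ∈ Ioo t₀ (T j) := ⟨hs.1, hj⟩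
    refine ⟨(h1 j hsj).congr_of_eventuallyEq ?_, w j s, h3 j (Ioo_subset_Icc_self hsj),
      (h2 j hsj).congr_of_eventuallyEq ?_⟩
    · filter_upwards [hev s hs] with t ht using (hXx ht).symm
    · filter_upwards [hev s hs] with t ht using (hVv ht).symm
  have hne : ∀ᵐ s : ℝ, s ≠ t₀ ∧ s ≠ τ := by
    have h1 : ∀ᵐ s : ℝ, s ≠ t₀ := by simp [ae_iff, measure_singleton]
    have h2 : ∀ᵐ s : ℝ, s ≠ τ := by simp [ae_iff, measure_singleton]
    exact h1.and h2
  -- Each shorter interval comes with its own Filippov selection. Reading the selection off the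
  -- derivative of `V` yields a single one for all of them.
  refine ⟨X, V, ⟨?_, fun s => -(k₂⁻¹ • deriv V s), ?_, ?_⟩,
    fun t ht => ⟨(hXx ht).symm, (hVv ht).symm⟩⟩
  · refine HasACDeriv.of_lipschitzOnWith hτ.le hX.lipschitzOnWith ?_
    filter_upwards [hae] with s hs hs'
    have := (hs hs').1
    rw [hXx (Ioo_subset_Ico_self hs'), hVv (Ioo_subset_Ico_self hs')] at this
    exact this
  · filter_upwards [hae, hne] with s hs hsne hs'
    have hs'' : s ∈ Ioo t₀ τ := ⟨lt_of_le_of_ne hs'.1 hsne.1.symm, lt_of_le_of_ne hs'.2 hsne.2⟩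
    obtain ⟨-, y, hy, hd⟩ := hs hs''
    rw [hd.deriv, smul_neg, neg_neg, inv_smul_smul₀ hk₂, ← hXx (Ioo_subset_Ico_self hs'')]
    exact hy
  · refine HasACDeriv.of_lipschitzOnWith hτ.le hV.lipschitzOnWith ?_
    filter_upwards [hae] with s hs hs'
    obtain ⟨-, y, hy, hd⟩ := hs hs'
    rw [smul_neg, neg_neg, smul_inv_smul₀ hk₂, hd.deriv]
    exact hd

/-- The solution extended to `τ` is concatenated with a global solution issued from its end point.
-/
theorem continuation (hL : LyapunovGains n P B q k₁ k₂ ε m) (hP : P.Valid) (hB : B.Valid)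
    (hS : S.Admissible P B) {t₀ τ : ℝ} (ht₀ : 0 ≤ t₀) (hτ : t₀ < τ)
    (h : ∀ t₁, t₀ ≤ t₁ → t₁ < τ → S.IsSolution P k₁ k₂ t₀ t₁ x v) :
    ∃ x' v' : ℝ → Vec n, S.IsGlobalSolution P k₁ k₂ t₀ x' v' ∧
      ∀ t ∈ Ico t₀ τ, x' t = x t ∧ v' t = v t := by
  obtain ⟨x₁, v₁, hsol₁, heq⟩ := hL.exists_extension hP hB hS ht₀ hτ h
  obtain ⟨x₂, v₂, hsol₂, hx₂, hv₂⟩ := hS.exists_globalSolution hP hB k₁ hL.k₂_pos.ne'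
    (ht₀.trans hτ.le) (x₁ τ) (v₁ τ)
  let X : ℝ → Vec n := fun t => if t ≤ τ then x₁ t else x₂ t
  let V : ℝ → Vec n := fun t => if t ≤ τ then v₁ t else v₂ t
  have hXV : ∀ t, t ≤ τ → X t = x₁ t ∧ V t = v₁ t := fun t ht => ⟨if_pos ht, if_pos ht⟩
  have hXV' : ∀ t, τ ≤ t → X t = x₂ t ∧ V t = v₂ t := by
    intro t ht
    rcases ht.eq_or_lt with rfl | ht
    · rw [hx₂, hv₂]
      exact hXV _ le_rfl
    · exact ⟨if_neg (not_le.2 ht), if_neg (not_le.2 ht)⟩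
  have hleft : S.IsSolution P k₁ k₂ t₀ τ X V :=
    hsol₁.congr hτ.le (fun t ht => (hXV t ht.2).1) fun t ht => (hXV t ht.2).2
  refine ⟨X, V, fun t₁ ht₁ => ?_, fun t ht => ?_⟩
  · rcases le_total t₁ τ with hle | hle
    · exact hleft.mono ht₁ hle
    · exact hleft.trans ((hsol₂ t₁ hle).congr hle (fun t ht => (hXV' t ht.1).1)
        fun t ht => (hXV' t ht.1).2) hτ.le hle
  · rw [(hXV t ht.2.le).1, (hXV t ht.2.le).2]
    exact heq t ht

end LyapunovGains

end

end MGSTA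

end

theorem theorem1 (n : ℕ) (P : MGSTA.Design) (hP : P.Valid) (B : MGSTA.Bounds) (hB : B.Valid)
    (hkey : B.γ₄ + 2 * Real.sqrt (B.γ₃ * B.γ₅) < B.γ₁ * B.gm) :
    ∃ k₁ k₂ : ℝ, 0 < k₁ ∧ 0 < k₂ ∧ MGSTA.GloballyRobustlyFiniteTimeStable n P B k₁ k₂ := by
  obtain ⟨q, k₁, k₂, ε, m, hL⟩ := MGSTA.exists_lyapunovGains n hP hB hkey
  exact ⟨k₁, k₂, hL.k₁_pos, hL.k₂_pos,
    { exists_solution := fun S hS t₀ ht₀ x₀ v₀ =>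
        hS.exists_globalSolution hP hB k₁ hL.k₂_pos.ne' ht₀ x₀ v₀
      continuation := fun S hS t₀ τ ht₀ hτ x v h => hL.continuation hP hB hS ht₀ hτ h
      stable := hL.stable hP hB
      finite_time := hL.finite_time hP hB }⟩
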